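/- Let $A$ be a set of $n$ alternatives (say $A=\{0,\dots,n-1\}$) and let $\mathcal P=(\succ_1,\dots,\succ_t)$ be a list of linear orders over $A$. A permutation $\sigma$ of $[t]$ is a \emph{witness} for $\mathcal P$ if in the list $(\succ_{\sigma(1)},\dots,\succ_{\sigma(t)})$, for all distinct $a,a'\in A$, the positions of the orders that rank $a$ above $a'$ form a prefix or a suffix of $[t]$; $\mathcal P$ is \emph{single-crossing} if it has a witness. For two linear orders let $d(\succ,\succ')=|\{(a,a')\in A^2: a\succ a' \text{ and } a'\succ' a\}|$ be their Kendall tau distance. The machine model is the deterministic unit-cost word RAM with $w$-bit words: a fixed program with finitely many registers and a memory addressed by words, in which each constant assignment, addition, subtraction, multiplication, integer division, remainder, bitwise operation, shift, load, store and comparison costs one step, and control flow is by sequencing, branching and while-loops. The input is $n$, $t$ (in registers) and the $t$ orders, each written as a list of its alternatives from best to worst ($nt$ words). The word length is any $w\ge c\log_2((n+2)(t+2))$, where $c$ is a constant depending only on the program. \textbf{Theorem.} (i) There are a word-RAM program and constants $c,C$ such that for all $n,t\ge 0$, all such inputs $\mathcal P$ and all such $w$ the program halts and decides whether $\mathcal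 P$ is single-crossing; if it is, it outputs a witness $\sigma$, and this $\sigma$ lists the orders (if $t\ge1$) by non-decreasing Kendall tau distance from some order $\succ_x$ that maximizes $d(\succ_1,\succ_x)$. The number of steps is at most $C\,nt\sqrt{\log n}$ whenever $n\ge2$ and $t\ge1$, and at most $C\,(t+1)$ in the degenerate cases $n\le 1$ or $t=0$. (ii) The solution is unique up to reversal: if $\sigma$ and $\tau$ are witnesses for $\mathcal P$, then the list $(\succ_{\sigma(1)},\dots,\succ_{\sigma(t)})$ equals $(\succ_{\tau(1)},\dots,\succ_{\tau(t)})$ or its reverse $(\succ_{\tau(t)},\dots,\succ_{\tau(1)})$. (iii) Let $x$ maximize $d(\succ_1,\succ_x)$ and let $\sigma$ be any permutation that sorts the list by non-decreasing distance $d(\succ_x,\cdot)$, with result $(\succ_1',\dots,\succ_t')$. Then $\mathcal P$ is single-crossing if and only if $\sigma$ is a witness for it, and this holds if and only if $d(\succ_1',\succ_i')+d(\succ_i',\succ_{i+1}')=d(\succ_1',\succ_{i+1}')$ for all $2\le i<t$. -/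

import Mathlib

/-! ### Profiles of linear orders -/

namespace SingleCrossing

/-- A linear order over the alternatives `Fin n`, given as its ranking from best to worst:
`r i` is the alternative in position `i`. -/
abbrev Ranking (n : ℕ) : Type := Equiv.Perm (Fin n)

/-- `a` is ranked above `b` by `r`. -/
abbrev Prefers {n : ℕ} (r : Ranking n) (a b : Fin n) : Prop := r.symm a < r.symm b

/-- A list of `t` linear orders over `n` alternatives. -/
abbrev Profile (n t : ℕ) : Type := Fin t → Ranking n

/-- In the list `Q`, for any two distinct alternatives `a`, `b`, the orders that rank `a` above `b`
form a prefix or a suffix. -/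
def IsSingleCrossingList {n t : ℕ} (Q : Profile n t) : Prop :=
  ∀ a b : Fin n, a ≠ b →
    IsLowerSet {j : Fin t | Prefers (Q j) a b} ∨ IsUpperSet {j : Fin t | Prefers (Q j) a b}

/-- The list `P` permuted by `σ`, namely `P (σ 0), P (σ 1), …`, is single-crossing. -/
def Witnesses {n t : ℕ} (P : Profile n t) (σ : Equiv.Perm (Fin t)) : Prop :=
  IsSingleCrossingList fun i => P (σ i)

/-- The profile can be permuted into a single-crossing list. -/
def IsSingleCrossing {n t : ℕ} (P : Profile n t) : Prop :=
  ∃ σ : Equiv.Perm (Fin t), Witnesses P σ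

/-- Kendall tau distance: the number of pairs of alternatives on which the two orders disagree
(each such pair is counted in the orientation in which `r` ranks it). -/
def kendallTau {n : ℕ} (r s : Ranking n) : ℕ :=
  (Finset.univ.filter fun p : Fin n × Fin n => Prefers r p.1 p.2 ∧ Prefers s p.2 p.1).card

/-- The order with index `x` is at maximum Kendall tau distance from the first order of `P`. -/
def IsFarthestFromFirst {n t : ℕ} (P : Profile n t) (x : Fin t) : Prop :=
  ∀ y : Fin t, kendallTau (P ⟨0, x.pos⟩) (P y) ≤ kendallTau (P ⟨0, x.pos⟩) (P x)

/-- `σ` sorts `P` by non-decreasing Kendall tau distance from the order with index `x`. -/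
def SortsByDistanceFrom {n t : ℕ} (P : Profile n t) (x : Fin t) (σ : Equiv.Perm (Fin t)) : Prop :=
  ∀ i j : Fin t, i ≤ j → kendallTau (P x) (P (σ i)) ≤ kendallTau (P x) (P (σ j))

/-- For the list `Q = (Q 0, …, Q (t - 1))`, every consecutive pair `Q i`, `Q (i + 1)` with `1 ≤ i`
satisfies `d (Q 0) (Q i) + d (Q i) (Q (i + 1)) = d (Q 0) (Q (i + 1))`. -/
def PassesDistanceCheck {n t : ℕ} (Q : Profile n t) : Prop :=
  ∀ (i : ℕ) (_ : 1 ≤ i) (h : i + 1 < t),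
    kendallTau (Q ⟨0, by omega⟩) (Q ⟨i, by omega⟩) + kendallTau (Q ⟨i, by omega⟩) (Q ⟨i + 1, h⟩)
      = kendallTau (Q ⟨0, by omega⟩) (Q ⟨i + 1, h⟩)

end SingleCrossing

/-! ### The unit-cost word RAM -/

namespace WordRAM

/-- The binary operations on words. -/
inductive BinOp : Type
  | add | sub | mul | div | mod | band | bor | bxor | shl | shr

/-- The operations on `w`-bit words, seen as natural numbers below `2 ^ w`: addition, subtraction,
multiplication and left shift modulo `2 ^ w`, integer quotient (`0` if the divisor is `0`) and
remainder, bitwise and, or, exclusive or, and right shift. -/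
def BinOp.eval (w : ℕ) : BinOp → ℕ → ℕ → ℕ
  | .add, a, b => (a + b) % 2 ^ w
  | .sub, a, b => (a + (2 ^ w - b)) % 2 ^ w
  | .mul, a, b => (a * b) % 2 ^ w
  | .div, a, b => (a / b) % 2 ^ w
  | .mod, a, b => (a % b) % 2 ^ w
  | .band, a, b => (a &&& b) % 2 ^ w
  | .bor, a, b => (a ||| b) % 2 ^ w
  | .bxor, a, b => (a ^^^ b) % 2 ^ w
  | .shl, a, b => (a <<< b) % 2 ^ w
  | .shr, a, b => (a >>> b) % 2 ^ w

/-- Programs. A program is a finite object that does not depend on the word length; it mentions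
finitely many registers. -/
inductive Prog : Type
  /-- `reg d := c` -/
  | const (d c : ℕ)
  /-- `reg d := reg a ∘ reg b` -/
  | op (o : BinOp) (d a b : ℕ)
  /-- `reg d := mem (reg a)` -/
  | load (d a : ℕ)
  /-- `mem (reg a) := reg b` -/
  | store (a b : ℕ)
  /-- first `p`, then `q` -/
  | seq (p q : Prog)
  /-- if `reg a < reg b` then `p` else `q` -/
  | branch (a b : ℕ) (p q : Prog)
  /-- while `reg a < reg b` do `p` -/
  | loop (a b : ℕ) (p : Prog)

/-- Contents of the registers and of the memory cells. -/
structure State : Type where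
  reg : ℕ → ℕ
  mem : ℕ → ℕ

/-- `Exec w p s k s'`: with word length `w`, the program `p` started in state `s` halts after
exactly `k` steps in state `s'`. Every assignment, memory access and comparison is one step. -/
inductive Exec (w : ℕ) : Prog → State → ℕ → State → Prop
  | const (d c : ℕ) (s : State) :
      Exec w (.const d c) s 1 ⟨Function.update s.reg d (c % 2 ^ w), s.mem⟩
  | op (o : BinOp) (d a b : ℕ) (s : State) :
      Exec w (.op o d a b) s 1 ⟨Function.update s.reg d (o.eval w (s.reg a) (s.reg b)), s.mem⟩
  | load (d a : ℕ) (s : State) :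
      Exec w (.load d a) s 1 ⟨Function.update s.reg d (s.mem (s.reg a)), s.mem⟩
  | store (a b : ℕ) (s : State) :
      Exec w (.store a b) s 1 ⟨s.reg, Function.update s.mem (s.reg a) (s.reg b)⟩
  | seq {p q : Prog} {s s' s'' : State} {k l : ℕ} :
      Exec w p s k s' → Exec w q s' l s'' → Exec w (.seq p q) s (k + l) s''
  | branch_true {a b : ℕ} {p q : Prog} {s s' : State} {k : ℕ} :
      s.reg a < s.reg b → Exec w p s k s' → Exec w (.branch a b p q) s (k + 1) s'
  | branch_false {a b : ℕ} {p q : Prog} {s s' : State} {k : ℕ} :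
      ¬ s.reg a < s.reg b → Exec w q s k s' → Exec w (.branch a b p q) s (k + 1) s'
  | loop_done {a b : ℕ} {p : Prog} {s : State} :
      ¬ s.reg a < s.reg b → Exec w (.loop a b p) s 1 s
  | loop_step {a b : ℕ} {p : Prog} {s s' s'' : State} {k l : ℕ} :
      s.reg a < s.reg b → Exec w p s k s' → Exec w (.loop a b p) s' l s'' →
        Exec w (.loop a b p) s (k + l + 1) s''

/-- The machine is deterministic: final state and step count are determined by the start. -/
theorem Exec.deterministic {w : ℕ} {p : Prog} {s s₁ s₂ : State} {k₁ k₂ : ℕ}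
    (h₁ : Exec w p s k₁ s₁) (h₂ : Exec w p s k₂ s₂) : k₁ = k₂ ∧ s₁ = s₂ := by
  induction h₁ generalizing k₂ s₂ with
  | const | op | load | store => cases h₂; exact ⟨rfl, rfl⟩
  | seq _ _ ih₁ ih₂ =>
    cases h₂ with
    | seq g₁ g₂ =>
      obtain ⟨rfl, rfl⟩ := ih₁ g₁
      obtain ⟨rfl, rfl⟩ := ih₂ g₂
      exact ⟨rfl, rfl⟩
  | branch_true h _ ih =>
    cases h₂ with
    | branch_true _ g => obtain ⟨rfl, rfl⟩ := ih g; exact ⟨rfl, rfl⟩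
    | branch_false h' _ => exact absurd h h'
  | branch_false h _ ih =>
    cases h₂ with
    | branch_true h' _ => exact absurd h' h
    | branch_false _ g => obtain ⟨rfl, rfl⟩ := ih g; exact ⟨rfl, rfl⟩
  | loop_done h =>
    cases h₂ with
    | loop_done _ => exact ⟨rfl, rfl⟩
    | loop_step h' _ _ => exact absurd h' h
  | loop_step h _ _ ih₁ ih₂ =>
    cases h₂ with
    | loop_done h' => exact absurd h h'
    | loop_step _ g₁ g₂ =>
      obtain ⟨rfl, rfl⟩ := ih₁ g₁
      obtain ⟨rfl, rfl⟩ := ih₂ g₂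
      exact ⟨rfl, rfl⟩

end WordRAM

namespace SingleCrossing

/-- Initial state on input `P`: register `0` holds `n`, register `1` holds `t`, memory cell
`j * n + i` holds the alternative in position `i` of the `j`-th order, all else is `0`. -/
def inputState {n t : ℕ} (P : Profile n t) : WordRAM.State where
  reg := fun r => if r = 0 then n else if r = 1 then t else 0
  mem := fun a =>
    if h : a < n * t then
      (P ⟨a / n, Nat.div_lt_of_lt_mul h⟩
        ⟨a % n, Nat.mod_lt a (Nat.pos_of_mul_pos_right (Nat.zero_lt_of_lt h))⟩ : ℕ)
    else 0

/-- Final state that answers yes (register `0` holds `1`) and presents the permutation `σ` in the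
memory cells `0, …, t - 1`. -/
def OutputsYes {t : ℕ} (s : WordRAM.State) (σ : Equiv.Perm (Fin t)) : Prop :=
  s.reg 0 = 1 ∧ ∀ i : Fin t, s.mem i = (σ i : ℕ)

/-- Final state that answers no (register `0` holds `0`). -/
def OutputsNo (s : WordRAM.State) : Prop :=
  s.reg 0 = 0

end SingleCrossing

set_option linter.unusedSimpArgs false
set_option linter.constructorNameAsVariable false

/-! Order-theoretic part. Call `s` between `r` and `u` if it ranks every pair as they do whenever
these two agree. The defect in the triangle inequality for Kendall tau distance is twice the number
of pairs on which `s` contradicts a common opinion of `r` and `u` (`kendallTau_add`), so betweenness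
is equality in the triangle inequality (`between_iff`). A list is single-crossing exactly if each
member is between any earlier and any later one (`isSingleCrossingList_iff`), and betweenness with
respect to the first member alone already suffices. Distances from an end of such a list therefore
add up along it. An order farthest from some member must equal an end
(`IsSingleCrossingList.eq_end`), and orders equally far from that end coincide. After a possible
reversal, every witness thus starts with the farthest order and sorts the list by distance from it.
This gives uniqueness (`witnesses_unique`), the correctness of sorting
(`IsSingleCrossing.witnesses`), and a test that compares only neighbours
(`isSingleCrossingList_iff_passesDistanceCheck`).

Algorithmic part. About `3 * t` distances suffice, so each may cost `O(n √log n)`. A distance is the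
inversion number of a permutation, padded to length `N = 2 ^ L` (`inv_map_relPos`). An inversion is
charged to the highest bit on which its two entries differ. Sorting stably bit by bit from the top,
one counts at each bit the pairs with a one before a zero inside each group of entries that share
all higher bits (`groupInv_succ`). Done entry by entry, this would cost `N` per bit.

To save a factor `√L`, let `g = 2 ^ γ` be of the order of `√L`. A round treats `g` consecutive bits:
one bucket sort and one packing of the relevant `g`-bit digits, `g` digits to a word, cost `O(N)`;
then each of the `g` levels handles `N / g` words by table lookup (`levelPass_spec`). So a round
costs `O(N)`, and there are about `L / g` rounds. The lowest `γ` bits are left to a quadratic count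
inside groups of `g` entries, for `O(N * g)` in total. The tables have about `g * 2 ^ (g * g)`
entries, which is small against `N`.

Machine part. The program is written in a small structured language over natural numbers with
unbounded arrays. `Cmd.compile_exec` shows that compiled code simulates it with the exact step count
as long as nothing overflows; safety, cost and result are then proved together by weakest
preconditions (`wp`). -/

namespace SingleCrossing

/-! ### A small imperative language that compiles to the word RAM -/

/-- Variables of the high-level language. -/
inductive Var : Type
  | n | t | L | N | gam | g | D | W | R | nW
  | r | lo | top | s | bit | beta | nS
  | m | H | i | key | c
  | acc | accP | oi | y | yp
  | wm | ng | q | wi | ix | ones | tot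
  | tb | tj | x | y0 | p0 | y1 | p1 | tc | ti | hb | d
  | X | Y | bj | bk
  | yy | best | xb | ok | t1
  deriving DecidableEq

/-- Arrays of the high-level language; `io` is the memory segment with the input and the output. -/
inductive Arr : Type
  | io | PW | TY0 | TP0 | TY1 | TP1 | TC | TI | POS | SQ | SRC | KEY | CNT | DST | OUT | A | D2 | SIG
  deriving DecidableEq

theorem Var.ctorIdx_injective : Function.Injective Var.ctorIdx := by
  intro a b h
  have := congrArg Var.ofNat h
  rwa [Var.ofNat_ctorIdx, Var.ofNat_ctorIdx] at this

theorem Arr.ctorIdx_injective : Function.Injective Arr.ctorIdx := by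
  intro a b h
  have := congrArg Arr.ofNat h
  rwa [Arr.ofNat_ctorIdx, Arr.ofNat_ctorIdx] at this

/-- A variable lives in the register numbered by its constructor, so register 99 is free for the
array base and scratch starts at 100. The order of constructors matters: `n` and `t` come first,
hence sit in registers 0 and 1, where the input arrives; `n` finally carries the answer. -/
theorem Var.ctorIdx_lt (x : Var) : x.ctorIdx < 99 := by cases x <;> decide

theorem Arr.ctorIdx_lt (k : Arr) : k.ctorIdx < 32 := by cases k <;> decide

/-- Contents of the variables and arrays. -/
structure Store : Type where
  v : Var → ℕ
  a : Arr → ℕ → ℕ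

namespace Store

/-- Assignment to a variable. -/
def setv (s : Store) (x : Var) (y : ℕ) : Store := ⟨Function.update s.v x y, s.a⟩

/-- Assignment to an array cell. -/
def seta (s : Store) (k : Arr) (i y : ℕ) : Store :=
  ⟨s.v, Function.update s.a k (Function.update (s.a k) i y)⟩

variable (s : Store) (x z : Var) (k l : Arr) (i j y : ℕ)

@[simp] theorem setv_v : (s.setv x y).v z = if z = x then y else s.v z := by
  simp [setv, Function.update_apply]

@[simp] theorem setv_a : (s.setv x y).a = s.a := rfl

@[simp] theorem seta_v : (s.seta k i y).v = s.v := rfl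

@[simp] theorem seta_a : (s.seta k i y).a l =
    if l = k then Function.update (s.a k) i y else s.a l := by
  by_cases h : l = k
  · subst h; simp [seta]
  · simp [seta, h]

end Store

/-- Binary operations on natural numbers. -/
inductive Op : Type
  | add | sub | mul | div | mod

/-- Value of a binary operation. -/
def Op.eval : Op → ℕ → ℕ → ℕ
  | .add, a, b => a + b
  | .sub, a, b => a - b
  | .mul, a, b => a * b
  | .div, a, b => a / b
  | .mod, a, b => a % b

/-- The operation neither overflows the bound `U` nor underflows. -/
def Op.Safe (U : ℕ) : Op → ℕ → ℕ → Prop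
  | .add, a, b => a + b < U
  | .sub, a, b => b ≤ a
  | .mul, a, b => a * b < U
  | .div, _, _ => True
  | .mod, _, _ => True

/-- The corresponding machine operation. -/
def Op.toBinOp : Op → WordRAM.BinOp
  | .add => .add
  | .sub => .sub
  | .mul => .mul
  | .div => .div
  | .mod => .mod

/-- Expressions. -/
inductive Expr : Type
  | lit (c : ℕ)
  | var (x : Var)
  | bin (o : Op) (e f : Expr)
  | get (k : Arr) (e : Expr)

namespace Expr

instance : Add Expr := ⟨.bin .add⟩
instance : Sub Expr := ⟨.bin .sub⟩
instance : Mul Expr := ⟨.bin .mul⟩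
instance : Div Expr := ⟨.bin .div⟩
instance : Mod Expr := ⟨.bin .mod⟩
instance (c : ℕ) : OfNat Expr c := ⟨.lit c⟩
instance : Coe Var Expr := ⟨.var⟩

/-- Value of an expression. -/
def eval : Expr → Store → ℕ
  | lit c, _ => c
  | var x, s => s.v x
  | bin o e f, s => o.eval (e.eval s) (f.eval s)
  | get k e, s => s.a k (e.eval s)

/-- Every intermediate result is below `U`, and `io` is only read below `B`. -/
def Safe (U B : ℕ) : Expr → Store → Prop
  | lit _, _ => True
  | var _, _ => True
  | bin o e f, s => e.Safe U B s ∧ f.Safe U B s ∧ o.Safe U (e.eval s) (f.eval s)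
  | get k e, s => e.Safe U B s ∧ (k = .io → e.eval s < B)

/-- Number of machine steps. -/
def cost : Expr → ℕ
  | lit _ => 1
  | var _ => 1
  | bin _ e f => e.cost + f.cost + 1
  | get k e => e.cost + (if k = .io then 0 else 5) + 1

/-- All literals are small. -/
def wf : Expr → Bool
  | lit c => decide (c < 64)
  | var _ => true
  | bin _ e f => e.wf && f.wf
  | get _ e => e.wf

end Expr

/-- Commands. -/
inductive Cmd : Type
  | skip
  | set (x : Var) (e : Expr)
  | put (k : Arr) (i e : Expr)
  | seq (c d : Cmd)
  /-- if `e < f` then `c` else `d` -/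
  | ite (e f : Expr) (c d : Cmd)
  /-- for `x = 0, …, b - 1` do `c` -/
  | loop (x b : Var) (c : Cmd)

infixr:50 " ;; " => Cmd.seq

/-- State after `i` rounds of a loop with counter `x`. -/
def iter (f : Store → Store) (x : Var) (s : Store) : ℕ → Store
  | 0 => s.setv x 0
  | i + 1 => (f (iter f x s i)).setv x (i + 1)

namespace Cmd

/-- Final state. -/
def run : Cmd → Store → Store
  | skip, s => s
  | set x e, s => s.setv x (e.eval s)
  | put k i e, s => s.seta k (i.eval s) (e.eval s)
  | seq c d, s => d.run (c.run s)
  | ite e f c d, s => if e.eval s < f.eval s then c.run s else d.run s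
  | loop x b c, s => iter (fun s => c.run s) x s (s.v b)

/-- Number of machine steps. -/
def cost : Cmd → Store → ℕ
  | skip, _ => 1
  | set _ e, _ => e.cost + 1
  | put k i e, _ => i.cost + (if k = .io then 0 else 5) + e.cost + 1
  | seq c d, s => c.cost s + d.cost (c.run s)
  | ite e f c d, s => e.cost + f.cost + 1 + if e.eval s < f.eval s then c.cost s else d.cost s
  | loop x b c, s =>
    2 + ∑ i ∈ Finset.range (s.v b), (c.cost (iter c.run x s i) + 3)

/-- No overflow occurs, and `io` is only accessed below `B`. -/
def Safe (U B : ℕ) : Cmd → Store → Prop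
  | skip, _ => True
  | set _ e, s => e.Safe U B s
  | put k i e, s => i.Safe U B s ∧ e.Safe U B s ∧ (k = .io → i.eval s < B)
  | seq c d, s => c.Safe U B s ∧ d.Safe U B (c.run s)
  | ite e f c d, s => e.Safe U B s ∧ f.Safe U B s ∧
      (e.eval s < f.eval s → c.Safe U B s) ∧ (¬ e.eval s < f.eval s → d.Safe U B s)
  | loop x b c, s => ∀ i < s.v b, c.Safe U B (iter c.run x s i)

/-- The command may change the variable `z`. -/
def writes : Cmd → Var → Bool
  | skip, _ => false
  | set x _, z => decide (x = z)
  | put _ _ _, _ => false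
  | seq c d, z => c.writes z || d.writes z
  | ite _ _ c d, z => c.writes z || d.writes z
  | loop x _ c, z => decide (x = z) || c.writes z

/-- The command may change the array `l`. -/
def writesA : Cmd → Arr → Bool
  | skip, _ => false
  | set _ _, _ => false
  | put k _ _, l => decide (k = l)
  | seq c d, l => c.writesA l || d.writesA l
  | ite _ _ c d, l => c.writesA l || d.writesA l
  | loop _ _ c, l => c.writesA l

/-- Loops do not change their counters and bounds. -/
def wf : Cmd → Bool
  | skip => true
  | set _ e => e.wf
  | put _ i e => i.wf && e.wf
  | seq c d => c.wf && d.wf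
  | ite e f c d => e.wf && f.wf && c.wf && d.wf
  | loop x b c => c.wf && !c.writes x && !c.writes b && decide (x ≠ b)

/-- `writes` is a computable over-approximation, so later frame obligations close by `rfl` or
`decide`. -/
theorem run_v_of_not_writes (c : Cmd) (s : Store) {z : Var} (h : c.writes z = false) :
    (c.run s).v z = s.v z := by
  induction c generalizing s with
  | skip => rfl
  | set x e =>
    simp only [writes, decide_eq_false_iff_not] at h
    simp [run, Ne.symm h]
  | put => rfl
  | seq c d ihc ihd =>
    simp only [writes, Bool.or_eq_false_iff] at h
    rw [run, ihd _ h.2, ihc _ h.1]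
  | ite e f c d ihc ihd =>
    simp only [writes, Bool.or_eq_false_iff] at h
    rw [run]; split_ifs
    exacts [ihc _ h.1, ihd _ h.2]
  | loop x b c ih =>
    simp only [writes, Bool.or_eq_false_iff, decide_eq_false_iff_not] at h
    have : ∀ i, (iter c.run x s i).v z = s.v z := by
      intro i
      induction i with
      | zero => simp [iter, Ne.symm h.1]
      | succ i ihi => simp [iter, Ne.symm h.1, ih _ h.2, ihi]
    exact this _

theorem run_a_of_not_writesA (c : Cmd) (s : Store) {l : Arr} (h : c.writesA l = false) :
    (c.run s).a l = s.a l := by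
  induction c generalizing s with
  | skip => rfl
  | set => rfl
  | put k =>
    simp only [writesA, decide_eq_false_iff_not] at h
    simp [run, Ne.symm h]
  | seq c d ihc ihd =>
    simp only [writesA, Bool.or_eq_false_iff] at h
    rw [run, ihd _ h.2, ihc _ h.1]
  | ite e f c d ihc ihd =>
    simp only [writesA, Bool.or_eq_false_iff] at h
    rw [run]; split_ifs
    exacts [ihc _ h.1, ihd _ h.2]
  | loop x b c ih =>
    simp only [writesA] at h
    have : ∀ i, (iter c.run x s i).a l = s.a l := by
      intro i
      induction i with
      | zero => simp [iter]
      | succ i ihi => simp [iter, ih _ h, ihi]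
    exact this _

end Cmd

/-! ### Compilation -/

/-- The register that holds the bound `B`, above which the arrays are interleaved. -/
abbrev baseReg : ℕ := 99

/-- The scratch registers. -/
abbrev tmp (d : ℕ) : ℕ := 100 + d

open WordRAM (Prog)

/-- Turns the index in scratch register `d` into an address in the array `k`. -/
def compileAddr (d : ℕ) (k : Arr) : Prog :=
  .seq (.const (tmp (d + 1)) 32) (.seq (.op .mul (tmp d) (tmp d) (tmp (d + 1)))
    (.seq (.const (tmp (d + 1)) k.ctorIdx) (.seq (.op .add (tmp d) (tmp d) (tmp (d + 1)))
      (.op .add (tmp d) (tmp d) baseReg))))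

/-- Evaluates the expression into scratch register `d`. -/
def Expr.compile : ℕ → Expr → Prog
  | d, lit c => .const (tmp d) c
  -- The machine has no register move; the bitwise or of a register with itself copies it.
  | d, var x => .op .bor (tmp d) x.ctorIdx x.ctorIdx
  | d, bin o e f =>
    .seq (.seq (e.compile d) (f.compile (d + 1))) (.op o.toBinOp (tmp d) (tmp d) (tmp (d + 1)))
  | d, get k e =>
    if k = .io then .seq (e.compile d) (.load (tmp d) (tmp d))
    else .seq (.seq (e.compile d) (compileAddr d k)) (.load (tmp d) (tmp d))

/-- Machine program of a command. -/
def Cmd.compile : Cmd → Prog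
  | skip => .const (tmp 0) 0
  | set x e => .seq (e.compile 0) (.op .bor x.ctorIdx (tmp 0) (tmp 0))
  | put k i e =>
    if k = .io then .seq (.seq (i.compile 0) (e.compile 1)) (.store (tmp 0) (tmp 1))
    else .seq (.seq (.seq (i.compile 0) (compileAddr 0 k)) (e.compile 1)) (.store (tmp 0) (tmp 1))
  | seq c d => .seq c.compile d.compile
  | ite e f c d =>
    .seq (.seq (e.compile 0) (f.compile 1)) (.branch (tmp 0) (tmp 1) c.compile d.compile)
  | loop x b c =>
    .seq (.const x.ctorIdx 0) (.loop x.ctorIdx b.ctorIdx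
      (.seq c.compile (.seq (.const (tmp 0) 1) (.op .add x.ctorIdx x.ctorIdx (tmp 0)))))

end SingleCrossing

/-! ### Correctness of the compiler. -/

namespace SingleCrossing

open WordRAM (Prog Exec)

theorem Op.eval_lt {U : ℕ} {o : Op} {a b : ℕ} (ha : a < U) (h : o.Safe U a b) :
    o.eval a b < U := by
  cases o with
  | add | mul => exact h
  | sub => exact (Nat.sub_le _ _).trans_lt ha
  | div => exact (Nat.div_le_self _ _).trans_lt ha
  | mod => exact (Nat.mod_le _ _).trans_lt ha

/-- Safety excludes wrap-around. For subtraction, `b ≤ a` makes the machine's `a + (2 ^ w - b)`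
exceed `a - b` by exactly one modulus. -/
theorem Op.toBinOp_eval {U w : ℕ} (hU : U ≤ 2 ^ w) {o : Op} {a b : ℕ} (ha : a < U)
    (h : o.Safe U a b) : o.toBinOp.eval w a b = o.eval a b := by
  have hlt := (Op.eval_lt ha h).trans_le hU
  cases o with
  | add | mul | div | mod => exact Nat.mod_eq_of_lt hlt
  | sub =>
    simp only [Op.Safe] at h
    simp only [toBinOp, WordRAM.BinOp.eval, Op.eval] at hlt ⊢
    have hb : b ≤ 2 ^ w := h.trans (ha.le.trans hU)
    have : a + (2 ^ w - b) = a - b + 2 ^ w := by omega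
    rw [this, Nat.add_mod_right, Nat.mod_eq_of_lt hlt]

/-- All contents are below `U`. -/
structure Store.Bounded (U : ℕ) (s : Store) : Prop where
  v : ∀ x, s.v x < U
  a : ∀ k i, s.a k i < U

/-- The machine state represents the store. -/
structure Rep (B : ℕ) (s : Store) (ls : WordRAM.State) : Prop where
  reg : ∀ x : Var, ls.reg x.ctorIdx = s.v x
  base : ls.reg baseReg = B
  io : ∀ i < B, ls.mem i = s.a .io i
  arr : ∀ k : Arr, k ≠ .io → ∀ i, ls.mem (i * 32 + k.ctorIdx + B) = s.a k i

/-- Scratch registers, from 100 on, are not part of the represented store. -/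
theorem Rep.congr {B : ℕ} {s : Store} {ls ls' : WordRAM.State} (h : Rep B s ls)
    (hr : ∀ r < 100, ls'.reg r = ls.reg r) (hm : ls'.mem = ls.mem) : Rep B s ls' where
  reg x := (hr _ (x.ctorIdx_lt.trans (by norm_num))).trans (h.reg x)
  base := (hr _ (by norm_num)).trans h.base
  io := by rw [hm]; exact h.io
  arr := by rw [hm]; exact h.arr

theorem Expr.eval_lt {U B : ℕ} (hU : 64 ≤ U) {s : Store} (hb : s.Bounded U) :
    ∀ {e : Expr}, e.wf → e.Safe U B s → e.eval s < U
  | lit c, hw, _ => by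
    simp only [wf, decide_eq_true_eq] at hw
    exact hw.trans_le hU
  | var x, _, _ => hb.v x
  | bin o e f, hw, hs => by
    simp only [wf, Bool.and_eq_true] at hw
    exact Op.eval_lt (eval_lt hU hb hw.1 hs.1) hs.2.2
  | get k e, _, _ => hb.a k _

/-- The word length accommodates values below `U` and the addresses of all arrays. -/
structure Fits (w U B : ℕ) : Prop where
  lit_lt : 64 ≤ U
  addr_lt : U * 32 + 32 + B ≤ 2 ^ w

theorem Fits.le {w U B : ℕ} (h : Fits w U B) : U ≤ 2 ^ w := by
  have := h.addr_lt; omega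

section

variable {w U B : ℕ}

theorem compileAddr_exec (hF : Fits w U B) {d i : ℕ} {k : Arr} (ls : WordRAM.State)
    (hbase : ls.reg baseReg = B) (hi : ls.reg (tmp d) = i) (hlt : i < U) :
    ∃ ls', Exec w (compileAddr d k) ls 5 ls' ∧ ls'.reg (tmp d) = i * 32 + k.ctorIdx + B ∧
      ls'.mem = ls.mem ∧ ∀ r < tmp d, ls'.reg r = ls.reg r := by
  have hk := k.ctorIdx_lt
  have hA := hF.addr_lt
  refine ⟨_, .seq (.const _ _ _) (.seq (.op _ _ _ _ _) (.seq (.const _ _ _)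
    (.seq (.op _ _ _ _ _) (.op _ _ _ _ _)))), ?_, rfl, ?_⟩
  · have h1 : ¬ baseReg = 100 + d := by unfold baseReg; omega
    have h2 : ¬ baseReg = 100 + (d + 1) := by unfold baseReg; omega
    have e1 : 32 % 2 ^ w = 32 := Nat.mod_eq_of_lt (by omega)
    have e2 : k.ctorIdx % 2 ^ w = k.ctorIdx := Nat.mod_eq_of_lt (by omega)
    simp [WordRAM.BinOp.eval, hi, h1, h2, hbase, e1, e2]
    rw [Nat.mod_eq_of_lt (by omega)]
  · intro r hr
    have h1 : ¬ r = 100 + d := by simp only [tmp] at hr; omega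
    have h2 : ¬ r = 100 + (d + 1) := by simp only [tmp] at hr; omega
    simp [Function.update_apply, h1, h2]

/-- Scratch registers are used as a stack: evaluation at depth `d` leaves everything below `tmp d`
intact, so a first operand survives the evaluation of the second. -/
theorem Expr.compile_exec (hF : Fits w U B) {s : Store} (hb : s.Bounded U) {e : Expr} (hw : e.wf)
    (hs : e.Safe U B s) (d : ℕ) {ls : WordRAM.State} (h : Rep B s ls) :
    ∃ ls', Exec w (e.compile d) ls e.cost ls' ∧ ls'.reg (tmp d) = e.eval s ∧
      ls'.mem = ls.mem ∧ ∀ r < tmp d, ls'.reg r = ls.reg r := by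
  have hU := hF.le
  induction e generalizing d ls with
  | lit c =>
    simp only [wf, decide_eq_true_eq] at hw
    refine ⟨_, .const _ _ _, ?_, rfl, fun r hr => ?_⟩
    · simp [eval, Nat.mod_eq_of_lt (show c < 2 ^ w by have := hF.lit_lt; omega)]
    · simp [Function.update_of_ne hr.ne]
  | var x =>
    refine ⟨_, .op _ _ _ _ _, ?_, rfl, fun r hr => ?_⟩
    · simp [WordRAM.BinOp.eval, eval, h.reg, Nat.mod_eq_of_lt ((hb.v x).trans_le hU)]
    · simp [Function.update_of_ne hr.ne]
  | bin o e f ihe ihf =>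
    simp only [wf, Bool.and_eq_true] at hw
    obtain ⟨l1, x1, r1, m1, f1⟩ := ihe hw.1 hs.1 d h
    have h1 : Rep B s l1 := h.congr (fun r hr => f1 r (by simp only [tmp]; omega)) m1
    obtain ⟨l2, x2, r2, m2, f2⟩ := ihf hw.2 hs.2.1 (d + 1) h1
    refine ⟨_, .seq (.seq x1 x2) (.op _ _ _ _ _), ?_, m2.trans m1, fun r hr => ?_⟩
    · simp only [Function.update_self]
      rw [f2 _ (by simp [tmp]), r1, r2,
        Op.toBinOp_eval hU (Expr.eval_lt hF.lit_lt hb hw.1 hs.1) hs.2.2, eval]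
    · simp only [Function.update_of_ne hr.ne]
      rw [f2 r (by simp only [tmp] at hr ⊢; omega), f1 r hr]
  | get k e ih =>
    obtain ⟨l1, x1, r1, m1, f1⟩ := ih hw hs.1 d h
    by_cases hk : k = .io
    · subst hk
      rw [compile, if_pos rfl, cost, if_pos rfl]
      refine ⟨_, .seq x1 (.load _ _ _), ?_, m1, fun r hr => ?_⟩
      · simp only [Function.update_self]
        rw [r1, m1, h.io _ (hs.2 rfl), eval]
      · simp only [Function.update_of_ne hr.ne, f1 r hr]
    · rw [compile, if_neg hk, cost, if_neg hk]
      obtain ⟨l2, x2, r2, m2, f2⟩ := compileAddr_exec hF (k := k) l1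
        ((f1 _ (by simp only [tmp, baseReg]; omega)).trans h.base) r1 (Expr.eval_lt hF.lit_lt hb hw hs.1)
      refine ⟨_, .seq (.seq x1 x2) (.load _ _ _), ?_, m2.trans m1, fun r hr => ?_⟩
      · simp only [Function.update_self]
        rw [r2, m2, m1, h.arr k hk, eval]
      · simp only [Function.update_of_ne hr.ne, f2 r hr, f1 r hr]

theorem Store.Bounded.setv {s : Store} (hb : s.Bounded U) (x : Var) {y : ℕ} (hy : y < U) :
    (s.setv x y).Bounded U where
  v z := by rw [setv_v]; split_ifs; exacts [hy, hb.v z]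
  a := hb.a

theorem Store.Bounded.seta {s : Store} (hb : s.Bounded U) (k : Arr) (i : ℕ) {y : ℕ} (hy : y < U) :
    (s.seta k i y).Bounded U where
  v := hb.v
  a l j := by
    rw [seta_a]; split_ifs
    · rw [Function.update_apply]; split_ifs
      exacts [hy, hb.a _ _]
    · exact hb.a _ _

theorem Rep.setv {s : Store} {ls : WordRAM.State} (h : Rep B s ls) (x : Var) {y y' : ℕ}
    (hy : y' = y) : Rep B (s.setv x y) ⟨Function.update ls.reg x.ctorIdx y', ls.mem⟩ where
  reg z := by
    simp only [Store.setv_v, Function.update_apply, h.reg, Var.ctorIdx_injective.eq_iff, hy]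
  base := by
    simp only
    rw [Function.update_of_ne x.ctorIdx_lt.ne', h.base]
  io := h.io
  arr := h.arr

theorem Rep.seta_io {s : Store} {ls : WordRAM.State} (h : Rep B s ls) {i y : ℕ} (hi : i < B) :
    Rep B (s.seta .io i y) ⟨ls.reg, Function.update ls.mem i y⟩ where
  reg := h.reg
  base := h.base
  io j hj := by
    simp only [Store.seta_a, if_true, Function.update_apply, h.io j hj]
  arr k hk j := by
    simp only [Store.seta_a, if_neg hk]
    rw [Function.update_of_ne (by omega), h.arr k hk]

/-- Above `B` the arrays are interleaved with stride 32, one residue for each array, so no two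
arrays overlap and none needs a declared size. -/
theorem Rep.seta {s : Store} {ls : WordRAM.State} (h : Rep B s ls) {k : Arr} (hk : k ≠ .io)
    {i y : ℕ} :
    Rep B (s.seta k i y) ⟨ls.reg, Function.update ls.mem (i * 32 + k.ctorIdx + B) y⟩ where
  reg := h.reg
  base := h.base
  io j hj := by
    simp only [Store.seta_a, if_neg hk.symm]
    rw [Function.update_of_ne (by omega), h.io j hj]
  arr l hl j := by
    have h1 := k.ctorIdx_lt
    have h2 := l.ctorIdx_lt
    by_cases hlk : l = k
    · subst hlk
      simp only [Store.seta_a, if_true, Function.update_apply, h.arr l hl j]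
      exact if_congr (by omega) rfl rfl
    · have : l.ctorIdx ≠ k.ctorIdx := fun e => hlk (Arr.ctorIdx_injective e)
      simp only [Store.seta_a, if_neg hlk]
      rw [Function.update_of_ne (by omega), h.arr l hl]

/-- Simulation by induction on the command. The cost function mirrors the emitted code, so the step
count is an equality, and boundedness is carried along because it gives safety its meaning. -/
theorem Cmd.compile_exec (hF : Fits w U B) {c : Cmd} (hw : c.wf) {s : Store} (hb : s.Bounded U)
    (hs : c.Safe U B s) {ls : WordRAM.State} (h : Rep B s ls) :
    ∃ ls', Exec w c.compile ls (c.cost s) ls' ∧ Rep B (c.run s) ls' ∧ (c.run s).Bounded U := by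
  have hU := hF.le
  induction c generalizing s ls with
  | skip =>
    exact ⟨_, .const _ _ _, h.congr (fun r hr => Function.update_of_ne (by simp [tmp]; omega) _ _)
      rfl, hb⟩
  | set x e =>
    obtain ⟨l1, x1, r1, m1, f1⟩ := Expr.compile_exec hF hb hw hs 0 h
    have h1 : Rep B s l1 := h.congr f1 m1
    have hlt := Expr.eval_lt hF.lit_lt hb hw hs
    refine ⟨_, .seq x1 (.op _ _ _ _ _), h1.setv x ?_, hb.setv x hlt⟩
    simp [WordRAM.BinOp.eval, r1, Nat.mod_eq_of_lt (hlt.trans_le hU)]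
  | put k i e =>
    simp only [wf, Bool.and_eq_true] at hw
    obtain ⟨l1, x1, r1, m1, f1⟩ := Expr.compile_exec hF hb hw.1 hs.1 0 h
    have h1 : Rep B s l1 := h.congr f1 m1
    have hi := Expr.eval_lt hF.lit_lt hb hw.1 hs.1
    have he := Expr.eval_lt hF.lit_lt hb hw.2 hs.2.1
    by_cases hk : k = .io
    · subst hk
      rw [compile, if_pos rfl, cost, if_pos rfl]
      obtain ⟨l2, x2, r2, m2, f2⟩ := Expr.compile_exec hF hb hw.2 hs.2.1 1 h1
      have h2 : Rep B s l2 := h1.congr (fun r hr => f2 r (by simp [tmp]; omega)) m2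
      have r3 : l2.reg (tmp 0) = i.eval s := (f2 _ (by simp [tmp])).trans r1
      refine ⟨_, .seq (.seq x1 x2) (.store _ _ _), ?_, hb.seta _ _ he⟩
      rw [r2, r3]
      exact h2.seta_io (hs.2.2 rfl)
    · rw [compile, if_neg hk, cost, if_neg hk]
      obtain ⟨l2, x2, r2, m2, f2⟩ := compileAddr_exec hF (k := k) l1 h1.base r1 hi
      have h2 : Rep B s l2 := h1.congr f2 m2
      obtain ⟨l3, x3, r3, m3, f3⟩ := Expr.compile_exec hF hb hw.2 hs.2.1 1 h2
      have h3 : Rep B s l3 := h2.congr (fun r hr => f3 r (by simp [tmp]; omega)) m3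
      have r4 := (f3 _ (by simp [tmp])).trans r2
      refine ⟨_, .seq (.seq (.seq x1 x2) x3) (.store _ _ _), ?_, hb.seta _ _ he⟩
      rw [r3, r4]
      exact h3.seta hk
  | seq c d ihc ihd =>
    simp only [wf, Bool.and_eq_true] at hw
    obtain ⟨l1, x1, h1, b1⟩ := ihc hw.1 hb hs.1 h
    obtain ⟨l2, x2, h2, b2⟩ := ihd hw.2 b1 hs.2 h1
    exact ⟨l2, .seq x1 x2, h2, b2⟩
  | ite e f c d ihc ihd =>
    simp only [wf, Bool.and_eq_true] at hw
    obtain ⟨l1, x1, r1, m1, f1⟩ := Expr.compile_exec hF hb hw.1.1.1 hs.1 0 h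
    have h1 : Rep B s l1 := h.congr f1 m1
    obtain ⟨l2, x2, r2, m2, f2⟩ := Expr.compile_exec hF hb hw.1.1.2 hs.2.1 1 h1
    have h2 : Rep B s l2 := h1.congr (fun r hr => f2 r (by simp [tmp]; omega)) m2
    have r3 : l2.reg (tmp 0) = e.eval s := (f2 _ (by simp [tmp])).trans r1
    by_cases hlt : e.eval s < f.eval s
    · obtain ⟨l3, x3, h3, b3⟩ := ihc hw.1.2 hb (hs.2.2.1 hlt) h2
      refine ⟨l3, ?_, ?_, ?_⟩
      · rw [cost, if_pos hlt, add_assoc, add_comm 1]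
        exact .seq (.seq x1 x2) (.branch_true (by rwa [r3, r2]) x3)
      · rwa [run, if_pos hlt]
      · rwa [run, if_pos hlt]
    · obtain ⟨l3, x3, h3, b3⟩ := ihd hw.2 hb (hs.2.2.2 hlt) h2
      refine ⟨l3, ?_, ?_, ?_⟩
      · rw [cost, if_neg hlt, add_assoc, add_comm 1]
        exact .seq (.seq x1 x2) (.branch_false (by rwa [r3, r2]) x3)
      · rwa [run, if_neg hlt]
      · rwa [run, if_neg hlt]
  | loop x b c ih =>
    simp only [wf, Bool.and_eq_true, Bool.not_eq_true', decide_eq_true_eq] at hw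
    obtain ⟨⟨⟨hwc, hx⟩, hbw⟩, hxb⟩ := hw
    have hvx : ∀ i, (iter c.run x s i).v x = i := by
      intro i; cases i <;> simp [iter]
    have hvb : ∀ i, (iter c.run x s i).v b = s.v b := by
      intro i
      induction i with
      | zero => simp [iter, hxb.symm]
      | succ i ihi => simp [iter, hxb.symm, c.run_v_of_not_writes _ hbw, ihi]
    -- Induction on the number `j` of remaining rounds, generalised over the current round `i`.
    have key : ∀ j i, i + j = s.v b → ∀ ls, Rep B (iter c.run x s i) ls →
        (iter c.run x s i).Bounded U →
        ∃ ls', Exec w (.loop x.ctorIdx b.ctorIdx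
          (.seq c.compile (.seq (.const (tmp 0) 1) (.op .add x.ctorIdx x.ctorIdx (tmp 0))))) ls
          (1 + ∑ l ∈ Finset.range j, (c.cost (iter c.run x s (i + l)) + 3)) ls' ∧
          Rep B (iter c.run x s (s.v b)) ls' ∧ (iter c.run x s (s.v b)).Bounded U := by
      intro j
      induction j with
      | zero =>
        intro i hi ls hr hbd
        rw [add_zero] at hi
        refine ⟨ls, ?_, hi ▸ hr, hi ▸ hbd⟩
        exact .loop_done (by rw [hr.reg, hr.reg, hvx, hvb, hi]; exact lt_irrefl _)
      | succ j ihj =>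
        intro i hi ls hr hbd
        obtain ⟨l1, x1, r1, b1⟩ := ih hwc hbd (hs i (by omega)) hr
        -- The counter never exceeds the loop bound, itself a stored value below `U`, so
        -- incrementing is safe.
        have hlt : i + 1 < U := by have := hb.v b; have := (hb.v b); omega
        have r2 : Rep B (iter c.run x s (i + 1)) _ :=
          (r1.congr (ls' := ⟨Function.update l1.reg (tmp 0) (1 % 2 ^ w), l1.mem⟩)
            (fun r hr => Function.update_of_ne (by simp [tmp]; omega) _ _) rfl).setv x
            (y := i + 1) (y' := WordRAM.BinOp.eval w .add
              (Function.update l1.reg (tmp 0) (1 % 2 ^ w) x.ctorIdx)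
              (Function.update l1.reg (tmp 0) (1 % 2 ^ w) (tmp 0))) (by
            have hx1 : x.ctorIdx ≠ tmp 0 := by have := x.ctorIdx_lt; simp [tmp]; omega
            have hx2 : l1.reg x.ctorIdx = i := by
              rw [r1.reg, c.run_v_of_not_writes _ hx, hvx]
            rw [Function.update_of_ne hx1, Function.update_self, hx2]
            simp only [WordRAM.BinOp.eval, Nat.add_mod_mod]
            exact Nat.mod_eq_of_lt (hlt.trans_le hU))
        obtain ⟨l3, x3, r3, b3⟩ := ihj (i + 1) (by omega) _ r2 (b1.setv x hlt)
        refine ⟨l3, ?_, r3, b3⟩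
        have := Exec.loop_step (by rw [hr.reg, hr.reg, hvx, hvb]; omega)
          (.seq x1 (.seq (.const _ _ _) (.op .add _ _ _ _))) x3
        convert this using 1
        rw [Finset.sum_range_succ']
        rw [Finset.sum_congr rfl fun l _ => by rw [← Nat.add_assoc, Nat.add_right_comm]]
        simp only [add_zero]
        omega
    have h0 : Rep B (iter c.run x s 0)
        ⟨Function.update ls.reg x.ctorIdx (0 % 2 ^ w), ls.mem⟩ := h.setv x (Nat.zero_mod _)
    obtain ⟨l1, x1, r1, b1⟩ := key (s.v b) 0 (zero_add _) _ h0
      (hb.setv x (by have := hF.lit_lt; omega))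
    refine ⟨l1, ?_, r1, b1⟩
    have hcost : (loop x b c).cost s =
        1 + (1 + ∑ l ∈ Finset.range (s.v b), (c.cost (iter c.run x s (0 + l)) + 3)) := by
      simp only [cost, zero_add]
      omega
    rw [hcost]
    exact .seq (.const _ _ _) x1

end

end SingleCrossing

namespace SingleCrossing

/-! ### Weakest preconditions -/

section Simp

variable (U B : ℕ) (s : Store) (e f : Expr) (x : Var) (c : ℕ) (k : Arr)

namespace Expr

@[simp] theorem eval_ofNat : (no_index (OfNat.ofNat c) : Expr).eval s = OfNat.ofNat c := rfl
@[simp] theorem eval_var : (var x).eval s = s.v x := rfl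
@[simp] theorem eval_get : (get k e).eval s = s.a k (e.eval s) := rfl
@[simp] theorem eval_add : (e + f).eval s = e.eval s + f.eval s := rfl
@[simp] theorem eval_sub : (e - f).eval s = e.eval s - f.eval s := rfl
@[simp] theorem eval_mul : (e * f).eval s = e.eval s * f.eval s := rfl
@[simp] theorem eval_div : (e / f).eval s = e.eval s / f.eval s := rfl
@[simp] theorem eval_mod : (e % f).eval s = e.eval s % f.eval s := rfl

@[simp] theorem safe_ofNat : (no_index (OfNat.ofNat c) : Expr).Safe U B s := trivial
@[simp] theorem safe_var : (var x).Safe U B s := trivial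
@[simp] theorem safe_get :
    (get k e).Safe U B s ↔ e.Safe U B s ∧ (k = .io → e.eval s < B) := Iff.rfl
@[simp] theorem safe_add :
    (e + f).Safe U B s ↔ e.Safe U B s ∧ f.Safe U B s ∧ e.eval s + f.eval s < U := Iff.rfl
@[simp] theorem safe_sub :
    (e - f).Safe U B s ↔ e.Safe U B s ∧ f.Safe U B s ∧ f.eval s ≤ e.eval s := Iff.rfl
@[simp] theorem safe_mul :
    (e * f).Safe U B s ↔ e.Safe U B s ∧ f.Safe U B s ∧ e.eval s * f.eval s < U := Iff.rfl
@[simp] theorem safe_div : (e / f).Safe U B s ↔ e.Safe U B s ∧ f.Safe U B s := by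
  rw [← and_true (Expr.Safe U B f s)]; rfl
@[simp] theorem safe_mod : (e % f).Safe U B s ↔ e.Safe U B s ∧ f.Safe U B s := by
  rw [← and_true (Expr.Safe U B f s)]; rfl

@[simp] theorem cost_ofNat : (no_index (OfNat.ofNat c) : Expr).cost = 1 := rfl
@[simp] theorem cost_var : (var x).cost = 1 := rfl
@[simp] theorem cost_get : (get k e).cost = e.cost + (if k = .io then 0 else 5) + 1 := rfl
@[simp] theorem cost_add : (e + f).cost = e.cost + f.cost + 1 := rfl
@[simp] theorem cost_sub : (e - f).cost = e.cost + f.cost + 1 := rfl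
@[simp] theorem cost_mul : (e * f).cost = e.cost + f.cost + 1 := rfl
@[simp] theorem cost_div : (e / f).cost = e.cost + f.cost + 1 := rfl
@[simp] theorem cost_mod : (e % f).cost = e.cost + f.cost + 1 := rfl

end Expr

end Simp

/-- The command runs safely from `s`, and its cost and final state satisfy `Q`. -/
def wp (U B : ℕ) (c : Cmd) (s : Store) (Q : ℕ → Store → Prop) : Prop :=
  c.Safe U B s ∧ Q (c.cost s) (c.run s)

/-- The stores agree on everything that `c` does not change. -/
structure Frame (c : Cmd) (s s' : Store) : Prop where
  v : ∀ x, c.writes x = false → s'.v x = s.v x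
  a : ∀ k, c.writesA k = false → s'.a k = s.a k

section

variable {U B : ℕ} {s : Store} {Q Q' : ℕ → Store → Prop}

@[simp] theorem wp_skip : wp U B .skip s Q ↔ Q 1 s := by simp [wp, Cmd.Safe, Cmd.cost, Cmd.run]

@[simp] theorem wp_set {x : Var} {e : Expr} :
    wp U B (.set x e) s Q ↔ e.Safe U B s ∧ Q (e.cost + 1) (s.setv x (e.eval s)) := Iff.rfl

@[simp] theorem wp_put {k : Arr} {i e : Expr} :
    wp U B (.put k i e) s Q ↔ (i.Safe U B s ∧ e.Safe U B s ∧ (k = .io → i.eval s < B)) ∧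
      Q (i.cost + (if k = .io then 0 else 5) + e.cost + 1) (s.seta k (i.eval s) (e.eval s)) :=
  Iff.rfl

theorem wp_seq {c d : Cmd} : wp U B (c ;; d) s Q ↔
    wp U B c s fun k s' => wp U B d s' fun k' s'' => Q (k + k') s'' := by
  simp [wp, Cmd.Safe, Cmd.cost, Cmd.run, and_assoc]

theorem wp_ite {e f : Expr} {c d : Cmd} : wp U B (.ite e f c d) s Q ↔
    e.Safe U B s ∧ f.Safe U B s ∧
      (e.eval s < f.eval s → wp U B c s fun k => Q (e.cost + f.cost + 1 + k)) ∧
      (¬ e.eval s < f.eval s → wp U B d s fun k => Q (e.cost + f.cost + 1 + k)) := by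
  by_cases h : e.eval s < f.eval s <;> simp [wp, Cmd.Safe, Cmd.cost, Cmd.run, h, and_assoc]

/-- The frame is a syntactic fact about `c`, so the consequence rule supplies it for free and
postconditions need not list what stays unchanged. -/
theorem wp.mono {c : Cmd} (h : wp U B c s Q)
    (hQ : ∀ k s', Frame c s s' → Q k s' → Q' k s') : wp U B c s Q' :=
  ⟨h.1, hQ _ _ ⟨fun _ => c.run_v_of_not_writes s, fun _ => c.run_a_of_not_writesA s⟩ h.2⟩

theorem wp.seq {c d : Cmd} (h : wp U B c s Q)
    (hQ : ∀ k s', Frame c s s' → Q k s' → wp U B d s' fun k' s'' => Q' (k + k') s'') :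
    wp U B (c ;; d) s Q' :=
  wp_seq.2 (h.mono hQ)

/-- Loop rule: `I` is the invariant and `K` bounds the cost of a round. -/
theorem wp_loop {x b : Var} {c : Cmd} (I : ℕ → Store → Prop) (K : ℕ)
    (hw : (!c.writes x && !c.writes b && decide (x ≠ b)) = true)
    (h0 : I 0 (s.setv x 0))
    (step : ∀ i < s.v b, ∀ s', Frame (.loop x b c) s s' → s'.v x = i → I i s' →
      wp U B c s' fun k s'' => k ≤ K ∧ I (i + 1) (s''.setv x (i + 1))) :
    wp U B (.loop x b c) s fun k s' => k ≤ 2 + s.v b * (K + 3) ∧ I (s.v b) s' := by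
  simp only [Bool.and_eq_true, Bool.not_eq_true', decide_eq_true_eq] at hw
  obtain ⟨⟨hx, hb⟩, hxb⟩ := hw
  have hfr : ∀ i, Frame (.loop x b c) s (iter c.run x s i) ∧ (iter c.run x s i).v x = i := by
    intro i
    induction i with
    | zero =>
      refine ⟨⟨fun z hz => ?_, fun _ _ => rfl⟩, by simp [iter]⟩
      simp only [Cmd.writes, Bool.or_eq_false_iff, decide_eq_false_iff_not] at hz
      simp [iter, Ne.symm hz.1]
    | succ i ih =>
      refine ⟨⟨fun z hz => ?_, fun k hk => ?_⟩, by simp [iter]⟩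
      · have hz' := hz
        simp only [Cmd.writes, Bool.or_eq_false_iff, decide_eq_false_iff_not] at hz'
        simp [iter, Ne.symm hz'.1, c.run_v_of_not_writes _ hz'.2, ih.1.v z hz]
      · simp only [iter, Store.setv_a]
        rw [c.run_a_of_not_writesA _ hk, ih.1.a k hk]
  have hI : ∀ i ≤ s.v b, I i (iter c.run x s i) := by
    intro i
    induction i with
    | zero => exact fun _ => h0
    | succ i ih =>
      intro hi
      exact (step i hi _ (hfr i).1 (hfr i).2 (ih (by omega))).2.2
  refine ⟨fun i hi => (step i hi _ (hfr i).1 (hfr i).2 (hI i hi.le)).1, ?_, hI _ le_rfl⟩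
  rw [Cmd.cost, Nat.add_le_add_iff_left]
  refine (Finset.sum_le_card_nsmul _ _ (K + 3) fun i hi => ?_).trans (by simp)
  have hi := Finset.mem_range.1 hi
  have := (step i hi _ (hfr i).1 (hfr i).2 (hI i hi.le)).2.1
  omega

end

end SingleCrossing

namespace SingleCrossing

/-! ### Inversions of lists -/

/-- Number of inversions. -/
def inv : List ℕ → ℕ
  | [] => 0
  | x :: l => l.countP (· < x) + inv l

/-- Number of pairs of an earlier entry with `p` and a later entry without. -/
def cross (p : ℕ → Bool) : List ℕ → ℕ
  | [] => 0
  | x :: l => (if p x then l.countP (!p ·) else 0) + cross p l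

theorem inv_concat (l : List ℕ) (x : ℕ) : inv (l ++ [x]) = inv l + l.countP (x < ·) := by
  induction l with
  | nil => simp [inv]
  | cons y l ih =>
    simp only [List.cons_append, inv, List.countP_append, ih, List.countP_cons, List.countP_nil]
    omega

/-- The mixed term is what allows counting word by word: a word contributes its own crossings and
its zeros times the ones seen before. -/
theorem cross_append (p : ℕ → Bool) (l l' : List ℕ) :
    cross p (l ++ l') = cross p l + cross p l' + l.countP p * l'.countP (!p ·) := by
  induction l with
  | nil => simp [cross]
  | cons y l ih =>
    simp only [List.cons_append, cross, List.countP_append, ih, List.countP_cons]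
    split_ifs <;> ring

theorem cross_map (p : ℕ → Bool) (f : ℕ → ℕ) (l : List ℕ) :
    cross p (l.map f) = cross (fun x => p (f x)) l := by
  induction l with
  | nil => rfl
  | cons y l ih => simp [cross, ih, List.countP_map, Function.comp_def]

theorem cross_congr {p q : ℕ → Bool} (l : List ℕ) (h : ∀ x ∈ l, p x = q x) :
    cross p l = cross q l := by
  induction l with
  | nil => rfl
  | cons y l ih =>
    simp only [List.mem_cons, forall_eq_or_imp] at h
    rw [cross, cross, ih h.2, h.1, List.countP_congr fun x hx => by rw [h.2 x hx]]

/-- Entries with `p` exceed those without. Hence a mixed pair is an inversion exactly if the entry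
with `p` comes first, and all other inversions lie inside one of the two classes. -/
theorem inv_eq_cross_add (p : ℕ → Bool) (l : List ℕ)
    (h : ∀ x ∈ l, ∀ y ∈ l, p x = true → p y = false → y < x) :
    inv l = cross p l + inv (l.filter (!p ·)) + inv (l.filter p) := by
  induction l with
  | nil => rfl
  | cons x l ih =>
    have ih := ih fun x hx y hy => h x (List.mem_cons_of_mem _ hx) y (List.mem_cons_of_mem _ hy)
    have hsplit : l.countP (· < x) =
        (l.filter (!p ·)).countP (· < x) + (l.filter p).countP (· < x) := by
      rw [List.countP_eq_countP_filter_add l (· < x) p, add_comm]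
    cases hp : p x with
    | true =>
      have h1 : (l.filter (!p ·)).countP (· < x) = l.countP (!p ·) := by
        rw [List.countP_filter]
        refine List.countP_congr fun y hy => ?_
        have := h x (by simp) y (List.mem_cons_of_mem _ hy) hp
        simpa using this
      simp only [inv, cross, hp, List.filter_cons, Bool.not_true, if_true, Bool.false_eq_true,
        if_false, ih, hsplit, h1]
      ring
    | false =>
      have h1 : (l.filter p).countP (· < x) = 0 := by
        rw [List.countP_eq_zero]
        intro y hy
        rw [List.mem_filter] at hy
        have := h y (List.mem_cons_of_mem _ hy.1) x (by simp) hy.2 hp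
        simp only [decide_eq_true_eq, not_lt]
        exact this.le
      simp only [inv, cross, hp, List.filter_cons, Bool.not_false, if_true, Bool.false_eq_true,
        if_false, ih, hsplit, h1]
      ring

theorem inv_le (l : List ℕ) : inv l ≤ l.length * l.length := by
  induction l with
  | nil => simp [inv]
  | cons x l ih =>
    have := l.countP_le_length (p := fun y => decide (y < x))
    simp only [inv, List.length_cons]
    nlinarith

/-! ### Stable bucket sort -/

/-- The list, sorted stably by the keys `f < H`. -/
def bucket (f : ℕ → ℕ) (H : ℕ) (l : List ℕ) : List ℕ :=
  (List.range H).flatMap fun h => l.filter (f · = h)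

theorem bucket_succ (f : ℕ → ℕ) (H : ℕ) (l : List ℕ) :
    bucket f (H + 1) l = bucket f H l ++ l.filter (f · = H) := by
  simp [bucket, List.range_succ]

theorem bucket_perm_filter (f : ℕ → ℕ) (H : ℕ) (l : List ℕ) :
    (bucket f H l).Perm (l.filter (f · < H)) := by
  induction H with
  | zero => simp [bucket]
  | succ H ih =>
    rw [bucket_succ]
    refine (ih.append_right _).trans ?_
    have h1 : l.filter (f · < H) = (l.filter (f · < H + 1)).filter (f · < H) := by
      rw [List.filter_filter]
      exact List.filter_congr fun x _ => by simp; omega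
    have h2 : l.filter (f · = H) = (l.filter (f · < H + 1)).filter (fun x => !decide (f x < H)) := by
      rw [List.filter_filter]
      exact List.filter_congr fun x _ => by
        rw [Bool.eq_iff_iff]; simp; omega
    rw [h1, h2]
    exact List.filter_append_perm _ _

theorem bucket_perm {f : ℕ → ℕ} {H : ℕ} {l : List ℕ} (h : ∀ x ∈ l, f x < H) :
    (bucket f H l).Perm l := by
  have := bucket_perm_filter f H l
  rwa [List.filter_eq_self.2 (by simpa using h)] at this

theorem length_bucket {f : ℕ → ℕ} {H : ℕ} {l : List ℕ} (h : ∀ x ∈ l, f x < H) :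
    (bucket f H l).length = l.length := (bucket_perm h).length_eq

theorem length_bucket_eq (f : ℕ → ℕ) (H : ℕ) (l : List ℕ) :
    (bucket f H l).length = l.countP (f · < H) := by
  rw [(bucket_perm_filter f H l).length_eq, List.countP_eq_length_filter]

/-- This is stability: entries with equal keys keep their order from `l`, and all other pairs are
ordered by key. Applied twice, it yields the two-digit radix sort. -/
theorem pairwise_bucket {f : ℕ → ℕ} {H : ℕ} {l : List ℕ} {r : ℕ → ℕ → Prop}
    (hl : l.Pairwise fun x y => f x = f y → r x y) (hr : ∀ x y, f x < f y → r x y) :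
    (bucket f H l).Pairwise r := by
  induction H with
  | zero => simp [bucket]
  | succ H ih =>
    rw [bucket_succ, List.pairwise_append]
    refine ⟨ih, ?_, ?_⟩
    · rw [List.pairwise_filter]
      refine hl.imp fun h hx hy => h ?_
      simp only [decide_eq_true_eq] at hx hy
      rw [hx, hy]
    · intro x hx y hy
      apply hr
      have hx := ((bucket_perm_filter f H l).mem_iff).1 hx
      simp only [List.mem_filter, decide_eq_true_eq] at hx hy
      omega

/-- The array `a` holds the list `l` from index `o` on. -/
def Holds (a : ℕ → ℕ) (o : ℕ) (l : List ℕ) : Prop := ∀ i (h : i < l.length), a (o + i) = l[i]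

theorem holds_nil (a : ℕ → ℕ) (o : ℕ) : Holds a o [] := fun i h => absurd h (by simp)

theorem holds_append {a : ℕ → ℕ} {o : ℕ} {l l' : List ℕ} :
    Holds a o (l ++ l') ↔ Holds a o l ∧ Holds a (o + l.length) l' := by
  constructor
  · intro h
    refine ⟨fun i hi => ?_, fun i hi => ?_⟩
    · rw [h i (by simp; omega), List.getElem_append_left hi]
    · rw [add_assoc, h (l.length + i) (by simp; omega), List.getElem_append_right (by omega)]
      simp
  · rintro ⟨h1, h2⟩ i hi
    rw [List.length_append] at hi
    by_cases hil : i < l.length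
    · rw [List.getElem_append_left hil, h1]
    · rw [List.getElem_append_right (by omega), ← h2 (i - l.length) (by omega)]
      congr 1; omega

/-- The bucket of key `k` starts after all entries with smaller keys, which is what counting sort
computes. -/
theorem holds_bucket {a : ℕ → ℕ} {f : ℕ → ℕ} {H : ℕ} {l : List ℕ}
    (h : ∀ k < H, Holds a (l.countP (f · < k)) (l.filter (f · = k))) :
    Holds a 0 (bucket f H l) := by
  induction H with
  | zero => exact holds_nil _ _
  | succ H ih =>
    rw [bucket_succ, holds_append]
    refine ⟨ih fun k hk => h k (by omega), ?_⟩
    rw [zero_add, length_bucket_eq]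
    exact h H (by omega)

/-! ### Radix groups of a permutation of `0, …, 2 ^ L - 1` -/

/-- The entries whose digits from position `k` on are `h`. -/
def grp (a : List ℕ) (k h : ℕ) : List ℕ := a.filter (· / 2 ^ k = h)

/-- The `k`-th bit is set. -/
def bitSet (k v : ℕ) : Bool := decide (v / 2 ^ k % 2 = 1)

/-- The list, sorted stably by the digits from position `k` on. -/
def sortedFrom (L : ℕ) (a : List ℕ) (k : ℕ) : List ℕ := bucket (· / 2 ^ k) (2 ^ (L - k)) a

/-- One more bit splits group `h` into its children `2 * h` and `2 * h + 1`, with the order of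
entries preserved. So concatenating zeros and ones group by group is one stable sorting step. -/
theorem filter_not_bitSet_grp (a : List ℕ) (k h : ℕ) :
    (grp a (k + 1) h).filter (!bitSet k ·) = grp a k (2 * h) := by
  rw [grp, grp, List.filter_filter]
  refine List.filter_congr fun v _ => ?_
  rw [Bool.eq_iff_iff]
  simp only [bitSet, pow_succ, ← Nat.div_div_eq_div_mul, Bool.and_eq_true, Bool.not_eq_true',
    decide_eq_true_eq, decide_eq_false_iff_not]
  omega

theorem filter_bitSet_grp (a : List ℕ) (k h : ℕ) :
    (grp a (k + 1) h).filter (bitSet k) = grp a k (2 * h + 1) := by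
  rw [grp, grp, List.filter_filter]
  refine List.filter_congr fun v _ => ?_
  rw [Bool.eq_iff_iff]
  simp only [bitSet, pow_succ, ← Nat.div_div_eq_div_mul, Bool.and_eq_true, decide_eq_true_eq]
  omega

/-- The entries are all numbers below `2 ^ L`, so a group is a full interval of length `2 ^ k`.
Equal group sizes are what align groups with words. -/
theorem length_grp {L k h : ℕ} {a : List ℕ} (ha : a.Perm (List.range (2 ^ L))) (hk : k ≤ L)
    (hh : h < 2 ^ (L - k)) : (grp a k h).length = 2 ^ k := by
  rw [grp, ← List.countP_eq_length_filter, ha.countP_eq, List.countP_eq_length_filter,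
    ← List.toFinset_card_of_nodup (List.nodup_range.filter _)]
  have : (List.filter (fun x => decide (x / 2 ^ k = h)) (List.range (2 ^ L))).toFinset =
      Finset.Ico (h * 2 ^ k) ((h + 1) * 2 ^ k) := by
    ext v
    have h1 : (h + 1) * 2 ^ k ≤ 2 ^ L := by
      calc (h + 1) * 2 ^ k ≤ 2 ^ (L - k) * 2 ^ k := Nat.mul_le_mul_right _ hh
        _ = 2 ^ L := by rw [← pow_add]; congr 1; omega
    simp only [List.mem_toFinset, List.mem_filter, List.mem_range, decide_eq_true_eq,
      Finset.mem_Ico]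
    rw [Nat.div_eq_iff (by positivity)]
    have := Nat.two_pow_pos k
    rw [add_mul, one_mul] at *
    omega
  rw [this, Nat.card_Ico, add_mul, one_mul, Nat.add_sub_cancel_left]

/-- Inversions inside the groups at position `k`. -/
def groupInv (L : ℕ) (a : List ℕ) (k : ℕ) : ℕ := ∑ h ∈ Finset.range (2 ^ (L - k)), inv (grp a k h)

theorem groupInv_self {L : ℕ} {a : List ℕ} (ha : ∀ v ∈ a, v < 2 ^ L) :
    groupInv L a L = inv a := by
  simp only [groupInv, Nat.sub_self, pow_zero, Finset.sum_range_one, grp]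
  rw [List.filter_eq_self.2]
  intro v hv
  simp [ha v hv]

/-- An inversion inside a group either crosses at bit `k` or stays inside a child group. Telescoping
over `k` gives the whole inversion number. -/
theorem groupInv_succ {L k : ℕ} (a : List ℕ) (hk : k < L) :
    groupInv L a (k + 1) =
      ∑ h ∈ Finset.range (2 ^ (L - (k + 1))), cross (bitSet k) (grp a (k + 1) h) +
        groupInv L a k := by
  have h2 : 2 ^ (L - k) = 2 ^ (L - (k + 1)) * 2 := by rw [← pow_succ]; congr 1; omega
  have hsum : ∀ (F : ℕ → ℕ) (M : ℕ), ∑ h ∈ Finset.range (M * 2), F h =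
      ∑ h ∈ Finset.range M, (F (2 * h) + F (2 * h + 1)) := by
    intro F M
    induction M with
    | zero => simp
    | succ M ih =>
      rw [show (M + 1) * 2 = M * 2 + 1 + 1 by ring, Finset.sum_range_succ, Finset.sum_range_succ,
        ih, Finset.sum_range_succ, mul_comm M 2, add_assoc]
  rw [groupInv, groupInv, h2, hsum, ← Finset.sum_add_distrib]
  refine Finset.sum_congr rfl fun h _ => ?_
  rw [inv_eq_cross_add (bitSet k), filter_not_bitSet_grp, filter_bitSet_grp, add_assoc]
  -- Inside a group all bits above `k` agree, so an entry with bit `k` set exceeds one without.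
  intro x hx y hy hpx hpy
  simp only [grp, List.mem_filter, decide_eq_true_eq, bitSet, decide_eq_false_iff_not,
    pow_succ, ← Nat.div_div_eq_div_mul] at hx hy hpx hpy
  by_contra hxy
  have := Nat.div_le_div_right (c := 2 ^ k) (not_lt.1 hxy)
  omega

end SingleCrossing

namespace SingleCrossing

/-! ### Packed lists of digits -/

/-- The `i`-th block of `g` entries. -/
def chunk (g i : ℕ) (l : List ℕ) : List ℕ := (l.drop (i * g)).take g

/-- The array holds the complete blocks of `g` digits to the base `D`. -/
def Packed (D g : ℕ) (a : ℕ → ℕ) (l : List ℕ) : Prop :=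
  ∀ i < l.length / g, a i = Nat.ofDigits D (chunk g i l)

theorem length_chunk {g i : ℕ} {l : List ℕ} (h : i < l.length / g) : (chunk g i l).length = g := by
  have h1 : (i + 1) * g ≤ l.length := (Nat.mul_le_mul_right _ h).trans (Nat.div_mul_le_self _ _)
  rw [add_mul, one_mul] at h1
  simp only [chunk, List.length_take, List.length_drop]
  omega

theorem chunk_append {g i : ℕ} {l : List ℕ} (l' : List ℕ) (h : i < l.length / g) :
    chunk g i (l ++ l') = chunk g i l := by
  have h1 : (i + 1) * g ≤ l.length := (Nat.mul_le_mul_right _ h).trans (Nat.div_mul_le_self _ _)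
  rw [add_mul, one_mul] at h1
  rw [chunk, chunk, List.drop_append_of_le_length (by omega), List.take_append_of_le_length]
  rw [List.length_drop]; omega

theorem mem_of_mem_chunk {g i x : ℕ} {l : List ℕ} (h : x ∈ chunk g i l) : x ∈ l :=
  List.mem_of_mem_drop (List.mem_of_mem_take h)

theorem chunk_map (g i : ℕ) (f : ℕ → ℕ) (l : List ℕ) :
    chunk g i (l.map f) = (chunk g i l).map f := by
  simp [chunk, List.map_drop, List.map_take]

theorem take_succ_mul (g i : ℕ) (l : List ℕ) :
    l.take ((i + 1) * g) = l.take (i * g) ++ chunk g i l := by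
  rw [chunk, add_mul, one_mul, List.take_add]

/-- Blocks of a concatenation of lists of equal length that is a multiple of the block size. -/
theorem chunk_flatMap {g m q i M : ℕ} {F : ℕ → List ℕ} (hF : ∀ h < M, (F h).length = m * g)
    (hq : q < M) (hi : i < m) :
    chunk g (q * m + i) ((List.range M).flatMap F) = chunk g i (F q) := by
  have hlen : ∀ K ≤ M, ((List.range K).flatMap F).length = K * m * g := by
    intro K
    induction K with
    | zero => simp
    | succ K ih =>
      intro hK
      rw [List.range_succ, List.flatMap_append, List.length_append, ih (by omega)]
      simp [hF K (by omega)]; ring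
  have hsplit : ∃ l', (List.range M).flatMap F = (List.range q).flatMap F ++ (F q ++ l') := by
    obtain ⟨e, rfl⟩ := Nat.exists_eq_add_of_lt hq
    rw [show q + e + 1 = q + (1 + e) by ring, List.range_add, List.range_add]
    refine ⟨_, by simp [List.flatMap_append]; rfl⟩
  obtain ⟨l', hl'⟩ := hsplit
  have hqi : (q * m + i) * g = ((List.range q).flatMap F).length + i * g := by
    rw [hlen q hq.le]; ring
  rw [chunk, hl', hqi, List.drop_append, List.drop_eq_nil_of_le (by omega), List.nil_append,
    Nat.add_sub_cancel_left, ← chunk]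
  rcases Nat.eq_zero_or_pos g with rfl | hg
  · simp [chunk]
  · exact chunk_append l' (by rw [hF q hq, Nat.mul_div_cancel _ hg]; exact hi)

section

open Var Arr

/-- Starts an empty stream of digits. -/
def streamInit : Cmd := .set acc 0 ;; .set accP 1 ;; .set oi 0

/-- Appends the packed digits `y` to the stream. -/
def streamAppend : Cmd :=
  .set acc (acc + y * accP) ;; .set accP (accP * yp) ;;
  .ite accP W .skip
    (.put OUT oi (acc % W) ;; .set acc (acc / W) ;; .set accP (accP / W) ;; .set oi (oi + 1))

end

/-- The digits `out` have been appended to the stream. -/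
structure Stream (D g : ℕ) (s : Store) (out : List ℕ) : Prop where
  lt : ∀ x ∈ out, x < D
  oi : s.v .oi = out.length / g
  acc : s.v .acc = Nat.ofDigits D (out.drop (out.length / g * g))
  accP : s.v .accP = D ^ (out.length % g)
  out : Packed D g (s.a .OUT) out

theorem streamInit_spec {U B D g : ℕ} {s : Store} :
    wp U B streamInit s fun k s' => k ≤ 6 ∧ Stream D g s' [] := by
  simp only [streamInit, wp_seq, wp_set]
  refine ⟨trivial, trivial, trivial, by simp, ?_⟩
  constructor <;> simp [Packed]

/-- `acc` holds the incomplete last word, with fewer than `g` digits. Appending at most `g` digits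
gives fewer than `2 * g`, so at most one word is emitted and `D ^ (2 * g)` bounds the intermediate
values. The powers `accP` and `W` encode digit counts, so comparing them decides whether a word is
full. -/
theorem streamAppend_spec {U B D g : ℕ} {s : Store} {out l : List ℕ} (hD : 2 ≤ D) (hg : 0 < g)
    (hW : s.v .W = D ^ g) (hU : D ^ g * D ^ g < U) (hlen : out.length + 1 < U)
    (h : Stream D g s out) (hy : s.v .y = Nat.ofDigits D l) (hyp : s.v .yp = D ^ l.length)
    (hl : l.length ≤ g) (hlt : ∀ x ∈ l, x < D) :
    wp U B streamAppend s fun k s' => k ≤ 40 ∧ Stream D g s' (out ++ l) := by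
  set a := out.length / g with ha
  set r := out.drop (a * g) with hr
  have hrl : r.length = out.length % g := by
    rw [hr, List.length_drop, ha, Nat.mul_comm]
    have := Nat.div_add_mod out.length g
    omega
  have hrg : r.length < g := hrl ▸ Nat.mod_lt _ hg
  have hlen' : out.length = a * g + r.length := by
    rw [hrl, ha, Nat.mul_comm]; exact (Nat.div_add_mod _ _).symm
  have hrlt : ∀ x ∈ r ++ l, x < D := by
    intro x hx
    rcases List.mem_append.1 hx with hx | hx
    exacts [h.lt x (List.mem_of_mem_drop hx), hlt x hx]
  have hacc : s.v .acc + s.v .y * s.v .accP = Nat.ofDigits D (r ++ l) := by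
    rw [Nat.ofDigits_append, h.acc, hy, h.accP, hrl, mul_comm (Nat.ofDigits D l)]
  have haccP : s.v .accP * s.v .yp = D ^ (r.length + l.length) := by
    rw [h.accP, hyp, hrl, pow_add]
  have hpow : D ^ (r.length + l.length) < U :=
    (Nat.pow_le_pow_right (by omega) (by omega)).trans_lt ((pow_add D g g).trans_lt hU)
  have hofl : Nat.ofDigits D (r ++ l) < D ^ (r.length + l.length) := by
    rw [← List.length_append]
    exact Nat.ofDigits_lt_base_pow_length (by omega) hrlt
  have haU : a ≤ out.length := Nat.div_le_self _ _
  have hlt' : ∀ x ∈ out ++ l, x < D := by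
    intro x hx
    rcases List.mem_append.1 hx with hx | hx
    exacts [h.lt x hx, hlt x hx]
  have hdrop : ∀ b, b ≤ r.length + l.length →
      (out ++ l).drop (a * g + b) = (r ++ l).drop b := by
    intro b _
    rw [← List.drop_drop, List.drop_append_of_le_length (by omega)]
  have hDpos : 0 < D := by omega
  simp only [streamAppend, wp_seq, wp_set, wp_ite, wp_skip, wp_put]
  simp only [Expr.safe_add, Expr.safe_mul, Expr.safe_var, Expr.safe_mod, Expr.safe_div,
    Expr.eval_add, Expr.eval_mul, Expr.eval_var, Expr.eval_mod, Expr.eval_div, Expr.safe_ofNat,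
    Expr.eval_ofNat, Store.setv_v, Store.seta_v, reduceCtorEq, if_true, if_false, true_and,
    hacc, haccP, hW, h.oi, false_imp_iff, and_true]
  refine ⟨⟨by rw [← hacc] at hofl; omega, by omega⟩, hpow, fun hlt1 => ?_, fun hlt1 => ⟨by omega, ?_⟩⟩
  · have hlt2 : r.length + l.length < g := (Nat.pow_lt_pow_iff_right (by omega)).1 hlt1
    have hdiv : (out.length + l.length) / g = a := by
      rw [hlen', Nat.div_eq_iff hg]
      constructor <;> omega
    refine ⟨by simp, hlt', ?_, ?_, ?_, ?_⟩
    · simp [hdiv, h.oi, ha]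
    · have := hdrop 0 (by omega)
      rw [add_zero] at this
      simp [hdiv, this]
    · have : (out.length + l.length) % g = r.length + l.length := by
        rw [hlen', add_assoc, Nat.mul_add_mod_of_lt hlt2]
      simp [this]
    · intro i hi
      rw [List.length_append, hdiv] at hi
      rw [chunk_append l hi]
      simpa using h.out i hi
  · have hge : g ≤ r.length + l.length := by
      by_contra hlt2
      exact hlt1 (Nat.pow_lt_pow_right (by omega) (by omega))
    have hdiv : (out.length + l.length) / g = a + 1 := by
      rw [hlen', Nat.div_eq_iff hg, add_mul]
      constructor <;> omega
    have hd1 : (out ++ l).drop ((a + 1) * g) = (r ++ l).drop g := by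
      rw [add_mul, one_mul, hdrop g hge]
    refine ⟨by simp, hlt', ?_, ?_, ?_, ?_⟩
    · simp [hdiv, ha]
    · simp [hdiv, hd1, Nat.ofDigits_div_pow_eq_ofDigits_drop g hDpos _ hrlt]
    · have : (out.length + l.length) % g = r.length + l.length - g := by
        rw [hlen']
        obtain ⟨e, he⟩ := Nat.exists_eq_add_of_le hge
        rw [add_assoc, he, show a * g + (g + e) = (a + 1) * g + e by ring,
          Nat.mul_add_mod_of_lt (by omega)]
        omega
      simp [this, Nat.pow_div hge hDpos]
    · intro i hi
      rw [List.length_append, hdiv] at hi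
      simp only [Store.setv_a, Store.seta_a, if_true, Function.update_apply]
      split_ifs with hia
      · rw [Nat.ofDigits_mod_pow_eq_ofDigits_take g hDpos _ hrlt, hia, chunk]
        have := hdrop 0 (by omega)
        rw [add_zero] at this
        rw [this, List.drop_zero]
      · rw [chunk_append l (by omega)]
        exact h.out i (by omega)

end SingleCrossing

namespace SingleCrossing

/-! ### Bucket sort -/

section

open Var Arr

/-- Sorts the `m` entries of `SRC` stably by their keys in `KEY`, which are below `H`,
into `DST`. -/
def bucketSort : Cmd :=
  .loop i H (.put CNT i 0) ;;
  .loop i m (.set key (.get KEY i) ;; .put CNT key (.get CNT key + 1)) ;;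
  .set c 0 ;;
  .loop i H (.set key (.get CNT i) ;; .put CNT i c ;; .set c (c + key)) ;;
  .loop i m (.set key (.get KEY i) ;; .put DST (.get CNT key) (.get SRC i) ;;
    .put CNT key (.get CNT key + 1))

end

theorem countP_lt_succ (f : ℕ → ℕ) (h : ℕ) (l : List ℕ) :
    l.countP (f · < h + 1) = l.countP (f · < h) + l.countP (f · = h) := by
  induction l with
  | nil => rfl
  | cons x l ih =>
    simp only [List.countP_cons, ih, decide_eq_true_eq]
    split_ifs <;> omega

theorem countP_lt_mono (f : ℕ → ℕ) {h h' : ℕ} (hh : h ≤ h') (l : List ℕ) :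
    l.countP (f · < h) ≤ l.countP (f · < h') :=
  List.countP_mono_left fun x _ => by simp only [decide_eq_true_eq]; omega

theorem countP_take_succ (p : ℕ → Bool) {i : ℕ} {l : List ℕ} (h : i < l.length) :
    (l.take (i + 1)).countP p = (l.take i).countP p + if p l[i] then 1 else 0 := by
  rw [← List.take_concat_get' l i h, List.countP_append, List.countP_singleton]

theorem countP_take_le (p : ℕ → Bool) (i : ℕ) (l : List ℕ) :
    (l.take i).countP p ≤ l.countP p := (List.take_sublist i l).countP_le

/-- Counting sort: clear the counters, build the histogram, replace it by prefix sums, place the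
entries. While placing, counter `h` points to the next free cell of bucket `h`. -/
theorem bucketSort_spec {U B H : ℕ} {f : ℕ → ℕ} {l : List ℕ} {s : Store} (hm : s.v .m = l.length)
    (hH : s.v .H = H) (hU : l.length + 1 < U) (hsrc : Holds (s.a .SRC) 0 l)
    (hkey : ∀ i (h : i < l.length), s.a .KEY i = f l[i]) (hf : ∀ x ∈ l, f x < H) :
    wp U B bucketSort s fun k s' =>
      k ≤ 100 * (H + l.length + 1) ∧ Holds (s'.a .DST) 0 (bucket f H l) := by
  have hle : ∀ p, l.countP p ≤ l.length := fun p => List.countP_le_length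
  refine (wp_loop (fun i s => ∀ h < i, s.a .CNT h = 0) 10 (by decide) (by simp) ?_).seq ?_
  · intro i _ s' _ hi hI
    simp only [wp_put, Expr.eval_var, hi]
    simp only [Expr.safe_ofNat, Expr.safe_var, reduceCtorEq, false_imp_iff, true_and, Store.setv_a,
      Store.seta_a, if_true, Expr.eval_ofNat, Function.update_apply]
    refine ⟨by simp, fun h hh => ?_⟩
    split_ifs
    · rfl
    · exact hI h (by omega)
  rintro k1 s1 f1 ⟨hk1, h1⟩
  rw [hH] at hk1 h1
  have m1 : s1.v .m = l.length := (f1.v _ rfl).trans hm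
  have key1 : s1.a .KEY = s.a .KEY := f1.a _ rfl
  refine (wp_loop (fun i s => ∀ h < H, s.a .CNT h = (l.take i).countP (f · = h)) 30 (by decide)
    (by simpa using h1) ?_).seq ?_
  · intro i hil s' fr hi hI
    rw [m1] at hil
    have hk : s'.a .KEY i = f l[i] := by rw [fr.a _ rfl, key1, hkey i hil]
    have hfl := hf _ (List.getElem_mem hil)
    have hc := hI _ hfl
    have hc2 := (countP_take_le (fun x => f x = f l[i]) i l).trans (hle _)
    simp only [wp_seq, wp_set, wp_put]
    simp [hi, hk, hc]
    refine ⟨by omega, fun h hh => ?_⟩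
    rw [Function.update_apply, countP_take_succ _ hil]
    split_ifs with e1 e2 e2
    · rw [e1]
    · simp [e1] at e2
    · simp at e2; exact absurd e2.symm e1
    · exact hI h hh
  rintro k2 s2 f2 ⟨hk2, h2⟩
  rw [m1, List.take_length] at h2
  rw [m1] at hk2
  have H2 : s2.v .H = H := by rw [f2.v _ rfl, f1.v _ rfl, hH]
  rw [wp_seq, wp_set]
  refine ⟨trivial, ?_⟩
  -- The prefix sums overwrite the histogram in place: cells below `i` are already start positions,
  -- the others still counts.
  refine (wp_loop (fun i s => s.v .c = l.countP (f · < i) ∧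
    (∀ h < i, s.a .CNT h = l.countP (f · < h)) ∧
    ∀ h < H, i ≤ h → s.a .CNT h = l.countP (f · = h)) 40 (by decide)
    (by simpa using h2) ?_).seq ?_
  · rintro i hil s' fr hi ⟨hI1, hI2, hI3⟩
    replace hil : i < H := by simpa [H2] using hil
    have hc := hI3 i hil le_rfl
    have hs := countP_lt_succ f i l
    have := hle (f · < i + 1)
    simp only [wp_seq, wp_set, wp_put]
    simp [-Order.lt_add_one_iff, hi, hc, hI1, hs]
    refine ⟨by omega, fun h hh => ?_, fun h hh hih => ?_⟩
    · rw [Function.update_apply]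
      split_ifs with e1
      · rw [e1]
      · exact hI2 h (by omega)
    · rw [Function.update_apply, if_neg (by omega)]
      exact hI3 h hh (by omega)
  rintro k3 s3 f3 ⟨hk3, h3⟩
  simp only [Store.setv_v, reduceCtorEq, if_false, H2] at hk3 h3
  have m3 : s3.v .m = l.length := by rw [f3.v _ rfl, Store.setv_v, if_neg (by decide), f2.v _ rfl, m1]
  have key3 : s3.a .KEY = s.a .KEY := by rw [f3.a _ rfl, Store.setv_a, f2.a _ rfl, key1]
  have src3 : s3.a .SRC = s.a .SRC := by
    rw [f3.a _ rfl, Store.setv_a, f2.a _ rfl, f1.a _ rfl]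
  refine (wp_loop (fun i s => (∀ h < H, s.a .CNT h = l.countP (f · < h) +
      (l.take i).countP (f · = h)) ∧
    ∀ h < H, Holds (s.a .DST) (l.countP (f · < h)) ((l.take i).filter (f · = h))) 50 (by decide)
    ?_ ?_).mono ?_
  · refine ⟨fun h hh => by simpa using h3.2.1 h hh, fun h hh => by simpa using holds_nil _ _⟩
  · rintro i hil s' fr hi ⟨hI1, hI2⟩
    rw [m3] at hil
    have hk : s'.a .KEY i = f l[i] := by rw [fr.a _ rfl, key3, hkey i hil]
    have hsr : s'.a .SRC i = l[i] := by
      rw [fr.a _ rfl, src3, ← hsrc i hil, zero_add]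
    have hfl := hf _ (List.getElem_mem hil)
    have hc := hI1 _ hfl
    -- Entry `i` has this key itself, so its bucket is not yet full; this bounds the incremented
    -- position.
    have hc2 : (l.take i).countP (fun x => f x = f l[i]) + 1 ≤ l.countP (fun x => f x = f l[i]) := by
      refine le_trans ?_ (countP_take_le (fun x => f x = f l[i]) (i + 1) l)
      rw [countP_take_succ _ hil]; simp
    have hs := countP_lt_succ f (f l[i]) l
    have := hle (f · < f l[i] + 1)
    simp only [wp_seq, wp_set, wp_put]
    simp [hi, hk, hc, hsr]
    refine ⟨by omega, fun h hh => ?_, fun h hh => ?_⟩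
    · rw [Function.update_apply, countP_take_succ _ hil]
      split_ifs with e1 e2 e2
      · rw [e1]; omega
      · simp [e1] at e2
      · simp at e2; exact absurd e2.symm e1
      · exact hI1 h hh
    · rw [← List.take_concat_get' l i hil, List.filter_append, holds_append,
        ← List.countP_eq_length_filter]
      have hcl := countP_take_le (f · = h) i l
      have hlt := countP_lt_succ f h l
      by_cases e1 : f l[i] = h
      · subst e1
        refine ⟨fun j hj => ?_, fun j hj => ?_⟩
        · rw [← List.countP_eq_length_filter] at hj
          rw [Function.update_of_ne (by omega), hI2 _ hh]
        · simp at hj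
          subst hj
          simp [Function.update_self]
      · refine ⟨fun j hj => ?_, by simpa [e1] using holds_nil _ _⟩
        have hj' := hj
        rw [← List.countP_eq_length_filter] at hj'
        rw [Function.update_of_ne, hI2 h hh]
        -- Buckets of distinct keys occupy disjoint ranges, so the write misses bucket `h`.
        rcases lt_or_gt_of_ne e1 with e2 | e2
        · have := countP_lt_mono f (show f l[i] + 1 ≤ h from e2) l
          omega
        · have := countP_lt_mono f (show h + 1 ≤ f l[i] from e2) l
          omega
  · rintro k4 s4 - ⟨hk4, -, h4⟩
    rw [m3, List.take_length] at h4
    rw [m3] at hk4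
    refine ⟨?_, holds_bucket h4⟩
    simp only [Expr.cost_ofNat]
    omega

end SingleCrossing

namespace SingleCrossing

/-! ### Tables for packed blocks -/

section

open Var Arr

/-- Tabulates, for every bit position `beta < g` and every block of `g` digits, the digits without
and with this bit, and the number of crossings. -/
def buildTables : Cmd :=
  .loop beta g (
    .set hb (.get PW beta) ;;
    .loop tb W (
      .set x tb ;; .set y0 0 ;; .set p0 1 ;; .set y1 0 ;; .set p1 1 ;; .set tc 0 ;; .set ti 0 ;;
      .loop tj g (
        .set d (x % D) ;; .set x (x / D) ;;
        .ite (d / hb % 2) 1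
          (.set y0 (y0 + d * p0) ;; .set p0 (p0 * D) ;; .set ti (ti + tc))
          (.set y1 (y1 + d * p1) ;; .set p1 (p1 * D) ;; .set tc (tc + 1))) ;;
      .set ix (beta * W + tb) ;;
      .put TY0 ix y0 ;; .put TP0 ix p0 ;; .put TY1 ix y1 ;; .put TP1 ix p1 ;;
      .put TC ix tc ;; .put TI ix ti))

end

/-- The tables at index `ix` describe the block `l` with respect to bit `b`. -/
structure EntryAt (D b ix : ℕ) (s : Store) (l : List ℕ) : Prop where
  TY0 : s.a .TY0 ix = Nat.ofDigits D (l.filter (!bitSet b ·))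
  TP0 : s.a .TP0 ix = D ^ (l.filter (!bitSet b ·)).length
  TY1 : s.a .TY1 ix = Nat.ofDigits D (l.filter (bitSet b))
  TP1 : s.a .TP1 ix = D ^ (l.filter (bitSet b)).length
  TC : s.a .TC ix = l.countP (bitSet b)
  TI : s.a .TI ix = cross (bitSet b) l

/-- All table entries are correct. -/
def Tables (D g : ℕ) (s : Store) : Prop :=
  ∀ b < g, ∀ l : List ℕ, l.length = g → (∀ x ∈ l, x < D) →
    EntryAt D b (b * D ^ g + Nat.ofDigits D l) s l

theorem cross_le (p : ℕ → Bool) (l : List ℕ) : cross p l ≤ l.length * l.length := by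
  induction l with
  | nil => simp [cross]
  | cons x l ih =>
    have := l.countP_le_length (p := fun y => !p y)
    simp only [cross, List.length_cons]
    split_ifs <;> nlinarith

/-- Padded with zero digits, every number below `D ^ g` is a block of exactly `g` digits; running
through all numbers below `W` therefore reaches every block. -/
theorem exists_ofDigits {D : ℕ} (hD : 2 ≤ D) (g X : ℕ) (hX : X < D ^ g) :
    ∃ l : List ℕ, l.length = g ∧ (∀ x ∈ l, x < D) ∧ Nat.ofDigits D l = X := by
  induction g generalizing X with
  | zero => exact ⟨[], rfl, by simp, by simp at hX; simp [hX]⟩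
  | succ g ih =>
    obtain ⟨l, h1, h2, h3⟩ := ih (X / D) (Nat.div_lt_of_lt_mul (by rwa [pow_succ'] at hX))
    refine ⟨X % D :: l, by simp [h1], ?_, ?_⟩
    · intro x hx
      rcases List.mem_cons.1 hx with rfl | hx
      exacts [Nat.mod_lt _ (by omega), h2 x hx]
    · rw [Nat.ofDigits_cons, h3]
      exact Nat.mod_add_div _ _

/-- Each block is split digit by digit. Whenever a digit without the bit appears, the ones met so
far are added to the crossing count. -/
theorem buildTables_spec {U B D g : ℕ} {s : Store} (hD : 2 ≤ D) (hg : s.v .g = g)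
    (hvD : s.v .D = D) (hW : s.v .W = D ^ g) (hPW : ∀ i < g, s.a .PW i = 2 ^ i)
    (hU : g * D ^ g < U) (hU1 : g * g < U) (hU2 : D ^ g < U) :
    wp U B buildTables s fun k s' =>
      k ≤ 4 + g * (D ^ g * (60 * g + 100) + 100) ∧ Tables D g s' := by
  refine (wp_loop (fun β s => ∀ b l, l.length = g → (∀ x ∈ l, x < D) → b < β →
      EntryAt D b (b * D ^ g + Nat.ofDigits D l) s l)
    (D ^ g * (60 * g + 100) + 50) (by decide)
    (fun b l _ _ hb => absurd hb (by simp)) ?_).mono ?_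
  · intro β hβ s1 f1 hβ1 hI1
    rw [hg] at hβ
    rw [wp_seq, wp_set]
    refine ⟨by simp, ?_⟩
    have hhb : s1.a .PW β = 2 ^ β := by rw [f1.a _ rfl, hPW β hβ]
    simp only [Expr.eval_get, Expr.eval_var, hβ1, hhb]
    refine (wp_loop (fun X s => ∀ b l, l.length = g → (∀ x ∈ l, x < D) →
      (b < β ∨ b = β ∧ Nat.ofDigits D l < X) →
      EntryAt D b (b * D ^ g + Nat.ofDigits D l) s l) (60 * g + 90) (by decide) ?_ ?_).mono ?_
    · rintro b l hl hlt (hb | hb)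
      · have := hI1 b l hl hlt hb
        exact ⟨this.TY0, this.TP0, this.TY1, this.TP1, this.TC, this.TI⟩
      · exact absurd hb.2 (by simp)
    · intro X hX s2 f2 hX2 hI2
      have hX : X < D ^ g := by simpa [f1.v .W rfl, hW] using hX
      obtain ⟨l, hl, hlt, hlX⟩ := exists_ofDigits hD g X hX
      simp only [wp_seq (c := .set _ _), wp_set, Expr.safe_ofNat, Expr.safe_var, true_and]
      have g2 : s2.v .g = g := by rw [f2.v _ rfl]; simp [f1.v .g rfl, hg]
      have D2 : s2.v .D = D := by rw [f2.v _ rfl]; simp [f1.v .D rfl, hvD]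
      have hb2 : s2.v .hb = 2 ^ β := by rw [f2.v _ rfl]; simp
      have W2 : s2.v .W = D ^ g := by rw [f2.v _ rfl]; simp [f1.v .W rfl, hW]
      have β2 : s2.v .beta = β := by rw [f2.v _ rfl]; simp [hβ1]
      refine (wp_loop (fun j s => s.v .x = Nat.ofDigits D (l.drop j) ∧
        s.v .y0 = Nat.ofDigits D ((l.take j).filter (!bitSet β ·)) ∧
        s.v .p0 = D ^ ((l.take j).filter (!bitSet β ·)).length ∧
        s.v .y1 = Nat.ofDigits D ((l.take j).filter (bitSet β)) ∧
        s.v .p1 = D ^ ((l.take j).filter (bitSet β)).length ∧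
        s.v .tc = (l.take j).countP (bitSet β) ∧
        s.v .ti = cross (bitSet β) (l.take j)) 50 (by decide)
        ⟨by simp [hX2, hlX], by simp, by simp, by simp, by simp, by simp, by simp [cross]⟩
        ?_).seq ?_
      · rintro j hj s3 f3 - ⟨i1, i2, i3, i4, i5, i6, i7⟩
        have hj : j < l.length := by simpa [g2, hl] using hj
        have D3 : s3.v .D = D := by rw [f3.v _ rfl]; simp [D2]
        have hb3 : s3.v .hb = 2 ^ β := by rw [f3.v _ rfl]; simp [hb2]
        have hdj : l[j] < D := hlt _ (List.getElem_mem hj)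
        rw [List.drop_eq_getElem_cons hj, Nat.ofDigits_cons] at i1
        have e1 : s3.v .x % D = l[j] := by simp [i1, Nat.mod_eq_of_lt hdj]
        have e2 : s3.v .x / D = Nat.ofDigits D (l.drop (j + 1)) := by
          rw [i1, Nat.add_mul_div_left _ _ (by omega)]
          simp [Nat.div_eq_of_lt hdj]
        have htk : l.take (j + 1) = l.take j ++ [l[j]] := (List.take_concat_get' l j hj).symm
        have hbit : ∀ q : ℕ → Bool, Nat.ofDigits D ((l.take (j + 1)).filter q) < D ^ g ∧
            ((l.take (j + 1)).filter q).length ≤ g := by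
          intro q
          have h1 : ((l.take (j + 1)).filter q).length ≤ g :=
            (List.length_filter_le _ _).trans (by simp; omega)
          refine ⟨lt_of_lt_of_le (Nat.ofDigits_lt_base_pow_length (by omega) fun x hx => ?_)
            (Nat.pow_le_pow_right (by omega) h1), h1⟩
          exact hlt x (List.mem_of_mem_take (List.mem_of_mem_filter hx))
        have hcr : cross (bitSet β) (l.take (j + 1)) ≤ g * g := by
          refine (cross_le _ _).trans (Nat.mul_le_mul ?_ ?_) <;> simp <;> omega
        have hct : (l.take (j + 1)).countP (bitSet β) ≤ g :=
          List.countP_le_length.trans (by simp; omega)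
        have hct2 : g ≤ g * g := Nat.le_mul_self g
        have hbits : l[j] / 2 ^ β % 2 < 1 ↔ bitSet β l[j] = false := by
          simp only [bitSet, decide_eq_false_iff_not]; omega
        simp only [wp_seq, wp_set, wp_ite]
        simp only [Expr.safe_add, Expr.safe_mul, Expr.safe_var, Expr.safe_mod, Expr.safe_div,
          Expr.eval_add, Expr.eval_mul, Expr.eval_var, Expr.eval_mod, Expr.eval_div,
          Expr.safe_ofNat, Expr.eval_ofNat, Store.setv_v, Store.seta_v, reduceCtorEq, if_true,
          if_false, true_and, D3, e1, e2, hb3, hbits, i2, i3, i4, i5, i6, i7, htk]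
        have hf := hbit (!bitSet β ·)
        have ht := hbit (bitSet β)
        rw [htk] at hf ht hcr hct
        refine ⟨fun hp => ?_, fun hp => ?_⟩
        · have hp' : (!bitSet β l[j]) = true := by simp [hp]
          have hc1 : cross (bitSet β) [l[j]] = 0 := by simp [cross]
          simp only [List.filter_append, List.filter_cons, hp, hp', if_true, if_false, Bool.false_eq_true, List.filter_nil, Bool.not_false,
            Bool.not_true,
            Nat.ofDigits_append, Nat.ofDigits_singleton, List.length_append, List.length_singleton,
            cross_append, hc1, List.countP_append, List.countP_cons, List.countP_nil] at hf ht hcr ⊢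
          rw [mul_comm l[j], ← pow_succ]
          have hp2 : D ^ ((List.filter (fun x => !bitSet β x) (List.take j l)).length + 1) < U :=
            (Nat.pow_le_pow_right (by omega) hf.2).trans_lt hU2
          simp at hcr ⊢
          refine ⟨⟨?_, ?_⟩, ?_, ?_⟩ <;> omega
        · have hp1 : bitSet β l[j] = true := by simpa using hp
          have hp' : (!bitSet β l[j]) = false := by simp [hp1]
          have hc1 : cross (bitSet β) [l[j]] = 0 := by simp [cross]
          simp only [List.filter_append, List.filter_cons, hp1, hp', if_true, if_false, Bool.false_eq_true, List.filter_nil, Bool.not_false,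
            Bool.not_true,
            Nat.ofDigits_append, Nat.ofDigits_singleton, List.length_append, List.length_singleton,
            cross_append, hc1, List.countP_append, List.countP_cons, List.countP_nil] at hf ht hct ⊢
          rw [mul_comm l[j], ← pow_succ]
          have hp2 : D ^ ((List.filter (bitSet β) (List.take j l)).length + 1) < U :=
            (Nat.pow_le_pow_right (by omega) ht.2).trans_lt hU2
          simp at hct ⊢
          refine ⟨⟨?_, ?_⟩, ?_, ?_⟩ <;> omega
      · rintro k3 s3 f3 ⟨hk3, -, i2, i3, i4, i5, i6, i7⟩
        simp only [Store.setv_v, reduceCtorEq, if_false, g2] at hk3 i2 i3 i4 i5 i6 i7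
        rw [List.take_of_length_le hl.le] at i2 i3 i4 i5 i6 i7
        have W3 : s3.v .W = D ^ g := by rw [f3.v _ rfl]; simp [W2]
        have β3 : s3.v .beta = β := by rw [f3.v _ rfl]; simp [β2]
        have X3 : s3.v .tb = X := by rw [f3.v _ rfl]; simp [hX2]
        have hix : (β + 1) * D ^ g ≤ g * D ^ g := Nat.mul_le_mul_right _ hβ
        rw [add_mul, one_mul] at hix
        simp only [wp_seq, wp_set, wp_put]
        simp only [Expr.safe_add, Expr.safe_mul, Expr.safe_var, Expr.eval_add, Expr.eval_mul,
          Expr.eval_var, Store.setv_v, Store.seta_v, reduceCtorEq, if_true, if_false, true_and,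
          W3, β3, X3, i2, i3, i4, i5, i6, i7, false_imp_iff, and_true]
        refine ⟨⟨by omega, by omega⟩, by simp; omega, fun b l' hl' hlt' hb => ?_⟩
        have hl'g : Nat.ofDigits D l' < D ^ g :=
          hl' ▸ Nat.ofDigits_lt_base_pow_length (by omega) hlt'
        by_cases hnew : b = β ∧ Nat.ofDigits D l' = X
        · obtain ⟨rfl, h2⟩ := hnew
          have : l' = l := Nat.ofDigits_inj_of_len_eq (by omega) (hl'.trans hl.symm) hlt' hlt
            (h2.trans hlX.symm)
          subst this
          constructor <;> simp [h2]
        · have hne : b * D ^ g + Nat.ofDigits D l' ≠ β * D ^ g + X := by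
            intro he
            -- Block values are below `D ^ g`, so dividing the index by `D ^ g` recovers the bit
            -- position; distinct entries never overwrite each other.
            have hb' : b = β := by
              have := congrArg (· / D ^ g) he
              simpa [mul_comm _ (D ^ g), Nat.mul_add_div (Nat.zero_lt_of_lt hX),
                Nat.div_eq_of_lt hl'g, Nat.div_eq_of_lt hX] using this
            subst hb'
            exact hnew ⟨rfl, by omega⟩
          have hold := hI2 b l' hl' hlt' (by omega)
          have fa : ∀ k, k ∈ [Arr.TY0, .TP0, .TY1, .TP1, .TC, .TI] → s3.a k = s2.a k := by
            intro k hk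
            rw [f3.a k (by simp at hk; rcases hk with rfl | rfl | rfl | rfl | rfl | rfl <;> rfl)]
            simp
          constructor <;>
            simp [hne, fa, hold.TY0, hold.TP0, hold.TY1, hold.TP1, hold.TC, hold.TI]
    · rintro k s2 f2 ⟨hk2, h2⟩
      simp only [Store.setv_v, reduceCtorEq, if_false, f1.v .W rfl, hW] at hk2 h2
      refine ⟨?_, fun b l hl hlt hb => ?_⟩
      · simp
        have : 60 * g + 90 + 3 ≤ 60 * g + 100 := by omega
        have := Nat.mul_le_mul_left (D ^ g) this
        omega
      · have hl'g : Nat.ofDigits D l < D ^ g :=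
          hl ▸ Nat.ofDigits_lt_base_pow_length (by omega) hlt
        have := h2 b l hl hlt (by omega)
        exact ⟨this.TY0, this.TP0, this.TY1, this.TP1, this.TC, this.TI⟩
  · rintro k s1 - ⟨hk, h1⟩
    rw [hg] at h1 hk
    refine ⟨hk.trans ?_, fun b hb l hl hlt => h1 b l hl hlt hb⟩
    have : D ^ g * (60 * g + 100) + 50 + 3 ≤ D ^ g * (60 * g + 100) + 100 := by omega
    have := Nat.mul_le_mul_left g this
    omega

end SingleCrossing

namespace SingleCrossing

/-! ### One level of the packed bitwise radix sort -/

section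

open Var Arr

/-- Appends the entries of a group without the current bit and counts the crossings. -/
def zerosPass : Cmd :=
  .loop wi wm (
    .set x (.get A (q * wm + wi)) ;; .set ix (beta * W + x) ;;
    .set tot (tot + (ones * (g - .get TC ix) + .get TI ix)) ;; .set ones (ones + .get TC ix) ;;
    .set y (.get TY0 ix) ;; .set yp (.get TP0 ix) ;; streamAppend)

/-- Appends the entries of a group with the current bit. -/
def onesPass : Cmd :=
  .loop wi wm (
    .set x (.get A (q * wm + wi)) ;; .set ix (beta * W + x) ;;
    .set y (.get TY1 ix) ;; .set yp (.get TP1 ix) ;; streamAppend)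

/-- Sorts the packed list by one more bit and counts the crossings. -/
def levelPass : Cmd :=
  .set wm (.get PW (bit + 1) / g) ;; .set ng (N / .get PW (bit + 1)) ;; streamInit ;;
  .loop q ng (.set ones 0 ;; zerosPass ;; onesPass) ;;
  .loop wi nW (.put A wi (.get OUT wi))

end

/-- The parameters and tables are set up for lists of length `2 ^ L` and blocks of `2 ^ γ` digits
of `2 ^ γ` bits. -/
structure Env (U L γ : ℕ) (s : Store) : Prop where
  sq_le : 2 ^ γ * 2 ^ γ ≤ L
  W_le : (2 ^ 2 ^ γ) ^ 2 ^ γ * (2 ^ 2 ^ γ) ^ 2 ^ γ ≤ 2 * 2 ^ L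
  U_ge : 16 * (2 ^ L * 2 ^ L) ≤ U
  vL : s.v .L = L
  vN : s.v .N = 2 ^ L
  vgam : s.v .gam = γ
  vg : s.v .g = 2 ^ γ
  vD : s.v .D = 2 ^ 2 ^ γ
  vW : s.v .W = (2 ^ 2 ^ γ) ^ 2 ^ γ
  vR : s.v .R = (L - γ + 2 ^ γ - 1) / 2 ^ γ
  vnW : s.v .nW = 2 ^ (L - γ)
  PW : ∀ i ≤ L, s.a .PW i = 2 ^ i
  tables : Tables (2 ^ 2 ^ γ) (2 ^ γ) s

/-- The command leaves the parameters and tables alone. -/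
def Cmd.keepsEnv (c : Cmd) : Bool :=
  [Var.L, .N, .gam, .g, .D, .W, .R, .nW].all (fun x => !c.writes x) &&
    [Arr.PW, .TY0, .TP0, .TY1, .TP1, .TC, .TI].all (fun k => !c.writesA k)

theorem Env.frame {U L γ : ℕ} {c : Cmd} {s s' : Store} (h : Env U L γ s) (f : Frame c s s')
    (hc : c.keepsEnv = true) : Env U L γ s' := by
  simp only [Cmd.keepsEnv, List.all_cons, List.all_nil, Bool.and_true, Bool.and_eq_true,
    Bool.not_eq_true'] at hc
  obtain ⟨⟨c1, c2, c3, c4, c5, c6, c7, c8⟩, a1, a2, a3, a4, a5, a6, a7⟩ := hc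
  refine ⟨h.sq_le, h.W_le, h.U_ge, by rw [f.v _ c1, h.vL], by rw [f.v _ c2, h.vN],
    by rw [f.v _ c3, h.vgam], by rw [f.v _ c4, h.vg], by rw [f.v _ c5, h.vD], by rw [f.v _ c6, h.vW],
    by rw [f.v _ c7, h.vR], by rw [f.v _ c8, h.vnW], by rw [f.a _ a1]; exact h.PW, ?_⟩
  intro b hb l hl hlt
  have := h.tables b hb l hl hlt
  constructor
  · rw [f.a _ a2, this.TY0]
  · rw [f.a _ a3, this.TP0]
  · rw [f.a _ a4, this.TY1]
  · rw [f.a _ a5, this.TP1]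
  · rw [f.a _ a6, this.TC]
  · rw [f.a _ a7, this.TI]

theorem Env.setv {U L γ : ℕ} {s : Store} (h : Env U L γ s) (x : Var) (y : ℕ)
    (hx : x ∉ [Var.L, .N, .gam, .g, .D, .W, .R, .nW]) : Env U L γ (s.setv x y) := by
  -- A dummy assignment to `x` has the same frame as `setv`.
  refine h.frame (c := .set x 0) ⟨fun z hz => ?_, fun _ _ => rfl⟩ ?_
  · simp only [Cmd.writes, decide_eq_false_iff_not] at hz
    simp [Ne.symm hz]
  · simp only [List.mem_cons, List.not_mem_nil, or_false, not_or] at hx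
    simp [Cmd.keepsEnv, Cmd.writes, Cmd.writesA, hx]

theorem Env.bounds {U L γ : ℕ} {s : Store} (h : Env U L γ s) :
    γ ≤ L ∧ 2 ^ γ ≤ L ∧ L < 2 ^ L ∧ (2 ^ 2 ^ γ) ^ 2 ^ γ ≤ 2 ^ L ∧
      2 ^ γ * (2 ^ 2 ^ γ) ^ 2 ^ γ ≤ 2 ^ L * 2 ^ L := by
  have h1 := h.sq_le
  have h2 : 2 ^ γ ≤ 2 ^ γ * 2 ^ γ := Nat.le_mul_self _
  have h3 : γ < 2 ^ γ := Nat.lt_two_pow_self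
  have h4 : L < 2 ^ L := Nat.lt_two_pow_self
  have h5 : (2 ^ 2 ^ γ) ^ 2 ^ γ ≤ 2 ^ L := by
    rw [← pow_mul]; exact Nat.pow_le_pow_right (by norm_num) h1
  exact ⟨by omega, by omega, h4, h5, Nat.mul_le_mul (by omega) h5⟩

/-- Crossings counted on part of a list never exceed the final count, so a bound on the latter
excludes overflow of the running total. -/
theorem cross_sublist_le {p : ℕ → Bool} {l l' : List ℕ} (h : l.Sublist l') :
    cross p l ≤ cross p l' := by
  induction h with
  | slnil => exact le_rfl
  | cons x _ ih => exact ih.trans (Nat.le_add_left _ _)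
  | cons_cons x h ih =>
    have := h.countP_le (p := fun y => !p y)
    simp only [cross]
    split_ifs <;> omega

theorem countP_not_add (p : ℕ → Bool) (l : List ℕ) :
    l.countP (!p ·) = l.length - l.countP p := by
  have := l.length_eq_countP_add_countP (p := p)
  have h2 : l.countP (!p ·) = l.countP (fun a => decide ¬p a = true) :=
    List.countP_congr fun x _ => by simp
  omega

section

variable {U B L γ : ℕ} {s : Store}

theorem Env.lookup (h : Env U L γ s) {β i : ℕ} {G : List ℕ} (hβ : β < 2 ^ γ)
    (hi : i < G.length / 2 ^ γ) (hG : ∀ x ∈ G, x < 2 ^ 2 ^ γ) :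
    β * (2 ^ 2 ^ γ) ^ 2 ^ γ + Nat.ofDigits (2 ^ 2 ^ γ) (chunk (2 ^ γ) i G) < U ∧
    EntryAt (2 ^ 2 ^ γ) β
      (β * (2 ^ 2 ^ γ) ^ 2 ^ γ + Nat.ofDigits (2 ^ 2 ^ γ) (chunk (2 ^ γ) i G)) s
      (chunk (2 ^ γ) i G) := by
  have hl := length_chunk hi
  have hd : ∀ x ∈ chunk (2 ^ γ) i G, x < 2 ^ 2 ^ γ := fun x hx => hG x (mem_of_mem_chunk hx)
  refine ⟨?_, h.tables β hβ _ hl hd⟩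
  have hD : 1 < 2 ^ 2 ^ γ := Nat.one_lt_two_pow (by positivity)
  have h1 := Nat.ofDigits_lt_base_pow_length hD hd
  rw [hl] at h1
  have h2 : (β + 1) * (2 ^ 2 ^ γ) ^ 2 ^ γ ≤ 2 ^ γ * (2 ^ 2 ^ γ) ^ 2 ^ γ :=
    Nat.mul_le_mul_right _ hβ
  rw [add_mul, one_mul] at h2
  have := h.bounds
  have := h.U_ge
  omega

/-- A group `G` is read word by word. `ones` counts the digits with the bit in earlier words, so by
`cross_append` the next word adds `ones` times its zeros, plus its tabulated inner crossings. -/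
theorem zerosPass_spec (h : Env U L γ s) {β m q T : ℕ} {G out : List ℕ} (hβ : β < 2 ^ γ)
    (hbeta : s.v .beta = β) (hm : s.v .wm = m) (hq : s.v .q = q)
    (hGl : G.length = m * 2 ^ γ) (hG : ∀ x ∈ G, x < 2 ^ 2 ^ γ)
    (hA : ∀ i < m, s.a .A (q * m + i) = Nat.ofDigits (2 ^ 2 ^ γ) (chunk (2 ^ γ) i G))
    (hqU : q * m + m < U) (hones : s.v .ones = 0) (htot : s.v .tot = T)
    (hT : T + cross (bitSet β) G < U)
    (hout : out.length + G.length + 1 < U) (hs : Stream (2 ^ 2 ^ γ) (2 ^ γ) s out) :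
    wp U B zerosPass s fun k s' => k ≤ 2 + m * 200 ∧
      Stream (2 ^ 2 ^ γ) (2 ^ γ) s' (out ++ G.filter (!bitSet β ·)) ∧
      s'.v .tot = T + cross (bitSet β) G := by
  have hg : 0 < 2 ^ γ := by positivity
  have hD : 2 ≤ 2 ^ 2 ^ γ := Nat.one_lt_two_pow (by positivity)
  have hdiv : G.length / 2 ^ γ = m := by rw [hGl, Nat.mul_div_cancel _ hg]
  refine (wp_loop (fun i s =>
    Stream (2 ^ 2 ^ γ) (2 ^ γ) s (out ++ (G.take (i * 2 ^ γ)).filter (!bitSet β ·)) ∧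
    s.v .ones = (G.take (i * 2 ^ γ)).countP (bitSet β) ∧
    s.v .tot = T + cross (bitSet β) (G.take (i * 2 ^ γ))) 190 (by decide) ?_ ?_).mono ?_
  · refine ⟨?_, by simp [hones], by simp [htot, cross]⟩
    simpa using (⟨hs.lt, hs.oi, hs.acc, hs.accP, hs.out⟩ : Stream _ _ (s.setv .wi 0) out)
  · rintro i hi s1 f1 hi1 ⟨I1, I2, I3⟩
    rw [hm] at hi
    have e1 : Env U L γ s1 := h.frame f1 (by decide)
    obtain ⟨hixU, ent⟩ := e1.lookup hβ (i := i) (by omega) hG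
    have hcl : (chunk (2 ^ γ) i G).length = 2 ^ γ := length_chunk (by omega)
    set ch := chunk (2 ^ γ) i G with hch
    have hA1 : s1.a .A (q * m + i) = Nat.ofDigits (2 ^ 2 ^ γ) ch := by
      rw [f1.a _ rfl, hA i hi]
    have q1 : s1.v .q = q := by rw [f1.v _ rfl, hq]
    have m1 : s1.v .wm = m := by rw [f1.v _ rfl, hm]
    have b1 : s1.v .beta = β := by rw [f1.v _ rfl, hbeta]
    have htk := take_succ_mul (2 ^ γ) i G
    rw [← hch] at htk
    have hcr : cross (bitSet β) (G.take ((i + 1) * 2 ^ γ)) ≤ cross (bitSet β) G :=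
      cross_sublist_le (List.take_sublist _ _)
    have hcnt : (G.take ((i + 1) * 2 ^ γ)).countP (bitSet β) ≤ G.length :=
      ((List.take_sublist _ _).countP_le).trans List.countP_le_length
    have hfl : ((G.take (i * 2 ^ γ)).filter (!bitSet β ·)).length ≤ G.length :=
      ((List.filter_sublist).trans (List.take_sublist _ _)).length_le
    have hcc : ch.countP (bitSet β) ≤ 2 ^ γ := hcl ▸ List.countP_le_length
    rw [htk, cross_append, countP_not_add, hcl] at hcr
    rw [htk, List.countP_append] at hcnt
    have hbW : β * (2 ^ 2 ^ γ) ^ 2 ^ γ < U := by omega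
    simp only [wp_seq (c := .set _ _), wp_set]
    simp only [Expr.safe_add, Expr.safe_mul, Expr.safe_sub, Expr.safe_var, Expr.safe_get,
      Expr.eval_add, Expr.eval_mul, Expr.eval_sub, Expr.eval_var, Expr.eval_get, Store.setv_v,
      Store.setv_a, reduceCtorEq, if_true, if_false, true_and, false_imp_iff, and_true, hi1, q1, m1,
      b1, hA1, e1.vW, e1.vg, I2, I3, ent.TC, ent.TI, ent.TY0, ent.TP0]
    refine ⟨⟨by omega, by omega⟩, ⟨hbW, hixU⟩, ⟨⟨⟨hcc, by omega⟩, by omega⟩, by omega⟩, by omega, ?_⟩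
    refine (streamAppend_spec (g := 2 ^ γ) (out := out ++ (G.take (i * 2 ^ γ)).filter (!bitSet β ·))
      (l := ch.filter (!bitSet β ·)) hD hg (by simp [e1.vW]) ?_ ?_ ?_ (by simp)
      (by simp) ?_ ?_).mono ?_
    · have := h.W_le
      have := h.U_ge
      have : 2 ^ L ≤ 2 ^ L * 2 ^ L := Nat.le_mul_self _
      have : 0 < 2 ^ L := by positivity
      omega
    · rw [List.length_append]; omega
    · exact ⟨I1.lt, I1.oi, I1.acc, I1.accP, I1.out⟩
    · exact (List.length_filter_le _ _).trans hcl.le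
    · exact fun x hx => hG x (mem_of_mem_chunk (List.mem_of_mem_filter hx))
    · rintro k s2 f2 ⟨hk, hst⟩
      refine ⟨by simp; omega, ?_, ?_, ?_⟩
      · rw [htk, List.filter_append, ← List.append_assoc]
        exact ⟨hst.lt, hst.oi, hst.acc, hst.accP, hst.out⟩
      · simp [f2.v .ones rfl, htk]
      · simp [f2.v .tot rfl, htk, cross_append, countP_not_add, hcl]; ring
  · rintro k s1 f1 ⟨hk, i1, -, i3⟩
    have : G.take (m * 2 ^ γ) = G := List.take_of_length_le hGl.le
    rw [hm] at hk i1 i3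
    rw [this] at i1 i3
    exact ⟨by omega, i1, i3⟩

theorem onesPass_spec (h : Env U L γ s) {β m q : ℕ} {G out : List ℕ} (hβ : β < 2 ^ γ)
    (hbeta : s.v .beta = β) (hm : s.v .wm = m) (hq : s.v .q = q)
    (hGl : G.length = m * 2 ^ γ) (hG : ∀ x ∈ G, x < 2 ^ 2 ^ γ)
    (hA : ∀ i < m, s.a .A (q * m + i) = Nat.ofDigits (2 ^ 2 ^ γ) (chunk (2 ^ γ) i G))
    (hqU : q * m + m < U)
    (hout : out.length + G.length + 1 < U) (hs : Stream (2 ^ 2 ^ γ) (2 ^ γ) s out) :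
    wp U B onesPass s fun k s' => k ≤ 2 + m * 200 ∧
      Stream (2 ^ 2 ^ γ) (2 ^ γ) s' (out ++ G.filter (bitSet β)) := by
  have hg : 0 < 2 ^ γ := by positivity
  have hD : 2 ≤ 2 ^ 2 ^ γ := Nat.one_lt_two_pow (by positivity)
  have hdiv : G.length / 2 ^ γ = m := by rw [hGl, Nat.mul_div_cancel _ hg]
  refine (wp_loop (fun i s =>
    Stream (2 ^ 2 ^ γ) (2 ^ γ) s (out ++ (G.take (i * 2 ^ γ)).filter (bitSet β)))
    190 (by decide) ?_ ?_).mono ?_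
  · simpa using (⟨hs.lt, hs.oi, hs.acc, hs.accP, hs.out⟩ : Stream _ _ (s.setv .wi 0) out)
  · rintro i hi s1 f1 hi1 I1
    rw [hm] at hi
    have e1 : Env U L γ s1 := h.frame f1 (by decide)
    obtain ⟨hixU, ent⟩ := e1.lookup hβ (i := i) (by omega) hG
    have hcl : (chunk (2 ^ γ) i G).length = 2 ^ γ := length_chunk (by omega)
    set ch := chunk (2 ^ γ) i G with hch
    have hA1 : s1.a .A (q * m + i) = Nat.ofDigits (2 ^ 2 ^ γ) ch := by
      rw [f1.a _ rfl, hA i hi]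
    have q1 : s1.v .q = q := by rw [f1.v _ rfl, hq]
    have m1 : s1.v .wm = m := by rw [f1.v _ rfl, hm]
    have b1 : s1.v .beta = β := by rw [f1.v _ rfl, hbeta]
    have htk := take_succ_mul (2 ^ γ) i G
    rw [← hch] at htk
    have hfl : ((G.take (i * 2 ^ γ)).filter (bitSet β)).length ≤ G.length :=
      ((List.filter_sublist).trans (List.take_sublist _ _)).length_le
    have hbW : β * (2 ^ 2 ^ γ) ^ 2 ^ γ < U := by omega
    simp only [wp_seq (c := .set _ _), wp_set]
    simp only [Expr.safe_add, Expr.safe_mul, Expr.safe_sub, Expr.safe_var, Expr.safe_get,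
      Expr.eval_add, Expr.eval_mul, Expr.eval_sub, Expr.eval_var, Expr.eval_get, Store.setv_v,
      Store.setv_a, reduceCtorEq, if_true, if_false, true_and, false_imp_iff, and_true, hi1, q1, m1,
      b1, hA1, e1.vW, e1.vg, ent.TY1, ent.TP1]
    refine ⟨⟨by omega, by omega⟩, ⟨hbW, hixU⟩, ?_⟩
    refine (streamAppend_spec (g := 2 ^ γ) (out := out ++ (G.take (i * 2 ^ γ)).filter (bitSet β))
      (l := ch.filter (bitSet β)) hD hg (by simp [e1.vW]) ?_ ?_ ?_ (by simp)
      (by simp) ?_ ?_).mono ?_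
    · have := h.W_le
      have := h.U_ge
      have : 2 ^ L ≤ 2 ^ L * 2 ^ L := Nat.le_mul_self _
      have : 0 < 2 ^ L := by positivity
      omega
    · rw [List.length_append]; omega
    · exact ⟨I1.lt, I1.oi, I1.acc, I1.accP, I1.out⟩
    · exact (List.length_filter_le _ _).trans hcl.le
    · exact fun x hx => hG x (mem_of_mem_chunk (List.mem_of_mem_filter hx))
    · rintro k s2 f2 ⟨hk, hst⟩
      refine ⟨by simp; omega, ?_⟩
      rw [htk, List.filter_append, ← List.append_assoc]
      exact ⟨hst.lt, hst.oi, hst.acc, hst.accP, hst.out⟩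
  · rintro k s1 f1 ⟨hk, i1⟩
    have : G.take (m * 2 ^ γ) = G := List.take_of_length_le hGl.le
    rw [hm] at hk i1
    rw [this] at i1
    exact ⟨by omega, i1⟩

end

end SingleCrossing

/-! ### Digits of entries and the level pass. -/

namespace SingleCrossing

/-- The digit of `2 ^ γ` bits that starts at bit `lo`. -/
def digit (γ lo v : ℕ) : ℕ := v / 2 ^ lo % 2 ^ 2 ^ γ

theorem digit_lt (γ lo v : ℕ) : digit γ lo v < 2 ^ 2 ^ γ := Nat.mod_lt _ (by positivity)

/-- Within a round only bits `lo` to `lo + 2 ^ γ - 1` are tested, and the digit at `lo` retains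
them. So the packed digits can stand in for the entries in counting and splitting. -/
theorem bitSet_digit {γ lo β : ℕ} (hβ : β < 2 ^ γ) (v : ℕ) :
    bitSet β (digit γ lo v) = bitSet (lo + β) v := by
  have h : ∀ k v, bitSet k v = v.testBit k := fun k v =>
    (Nat.testBit_eq_decide_div_mod_eq).symm
  rw [h, h, digit, Nat.testBit_mod_two_pow, Nat.testBit_div_two_pow]
  simp [hβ, add_comm]

theorem cross_map_digit {γ lo β : ℕ} (hβ : β < 2 ^ γ) (l : List ℕ) :
    cross (bitSet β) (l.map (digit γ lo)) = cross (bitSet (lo + β)) l := by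
  rw [cross_map]
  exact cross_congr _ fun v _ => bitSet_digit hβ v

theorem filter_map_digit {γ lo β : ℕ} (hβ : β < 2 ^ γ) (l : List ℕ) :
    (l.map (digit γ lo)).filter (bitSet β) = (l.filter (bitSet (lo + β))).map (digit γ lo) := by
  rw [List.filter_map]
  congr 1
  exact List.filter_congr fun v _ => bitSet_digit hβ v

theorem filter_not_map_digit {γ lo β : ℕ} (hβ : β < 2 ^ γ) (l : List ℕ) :
    (l.map (digit γ lo)).filter (!bitSet β ·) =
      (l.filter (!bitSet (lo + β) ·)).map (digit γ lo) := by
  rw [List.filter_map]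
  congr 1
  exact List.filter_congr fun v _ => congrArg _ (bitSet_digit hβ v)

theorem sortedFrom_eq (L : ℕ) (a : List ℕ) (k : ℕ) :
    sortedFrom L a k = (List.range (2 ^ (L - k))).flatMap (grp a k) := rfl

theorem length_sortedFrom {L k : ℕ} {a : List ℕ} (ha : a.Perm (List.range (2 ^ L))) (hk : k ≤ L) :
    (sortedFrom L a k).length = 2 ^ L := by
  rw [sortedFrom, length_bucket, ha.length_eq, List.length_range]
  intro x hx
  rw [ha.mem_iff, List.mem_range] at hx
  rw [Nat.div_lt_iff_lt_mul (by positivity), ← pow_add]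
  rwa [Nat.sub_add_cancel hk]

variable {U B L γ : ℕ} {s : Store}

/-- Since `lo ≥ γ`, each of the `M` groups consists of exactly `m` full words and can be processed
separately. The output stream need not be aligned at the boundary between zeros and ones, but it is
again after each group. -/
theorem levelPass_spec (h : Env U L γ s) {a : List ℕ} (ha : a.Perm (List.range (2 ^ L)))
    {lo β T : ℕ} (hlo : γ ≤ lo) (hL : lo + β < L) (hβ : β < 2 ^ γ) (hbit : s.v .bit = lo + β)
    (hbeta : s.v .beta = β)
    (hA : Packed (2 ^ 2 ^ γ) (2 ^ γ) (s.a .A)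
      ((sortedFrom L a (lo + β + 1)).map (digit γ lo))) (htot : s.v .tot = T)
    (hT : T + ∑ q ∈ Finset.range (2 ^ (L - (lo + β + 1))),
      cross (bitSet (lo + β)) (grp a (lo + β + 1) q) < U) :
    wp U B levelPass s fun k s' => k ≤ 600 * 2 ^ (L - γ) ∧
      Packed (2 ^ 2 ^ γ) (2 ^ γ) (s'.a .A) ((sortedFrom L a (lo + β)).map (digit γ lo)) ∧
      s'.v .tot = T + ∑ q ∈ Finset.range (2 ^ (L - (lo + β + 1))),
        cross (bitSet (lo + β)) (grp a (lo + β + 1) q) := by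
  set k := lo + β with hk
  have hg : 0 < 2 ^ γ := by positivity
  set m := 2 ^ (k + 1 - γ) with hm
  set M := 2 ^ (L - (k + 1)) with hM
  have hmg : 2 ^ (k + 1) = m * 2 ^ γ := by rw [hm, ← pow_add]; congr 1; omega
  have hMm : M * m = 2 ^ (L - γ) := by rw [hm, hM, ← pow_add]; congr 1; omega
  have hmdiv : 2 ^ (k + 1) / 2 ^ γ = m := Nat.pow_div (by omega) (by norm_num)
  have hMdiv : 2 ^ L / 2 ^ (k + 1) = M := Nat.pow_div (by omega) (by norm_num)
  have hMpos : 0 < M := by positivity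
  have hmpos : 0 < m := by positivity
  have hnW : 2 ^ (L - γ) ≤ 2 ^ L := Nat.pow_le_pow_right (by norm_num) (by omega)
  have hU := h.U_ge
  have hLb := h.bounds
  have hN2 : 2 ^ L ≤ 2 ^ L * 2 ^ L := Nat.le_mul_self _
  have hgl : ∀ q < M, ((grp a (k + 1) q).map (digit γ lo)).length = m * 2 ^ γ := by
    intro q hq
    rw [List.length_map, length_grp ha (by omega) hq, hmg]
  have hmN : m * 2 ^ γ ≤ 2 ^ L := hmg ▸ Nat.pow_le_pow_right (by norm_num) (by omega)
  -- Word `i` of group `q` sits at index `q * m + i`, since all earlier groups fill exactly `m`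
  -- words each.
  have hword : ∀ q < M, ∀ i < m, s.a .A (q * m + i) =
      Nat.ofDigits (2 ^ 2 ^ γ) (chunk (2 ^ γ) i ((grp a (k + 1) q).map (digit γ lo))) := by
    intro q hq i hi
    have hqi : (q + 1) * m ≤ M * m := Nat.mul_le_mul_right _ hq
    rw [add_mul, one_mul] at hqi
    rw [hA, chunk_map, sortedFrom_eq, ← hM, chunk_flatMap (fun q hq => ?_) hq hi, ← chunk_map]
    · rw [← hgl q hq, List.length_map]
    · rw [List.length_map, length_sortedFrom ha (by omega), Nat.pow_div (by omega) (by norm_num)]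
      omega
  -- Partial outputs are prefixes of the fully sorted list; this bounds the stream length.
  have hlen : ∀ q ≤ M, ((List.range (2 * q)).flatMap (grp a k)).length ≤ 2 ^ L := by
    intro q hq
    have h1 : ((List.range (2 * q)).flatMap (grp a k)).Sublist
        ((List.range (2 ^ (L - k))).flatMap (grp a k)) := by
      have h2 : 2 ^ (L - k) = 2 * q + (2 * M - 2 * q) := by
        have : 2 ^ (L - k) = 2 * M := by rw [hM, ← pow_succ']; congr 1; omega
        omega
      rw [h2, List.range_add, List.flatMap_append]
      exact List.sublist_append_left _ _
    rw [← length_sortedFrom (k := k) ha (by omega)]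
    exact h1.length_le
  simp only [levelPass, wp_seq (c := .set _ _), wp_set]
  simp only [Expr.safe_add, Expr.safe_div, Expr.safe_var, Expr.safe_get, Expr.eval_add,
    Expr.eval_div, Expr.eval_var, Expr.eval_get, Expr.safe_ofNat, Expr.eval_ofNat, Store.setv_v,
    Store.setv_a, reduceCtorEq, if_true, if_false, true_and, false_imp_iff, and_true, hbit,
    h.PW (k + 1) (by omega), h.vg, h.vN, hmdiv, hMdiv]
  refine ⟨by omega, by omega, ?_⟩
  refine (streamInit_spec (D := 2 ^ 2 ^ γ) (g := 2 ^ γ)).seq ?_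
  rintro k1 s1 f1 ⟨hk1, st1⟩
  have e1 : Env U L γ s1 := ((h.setv _ _ (by decide)).setv _ _ (by decide)).frame f1 (by decide)
  have hng : s1.v .ng = M := by simp [f1.v .ng rfl]
  refine (wp_loop (fun q s =>
    Stream (2 ^ 2 ^ γ) (2 ^ γ) s (((List.range (2 * q)).flatMap (grp a k)).map (digit γ lo)) ∧
    s.v .tot = T + ∑ q ∈ Finset.range q, cross (bitSet k) (grp a (k + 1) q))
    (6 + m * 400) (by decide) ?_ ?_).seq ?_
  · exact ⟨⟨by simp, st1.oi, st1.acc, st1.accP, st1.out⟩, by simp [f1.v .tot rfl, htot]⟩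
  · rintro q hq s2 f2 hq2 ⟨I1, I2⟩
    rw [hng] at hq
    have hqi : (q + 1) * m ≤ M * m := Nat.mul_le_mul_right _ hq
    rw [add_mul, one_mul] at hqi
    have e2 : Env U L γ s2 := e1.frame f2 (by decide)
    have A2 : s2.a .A = s.a .A := by rw [f2.a _ rfl, f1.a _ rfl]; rfl
    have m2 : s2.v .wm = m := by rw [f2.v _ rfl, f1.v _ rfl]; simp
    have b2 : s2.v .beta = β := by rw [f2.v _ rfl, f1.v _ rfl]; simp [hbeta]
    have hle1 := hlen q hq.le
    have hle2 := hlen (q + 1) hq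
    have hsum : ∑ q ∈ Finset.range (q + 1), cross (bitSet k) (grp a (k + 1) q) ≤
        ∑ q ∈ Finset.range M, cross (bitSet k) (grp a (k + 1) q) :=
      Finset.sum_le_sum_of_subset (Finset.range_mono hq)
    rw [Finset.sum_range_succ] at hsum
    have hr : List.range (2 * (q + 1)) = List.range (2 * q) ++ [2 * q] ++ [2 * q + 1] := by
      rw [show 2 * (q + 1) = 2 * q + 1 + 1 by ring, List.range_succ, List.range_succ]
    rw [hr, List.flatMap_append, List.flatMap_append, List.flatMap_singleton,
      List.flatMap_singleton, List.length_append, List.length_append] at hle2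
    rw [wp_seq, wp_set]
    refine ⟨trivial, ?_⟩
    refine (zerosPass_spec (G := (grp a (k + 1) q).map (digit γ lo)) (m := m) (q := q)
      (T := T + ∑ q ∈ Finset.range q, cross (bitSet k) (grp a (k + 1) q))
      (e2.setv .ones _ (by decide)) hβ (by simp [b2]) (by simp [m2]) (by simp [hq2]) (hgl q hq)
      (fun x hx => ?_) (fun i hi => ?_) (by omega) (by simp)
      (by simp [I2]) ?_ ?_ (out := ((List.range (2 * q)).flatMap (grp a k)).map (digit γ lo))
      ⟨I1.lt, I1.oi, I1.acc, I1.accP, I1.out⟩).seq ?_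
    · obtain ⟨v, -, rfl⟩ := List.mem_map.1 hx
      exact digit_lt _ _ _
    · simp only [Store.setv_a, A2]
      exact hword q hq i hi
    · rw [cross_map_digit hβ, ← hk]; omega
    · rw [hgl q hq, List.length_map]; omega
    rintro k3 s3 f3 ⟨hk3, st3, tot3⟩
    rw [filter_not_map_digit hβ, ← hk, filter_not_bitSet_grp] at st3
    rw [cross_map_digit hβ, ← hk] at tot3
    refine (onesPass_spec (G := (grp a (k + 1) q).map (digit γ lo)) (m := m) (q := q)
      ((e2.setv .ones _ (by decide)).frame f3 (by decide)) hβ (by simp [f3.v .beta rfl, b2])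
      (by simp [f3.v .wm rfl, m2]) (by simp [f3.v .q rfl, hq2]) (hgl q hq)
      (fun x hx => ?_) (fun i hi => ?_) (by omega) ?_ st3).mono ?_
    · obtain ⟨v, -, rfl⟩ := List.mem_map.1 hx
      exact digit_lt _ _ _
    · rw [f3.a .A rfl]
      simp only [Store.setv_a, A2]
      exact hword q hq i hi
    · rw [hgl q hq, List.length_append, List.length_map, List.length_map]
      omega
    · rintro k4 s4 f4 ⟨hk4, st4⟩
      rw [filter_map_digit hβ, ← hk, filter_bitSet_grp] at st4
      refine ⟨by simp; omega, ?_, ?_⟩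
      · rw [hr, List.flatMap_append, List.flatMap_append, List.flatMap_singleton,
          List.flatMap_singleton, List.map_append, List.map_append]
        exact ⟨st4.lt, st4.oi, st4.acc, st4.accP, st4.out⟩
      · simp [f4.v .tot rfl, tot3, Finset.sum_range_succ, add_assoc]
  rintro k2 s2 f2 ⟨hk2, st2, tot2⟩
  rw [hng] at hk2 st2 tot2
  have h2M : 2 * M = 2 ^ (L - k) := by rw [hM, ← pow_succ']; congr 1; omega
  rw [h2M, ← sortedFrom_eq] at st2
  have e2 : Env U L γ s2 := e1.frame f2 (by decide)
  refine (wp_loop (fun i s => ∀ j < i, s.a .A j = s2.a .OUT j) 20 (by decide) (by simp) ?_).mono ?_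
  · intro i _ s3 f3 hi hI
    simp only [wp_put, Expr.eval_var, Expr.eval_get, hi]
    refine ⟨by simp, by simp, fun j hj => ?_⟩
    simp only [Store.setv_a, Store.seta_a, if_true, Function.update_apply, f3.a .OUT rfl]
    split_ifs with e
    · rw [e]
    · exact hI j (by omega)
  · rintro k3 s3 f3 ⟨hk3, h3⟩
    rw [e2.vnW] at hk3 h3
    refine ⟨?_, fun i hi => ?_, ?_⟩
    -- The overhead per group is absorbed because each group has at least one word; `M * m` is the
    -- total number of words.
    · have h6 : M * (6 + m * 400 + 3) ≤ 410 * (M * m) := by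
        have : M ≤ M * m := Nat.le_mul_of_pos_right _ hmpos
        calc M * (6 + m * 400 + 3) = 400 * (M * m) + 9 * M := by ring
          _ ≤ _ := by omega
      rw [hMm] at h6
      have : 1 ≤ 2 ^ (L - γ) := Nat.one_le_two_pow
      simp
      omega
    · rw [h3 i]
      · exact st2.out i hi
      · rw [List.length_map, length_sortedFrom ha (by omega),
          Nat.pow_div (by omega) (by norm_num)] at hi
        exact hi
    · rw [f3.v _ rfl, tot2]

end SingleCrossing

namespace SingleCrossing

/-! ### Counting inversions -/

section

open Var Arr

/-- Sorts `SQ` stably by the bits from position `top` on into `DST`. -/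
def sortTop : Cmd :=
  .set m N ;; .set H (N / .get PW top) ;;
  .loop i N (.put SRC i (.get SQ i) ;; .put KEY i (.get SQ i / .get PW top)) ;;
  bucketSort

/-- Packs the digits of `DST` at position `lo`. -/
def packPass : Cmd :=
  streamInit ;;
  .loop i N (.set y (.get DST i / .get PW lo % D) ;; .set yp D ;; streamAppend) ;;
  .loop wi nW (.put A wi (.get OUT wi))

/-- Counts the crossings at the bits from `lo` to `top`. -/
def roundPass : Cmd :=
  .set lo (gam + g * (R - 1 - r)) ;; .ite r 1 (.set top L) (.set top (lo + g)) ;;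
  sortTop ;; packPass ;; .set nS (top - lo) ;;
  .loop s nS (.set bit (top - 1 - s) ;; .set beta (bit - lo) ;; levelPass)

/-- Counts the inversions inside consecutive blocks of `g` entries of `DST`. -/
def brutePass : Cmd :=
  .loop q nW (.loop bj g (.loop bk bj (
    .ite (.get DST (q * g + bj)) (.get DST (q * g + bk)) (.set tot (tot + 1)) .skip)))

/-- Counts the inversions of the permutation `SQ` of `0, …, N - 1`. -/
def invCount : Cmd :=
  .set tot 0 ;; .loop r R roundPass ;; .set top gam ;; sortTop ;; brutePass

end

variable {U B L γ : ℕ} {s : Store}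

theorem sortTop_spec (h : Env U L γ s) {a : List ℕ} (ha : a.Perm (List.range (2 ^ L)))
    (hSQ : Holds (s.a .SQ) 0 a) {k : ℕ} (htop : s.v .top = k) (hk : k ≤ L) :
    wp U B sortTop s fun c s' => c ≤ 400 * 2 ^ L ∧ Holds (s'.a .DST) 0 (sortedFrom L a k) := by
  have hlen : a.length = 2 ^ L := by rw [ha.length_eq, List.length_range]
  have hdiv : 2 ^ L / 2 ^ k = 2 ^ (L - k) := Nat.pow_div hk (by norm_num)
  have hLk : 2 ^ (L - k) ≤ 2 ^ L := Nat.pow_le_pow_right (by norm_num) (by omega)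
  have hpos : 1 ≤ 2 ^ L := Nat.one_le_two_pow
  have hU := h.U_ge
  have hN2 : 2 ^ L ≤ 2 ^ L * 2 ^ L := Nat.le_mul_self _
  simp only [sortTop, wp_seq (c := .set _ _), wp_set]
  simp only [Expr.safe_div, Expr.safe_var, Expr.safe_get, Expr.eval_div, Expr.eval_var,
    Expr.eval_get, Store.setv_v, Store.setv_a, reduceCtorEq, if_true, if_false, true_and,
    false_imp_iff, and_true, htop, h.PW k hk, h.vN, hdiv]
  refine (wp_loop (fun i s => (∀ j < i, s.a .SRC j = s.a .SQ j) ∧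
    ∀ j < i, s.a .KEY j = s.a .SQ j / 2 ^ k) 40 (by decide) (by simp) ?_).seq ?_
  · rintro i _ s1 f1 hi ⟨I1, I2⟩
    have t1 : s1.v .top = k := by rw [f1.v _ rfl]; simp [htop]
    have p1 : s1.a .PW k = 2 ^ k := by rw [f1.a _ rfl]; simp [h.PW k hk]
    simp only [wp_seq, wp_put]
    simp [hi, t1, p1]
    refine ⟨fun j hj => ?_, fun j hj => ?_⟩
    · rw [Function.update_apply]; split_ifs with e
      exacts [by rw [e], I1 j (by omega)]
    · rw [Function.update_apply]; split_ifs with e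
      exacts [by rw [e], I2 j (by omega)]
  · rintro k1 s1 f1 ⟨hk1, h1, h2⟩
    have n1 : s1.v .N = 2 ^ L := by rw [f1.v _ rfl]; simp [h.vN]
    have sq1 : s1.a .SQ = s.a .SQ := by rw [f1.a _ rfl]; rfl
    simp only [Store.setv_v, reduceCtorEq, if_false, h.vN, sq1] at hk1 h1 h2
    refine (bucketSort_spec (l := a) (f := (· / 2 ^ k)) (H := 2 ^ (L - k)) ?_ ?_ (by omega) ?_ ?_
      ?_).mono ?_
    · rw [f1.v _ rfl]; simp [hlen]
    · rw [f1.v _ rfl]; simp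
    · intro i hi
      rw [zero_add, h1 i (by omega), ← hSQ i hi, zero_add]
    · intro i hi
      rw [h2 i (by omega), ← hSQ i hi, zero_add]
    · intro x hx
      rw [ha.mem_iff, List.mem_range] at hx
      rwa [Nat.div_lt_iff_lt_mul (by positivity), ← pow_add, Nat.sub_add_cancel hk]
    · rintro k2 s2 - ⟨hk2, h3⟩
      refine ⟨?_, h3⟩
      simp
      omega

theorem packPass_spec (h : Env U L γ s) {l : List ℕ} (hl : l.length = 2 ^ L)
    (hDST : Holds (s.a .DST) 0 l) {lo : ℕ} (hlo : s.v .lo = lo) (hloL : lo ≤ L) :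
    wp U B packPass s fun c s' => c ≤ 400 * 2 ^ L ∧
      Packed (2 ^ 2 ^ γ) (2 ^ γ) (s'.a .A) (l.map (digit γ lo)) := by
  have hLb := h.bounds
  have hLk : 2 ^ (L - γ) ≤ 2 ^ L := Nat.pow_le_pow_right (by norm_num) (by omega)
  have hpos : 1 ≤ 2 ^ L := Nat.one_le_two_pow
  have hU := h.U_ge
  have hW := h.W_le
  have hN2 : 2 ^ L ≤ 2 ^ L * 2 ^ L := Nat.le_mul_self _
  have hg : 0 < 2 ^ γ := by positivity
  have hD : 2 ≤ 2 ^ 2 ^ γ := Nat.one_lt_two_pow (by positivity)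
  refine (streamInit_spec (D := 2 ^ 2 ^ γ) (g := 2 ^ γ)).seq ?_
  rintro k1 s1 f1 ⟨hk1, st1⟩
  have e1 : Env U L γ s1 := h.frame f1 (by decide)
  refine (wp_loop (fun i s => Stream (2 ^ 2 ^ γ) (2 ^ γ) s ((l.take i).map (digit γ lo))) 100
    (by decide) ?_ ?_).seq ?_
  · simpa using (⟨st1.lt, st1.oi, st1.acc, st1.accP, st1.out⟩ : Stream _ _ (s1.setv .i 0) [])
  · intro i hi s2 f2 hi2 I
    have hil : i < l.length := by rw [e1.vN] at hi; omega
    have e2 : Env U L γ s2 := e1.frame f2 (by decide)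
    have D2 : s2.a .DST i = l[i] := by
      rw [f2.a _ rfl, f1.a _ rfl, ← hDST i hil, zero_add]
    have lo2 : s2.v .lo = lo := by rw [f2.v _ rfl, f1.v _ rfl, hlo]
    simp only [wp_seq (c := .set _ _), wp_set]
    simp only [Expr.safe_div, Expr.safe_mod, Expr.safe_var, Expr.safe_get, Expr.eval_div,
      Expr.eval_mod, Expr.eval_var, Expr.eval_get, Store.setv_v, Store.setv_a, reduceCtorEq,
      if_true, if_false, true_and, false_imp_iff, and_true, hi2, D2, lo2, e2.PW lo hloL, e2.vD]
    refine (streamAppend_spec (g := 2 ^ γ) (out := (l.take i).map (digit γ lo))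
      (l := [digit γ lo l[i]]) hD hg (by simp [e2.vW]) (by omega) (by simp; omega) ?_
      (by simp [digit]) (by simp) (by simpa using Nat.one_le_two_pow) ?_).mono ?_
    · exact ⟨I.lt, I.oi, I.acc, I.accP, I.out⟩
    · simpa using digit_lt _ _ _
    · rintro k3 s3 f3 ⟨hk3, st3⟩
      refine ⟨by simp; omega, ?_⟩
      rw [← List.take_concat_get' l i hil, List.map_append, List.map_singleton]
      exact ⟨st3.lt, st3.oi, st3.acc, st3.accP, st3.out⟩
  rintro k2 s2 f2 ⟨hk2, st2⟩
  rw [e1.vN] at hk2 st2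
  rw [List.take_of_length_le hl.le] at st2
  have e2 : Env U L γ s2 := e1.frame f2 (by decide)
  refine (wp_loop (fun i s => ∀ j < i, s.a .A j = s2.a .OUT j) 20 (by decide) (by simp) ?_).mono ?_
  · intro i _ s3 f3 hi hI
    simp only [wp_put, Expr.eval_var, Expr.eval_get, hi]
    refine ⟨by simp, by simp, fun j hj => ?_⟩
    simp only [Store.setv_a, Store.seta_a, if_true, Function.update_apply, f3.a .OUT rfl]
    split_ifs with e
    · rw [e]
    · exact hI j (by omega)
  · rintro k3 s3 f3 ⟨hk3, h3⟩
    rw [e2.vnW] at hk3 h3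
    refine ⟨by omega, fun i hi => ?_⟩
    rw [h3 i]
    · exact st2.out i hi
    · rwa [List.length_map, hl, Nat.pow_div (by omega) (by norm_num)] at hi

/-- All groups at position `k` have length `2 ^ k`, so group `q` is block `q` of the concatenation.
-/
theorem getElem_sortedFrom {a : List ℕ} (ha : a.Perm (List.range (2 ^ L))) {k q j : ℕ} (hk : k ≤ L)
    (hq : q < 2 ^ (L - k)) (hj : j < (grp a k q).length) (h : q * 2 ^ k + j < (sortedFrom L a k).length) :
    (sortedFrom L a k)[q * 2 ^ k + j] = (grp a k q)[j] := by
  have hlen : ∀ q < 2 ^ (L - k), (grp a k q).length = 1 * 2 ^ k := fun q hq => by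
    rw [length_grp ha hk hq, one_mul]
  have h1 : chunk (2 ^ k) (q * 1 + 0) (sortedFrom L a k) = chunk (2 ^ k) 0 (grp a k q) :=
    chunk_flatMap hlen hq one_pos
  have h2 : chunk (2 ^ k) 0 (grp a k q) = grp a k q := by
    rw [chunk, zero_mul, List.drop_zero, List.take_of_length_le]
    rw [hlen q hq, one_mul]
  rw [h2, chunk, mul_one, add_zero] at h1
  simp only [← h1, List.getElem_take, List.getElem_drop]

/-- There are `2 ^ (L - γ)` groups of `2 ^ γ` entries each, and quadratic time per group gives `2 ^
L * 2 ^ γ` in total. Each entry is compared with its predecessors, as in `inv_concat`. -/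
theorem brutePass_spec (h : Env U L γ s) {a : List ℕ} (ha : a.Perm (List.range (2 ^ L)))
    (hDST : Holds (s.a .DST) 0 (sortedFrom L a γ)) {T : ℕ} (htot : s.v .tot = T)
    (hT : T + groupInv L a γ < U) :
    wp U B brutePass s fun c s' => c ≤ 60 * (2 ^ L * 2 ^ γ) ∧ s'.v .tot = T + groupInv L a γ := by
  have hLb := h.bounds
  have hpos : 1 ≤ 2 ^ L := Nat.one_le_two_pow
  have hU := h.U_ge
  have hN2 : 2 ^ L ≤ 2 ^ L * 2 ^ L := Nat.le_mul_self _
  have hmul : 2 ^ (L - γ) * 2 ^ γ = 2 ^ L := by rw [← pow_add]; congr 1; omega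
  refine (wp_loop (fun q s => s.v .tot = T + ∑ q ∈ Finset.range q, inv (grp a γ q))
    (2 + 2 ^ γ * (2 + 2 ^ γ * 43 + 3)) (by decide) (by simp [htot]) ?_).mono ?_
  · intro q hq s1 f1 hq1 I1
    rw [h.vnW] at hq
    have e1 : Env U L γ s1 := h.frame f1 (by decide)
    set G := grp a γ q with hGdef
    have hG : G.length = 2 ^ γ := length_grp ha (show γ ≤ L by omega) hq
    have hval : ∀ j (hj : j < 2 ^ γ), s.a .DST (q * 2 ^ γ + j) =
        G[j]'(by omega) ∧ q * 2 ^ γ + j < 2 ^ L := by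
      intro j hj
      have h1 : (q + 1) * 2 ^ γ ≤ 2 ^ (L - γ) * 2 ^ γ := Nat.mul_le_mul_right _ hq
      rw [add_mul, one_mul, hmul] at h1
      have h2 : q * 2 ^ γ + j < (sortedFrom L a γ).length := by
        rw [length_sortedFrom ha (by omega)]; omega
      refine ⟨?_, by omega⟩
      rw [← getElem_sortedFrom ha (by omega) hq (by change j < G.length; omega) h2, ← hDST _ h2, zero_add]
    have hsum : ∑ q ∈ Finset.range (q + 1), inv (grp a γ q) ≤ groupInv L a γ :=
      Finset.sum_le_sum_of_subset (Finset.range_mono hq)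
    rw [Finset.sum_range_succ, ← hGdef] at hsum
    -- Inversions of a prefix never exceed those of the group; needed to exclude overflow.
    have hmono : ∀ j (hj : j < G.length), inv (G.take j) + (G.take j).countP (G[j] < ·) ≤ inv G := by
      intro j hj
      have : ∀ l l' : List ℕ, inv l ≤ inv (l ++ l') := by
        intro l l'
        induction l with
        | nil => exact Nat.zero_le _
        | cons x l ih =>
          simp only [List.cons_append, inv, List.countP_append]
          omega
      rw [← inv_concat, List.take_concat_get']
      conv_rhs => rw [← List.take_append_drop (j + 1) G]
      exact this _ _
    refine (wp_loop (fun j s => s.v .tot = T + ∑ q ∈ Finset.range q, inv (grp a γ q) +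
      inv (G.take j)) (2 + 2 ^ γ * 43) (by decide) (by simp [I1, inv]) ?_).mono ?_
    · intro j hj s2 f2 hj2 I2
      rw [e1.vg] at hj
      have hjG : j < G.length := by omega
      have hm := hmono j hjG
      refine (wp_loop (fun k s => s.v .tot = T + ∑ q ∈ Finset.range q, inv (grp a γ q) +
        inv (G.take j) + (G.take k).countP (G[j] < ·)) 40 (by decide) (by simp [I2]) ?_).mono ?_
      · intro k hk s3 f3 hk3 I3
        rw [hj2] at hk
        have hkG : k < G.length := by omega
        have e3 : Env U L γ s3 := (e1.frame f2 (by decide)).frame f3 (by decide)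
        have q3 : s3.v .q = q := by rw [f3.v _ rfl, f2.v _ rfl, hq1]
        have j3 : s3.v .bj = j := by rw [f3.v _ rfl, hj2]
        have D3 : s3.a .DST = s.a .DST := by rw [f3.a _ rfl, f2.a _ rfl, f1.a _ rfl]
        have hle : (G.take (k + 1)).countP (G[j] < ·) ≤ (G.take j).countP (G[j] < ·) :=
          (List.take_sublist_take_left hk).countP_le
        rw [countP_take_succ _ hkG] at hle
        obtain ⟨v1, b1⟩ := hval j (by omega)
        obtain ⟨v2, b2⟩ := hval k (by omega)
        simp only [wp_ite, wp_set, wp_skip]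
        simp only [Expr.safe_add, Expr.safe_mul, Expr.safe_var, Expr.safe_get, Expr.eval_add,
          Expr.eval_mul, Expr.eval_var, Expr.eval_get, Store.setv_v, Store.setv_a, reduceCtorEq,
          if_true, if_false, true_and, false_imp_iff, and_true, hk3, q3, j3, D3, e3.vg, v1, v2, I3,
          Expr.safe_ofNat, Expr.eval_ofNat]
        refine ⟨⟨by omega, by omega⟩, ⟨by omega, by omega⟩, fun hlt => ?_, fun hlt => ?_⟩
        · rw [countP_take_succ _ hkG]
          simp only [hlt, decide_true, if_true] at hle ⊢
          exact ⟨by omega, by simp, by omega⟩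
        · rw [countP_take_succ _ hkG]
          simp only [hlt, decide_false, Bool.false_eq_true, if_false] at hle ⊢
          exact ⟨by simp, by omega⟩
      · rintro k s3 - ⟨hk, h3⟩
        rw [hj2] at hk h3
        refine ⟨hk.trans ?_, ?_⟩
        · have : j * (40 + 3) ≤ 2 ^ γ * 43 := Nat.mul_le_mul hj.le (by norm_num)
          omega
        · simp only [Store.setv_v, reduceCtorEq, if_false, h3]
          rw [add_assoc, ← inv_concat, List.take_concat_get']
    · rintro k s2 - ⟨hk, h2⟩
      rw [e1.vg] at hk h2
      refine ⟨hk, ?_⟩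
      rw [List.take_of_length_le hG.le] at h2
      simp [h2, Finset.sum_range_succ, add_assoc, hGdef]
  · rintro k s1 - ⟨hk, h1⟩
    rw [h.vnW] at hk h1
    refine ⟨hk.trans ?_, h1⟩
    have h3 : 1 ≤ 2 ^ γ := Nat.one_le_two_pow
    have h4 : 2 ^ (L - γ) ≤ 2 ^ L := Nat.pow_le_pow_right (by norm_num) (by omega)
    have h5 : 2 ^ L ≤ 2 ^ L * 2 ^ γ := Nat.le_mul_of_pos_right _ h3
    calc 2 + 2 ^ (L - γ) * (2 + 2 ^ γ * (2 + 2 ^ γ * 43 + 3) + 3)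
        = 2 + 5 * 2 ^ (L - γ) + 5 * (2 ^ (L - γ) * 2 ^ γ) +
            43 * (2 ^ (L - γ) * 2 ^ γ * 2 ^ γ) := by ring
      _ ≤ _ := by rw [hmul]; omega

end SingleCrossing

/-! ### Rounds of levels and the inversion count. -/

namespace SingleCrossing

/-- Number of rounds that process the bits from `γ` to `L`, with `2 ^ γ` bits each. -/
def rounds (L γ : ℕ) : ℕ := (L - γ + 2 ^ γ - 1) / 2 ^ γ

/-- The bit below which round `r` starts. -/
def topAt (L γ r : ℕ) : ℕ := if r = 0 then L else γ + 2 ^ γ * (rounds L γ - r)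

theorem rounds_bounds {L γ : ℕ} (h : γ ≤ L) :
    L ≤ γ + 2 ^ γ * rounds L γ ∧ γ + 2 ^ γ * rounds L γ < L + 2 ^ γ := by
  have hg : 0 < 2 ^ γ := by positivity
  have h1 := Nat.div_add_mod (L - γ + 2 ^ γ - 1) (2 ^ γ)
  have h2 := Nat.mod_lt (L - γ + 2 ^ γ - 1) hg
  rw [← rounds] at h1
  omega

/-- Rounds are aligned from below at bit `γ`, so only round 0, which starts at `L`, may have fewer
than `2 ^ γ` bits. -/
theorem topAt_bounds {L γ r : ℕ} (h : γ ≤ L) (hr : r < rounds L γ) :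
    topAt L γ (r + 1) = γ + 2 ^ γ * (rounds L γ - 1 - r) ∧ topAt L γ r ≤ L ∧
      topAt L γ (r + 1) < topAt L γ r ∧ topAt L γ r ≤ topAt L γ (r + 1) + 2 ^ γ ∧
      (r ≠ 0 → topAt L γ r = topAt L γ (r + 1) + 2 ^ γ) := by
  obtain ⟨h1, h2⟩ := rounds_bounds h
  have hg : 0 < 2 ^ γ := by positivity
  have e1 : topAt L γ (r + 1) = γ + 2 ^ γ * (rounds L γ - 1 - r) := by
    rw [topAt, if_neg (by omega)]; congr 2; omega
  refine ⟨e1, ?_⟩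
  rw [e1]
  by_cases hr0 : r = 0
  · subst hr0
    have : 2 ^ γ * rounds L γ = 2 ^ γ * (rounds L γ - 1 - 0) + 2 ^ γ := by
      rw [← Nat.mul_succ]; congr 1; omega
    simp only [topAt, if_true]
    omega
  · have e2 : 2 ^ γ * (rounds L γ - r) = 2 ^ γ * (rounds L γ - 1 - r) + 2 ^ γ := by
      rw [← Nat.mul_succ]; congr 1; omega
    have e3 : 2 ^ γ * (rounds L γ - r) + 2 ^ γ ≤ 2 ^ γ * rounds L γ := by
      rw [← Nat.mul_succ]; exact Nat.mul_le_mul_left _ (by omega)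
    rw [topAt, if_neg hr0]
    omega

theorem topAt_rounds {L γ : ℕ} (h : γ ≤ L) : topAt L γ (rounds L γ) = γ := by
  obtain ⟨h1, h2⟩ := rounds_bounds h
  by_cases hr : rounds L γ = 0
  · rw [hr, mul_zero] at h1
    simp [topAt, hr]; omega
  · simp [topAt, hr]

variable {U B L γ : ℕ} {s : Store}

/-- The total plus the inversions still inside groups is always `inv a`; each level moves the
crossings of one bit from the second term to the first. Every round sorts the original list anew,
since the preceding round rearranged packed digits only. -/
theorem roundPass_spec (h : Env U L γ s) {a : List ℕ} (ha : a.Perm (List.range (2 ^ L)))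
    (hSQ : Holds (s.a .SQ) 0 a) {r : ℕ} (hr : s.v .r = r) (hrR : r < rounds L γ)
    (hU : inv a < U) (htot : s.v .tot + groupInv L a (topAt L γ r) = inv a) :
    wp U B roundPass s fun c s' => c ≤ 2000 * 2 ^ L ∧
      s'.v .tot + groupInv L a (topAt L γ (r + 1)) = inv a := by
  have hLb := h.bounds
  have hUge := h.U_ge
  have hpos : 1 ≤ 2 ^ L := Nat.one_le_two_pow
  have hN2 : 2 ^ L ≤ 2 ^ L * 2 ^ L := Nat.le_mul_self _
  have hg : 0 < 2 ^ γ := by positivity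
  obtain ⟨hlo, htopL, hlt, hle, heq⟩ := topAt_bounds hLb.1 hrR
  set lo := topAt L γ (r + 1) with hlo_def
  set top := topAt L γ r with htop_def
  have vR : s.v .R = rounds L γ := h.vR
  simp only [roundPass, wp_seq (c := .set _ _), wp_set]
  simp only [Expr.safe_add, Expr.safe_mul, Expr.safe_sub, Expr.safe_ofNat, Expr.safe_var,
    Expr.eval_add, Expr.eval_mul, Expr.eval_sub, Expr.eval_var, Expr.eval_ofNat, true_and, vR,
    h.vgam, h.vg, hr, ← hlo]
  refine ⟨⟨⟨⟨by omega, by omega⟩, by omega⟩, by omega⟩, ?_⟩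
  have e0 : Env U L γ (s.setv .lo lo) := h.setv _ _ (by decide)
  have hite : wp U B (.ite (.var .r) 1 (.set .top (.var .L))
      (.set .top ((.var .lo : Expr) + .var .g))) (s.setv .lo lo)
      fun c s' => c ≤ 20 ∧ s'.v .top = top := by
    simp only [wp_ite, wp_set]
    simp only [Expr.safe_add, Expr.safe_ofNat, Expr.safe_var, Expr.eval_add, Expr.eval_var,
      Expr.eval_ofNat, true_and, Store.setv_v, reduceCtorEq, if_true, if_false, hr, h.vL, h.vg,
      Expr.cost_var, Expr.cost_add, Expr.cost_ofNat]
    refine ⟨fun h0 => ⟨by omega, ?_⟩, fun h0 => ⟨by omega, by omega, ?_⟩⟩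
    · have : r = 0 := by omega
      rw [htop_def, this]; rfl
    · exact (heq (by omega)).symm
  refine hite.seq ?_
  rintro k1 s1 f1 ⟨hk1, top1⟩
  have e1 : Env U L γ s1 := e0.frame f1 (by decide)
  have SQ1 : s1.a .SQ = s.a .SQ := by rw [f1.a _ rfl]; rfl
  refine (sortTop_spec e1 ha (by rwa [SQ1]) top1 htopL).seq ?_
  rintro k2 s2 f2 ⟨hk2, DST2⟩
  have e2 : Env U L γ s2 := e1.frame f2 (by decide)
  have lo2 : s2.v .lo = lo := by rw [f2.v _ rfl, f1.v _ rfl]; simp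
  refine (packPass_spec e2 (length_sortedFrom ha htopL) DST2 lo2 (by omega)).seq ?_
  rintro k3 s3 f3 ⟨hk3, A3⟩
  have e3 : Env U L γ s3 := e2.frame f3 (by decide)
  have top3 : s3.v .top = top := by rw [f3.v _ rfl, f2.v _ rfl, top1]
  have lo3 : s3.v .lo = lo := by rw [f3.v _ rfl, lo2]
  have tot3 : s3.v .tot = s.v .tot := by rw [f3.v _ rfl, f2.v _ rfl, f1.v _ rfl]; simp
  rw [wp_seq, wp_set]
  refine ⟨by simp [top3, lo3]; omega, ?_⟩
  refine (wp_loop (fun j s => Packed (2 ^ 2 ^ γ) (2 ^ γ) (s.a .A)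
      ((sortedFrom L a (top - j)).map (digit γ lo)) ∧
      s.v .tot + groupInv L a (top - j) = inv a) (600 * 2 ^ (L - γ) + 20) (by decide) ?_ ?_).mono ?_
  · exact ⟨A3, by simpa [tot3] using htot⟩
  · rintro j hj s4 f4 hj4 ⟨I1, I2⟩
    replace hj : j < top - lo := by simpa [top3, lo3] using hj
    have e4 : Env U L γ s4 := (e3.setv .nS _ (by decide)).frame f4 (by decide)
    have top4 : s4.v .top = top := by rw [f4.v _ rfl]; simp [top3]
    have lo4 : s4.v .lo = lo := by rw [f4.v _ rfl]; simp [lo3]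
    obtain ⟨β, hβ⟩ : ∃ β, top - 1 - j = lo + β := ⟨top - 1 - j - lo, by omega⟩
    have hβ1 : top - j = lo + β + 1 := by omega
    have hβ2 : top - (j + 1) = lo + β := by omega
    rw [hβ1] at I1 I2
    rw [groupInv_succ a (by omega)] at I2
    simp only [wp_seq (c := .set _ _), wp_set]
    simp only [Expr.safe_sub, Expr.safe_ofNat, Expr.safe_var, Expr.eval_sub, Expr.eval_var,
      Expr.eval_ofNat, true_and, Store.setv_v, reduceCtorEq, if_true, if_false, top4, hj4, lo4, hβ,
      Nat.add_sub_cancel_left]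
    refine ⟨⟨by omega, by omega⟩, by omega, ?_⟩
    refine (levelPass_spec (((e4.setv .bit _ (by decide))).setv .beta _ (by decide)) ha
      (lo := lo) (β := β) (T := s4.v .tot) (by omega) (by omega) (by omega) (by simp) (by simp)
      (by simpa using I1) (by simp) (by omega)).mono ?_
    rintro k5 s5 - ⟨hk5, A5, tot5⟩
    refine ⟨by simp; omega, ?_, ?_⟩
    · rw [hβ2]; exact A5
    · rw [hβ2]
      omega
  · rintro k4 s4 - ⟨hk4, -, h4⟩
    have hns : (s3.setv .nS (((.var .top : Expr) - .var .lo).eval s3)).v .nS = top - lo := by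
      simp [top3, lo3]
    rw [hns] at hk4 h4
    rw [show top - (top - lo) = lo by omega] at h4
    refine ⟨?_, h4⟩
    have hmul : 2 ^ γ * 2 ^ (L - γ) = 2 ^ L := by rw [← pow_add]; congr 1; omega
    -- At most `2 ^ γ` levels over `2 ^ (L - γ)` words each: linear in `2 ^ L` for the whole round.
    have h5 : (top - lo) * (600 * 2 ^ (L - γ) + 20 + 3) ≤ 2 ^ γ * (600 * 2 ^ (L - γ) + 23) :=
      Nat.mul_le_mul (by omega) le_rfl
    rw [Nat.mul_add (2 ^ γ), Nat.mul_left_comm (2 ^ γ), hmul] at h5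
    simp
    omega

theorem invCount_spec (h : Env U L γ s) {a : List ℕ} (ha : a.Perm (List.range (2 ^ L)))
    (hSQ : Holds (s.a .SQ) 0 a) :
    wp U B invCount s fun c s' => c ≤ 2100 * (2 ^ L * (rounds L γ + 2 ^ γ)) ∧
      s'.v .tot = inv a := by
  have hlen : a.length = 2 ^ L := by rw [ha.length_eq, List.length_range]
  have hLb := h.bounds
  have hUge := h.U_ge
  have hpos : 1 ≤ 2 ^ L := Nat.one_le_two_pow
  have hN2 : 2 ^ L ≤ 2 ^ L * 2 ^ L := Nat.le_mul_self _
  have hU : inv a < U := by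
    have := inv_le a
    rw [hlen] at this
    omega
  rw [invCount, wp_seq, wp_set]
  refine ⟨trivial, ?_⟩
  have e0 : Env U L γ (s.setv .tot 0) := h.setv _ _ (by decide)
  refine (wp_loop (fun r s => s.v .tot + groupInv L a (topAt L γ r) = inv a) (2000 * 2 ^ L)
    (by decide) ?_ ?_).seq ?_
  · have : topAt L γ 0 = L := rfl
    simp only [this, Store.setv_v, reduceCtorEq, if_false, if_true, Expr.eval_ofNat, zero_add]
    refine groupInv_self fun v hv => ?_
    rwa [ha.mem_iff, List.mem_range] at hv
  · intro r hr s1 f1 hr1 I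
    have e1 : Env U L γ s1 := e0.frame f1 (by decide)
    replace hr : r < rounds L γ := by
      have := e0.vR
      rw [Expr.eval_ofNat, this] at hr
      exact hr
    refine (roundPass_spec e1 ha (by rw [f1.a _ rfl]; exact hSQ) hr1 hr hU I).mono ?_
    rintro k s2 - ⟨hk, h2⟩
    exact ⟨hk, by simpa using h2⟩
  · rintro k1 s1 f1 ⟨hk1, h1⟩
    have vR : (s.setv .tot (Expr.eval 0 s)).v .R = rounds L γ := e0.vR
    rw [vR] at hk1 h1
    rw [topAt_rounds hLb.1] at h1
    have e1 : Env U L γ s1 := e0.frame f1 (by decide)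
    rw [wp_seq, wp_set]
    refine ⟨trivial, ?_⟩
    have e1' : Env U L γ (s1.setv .top γ) := e1.setv _ _ (by decide)
    simp only [Expr.eval_var, e1.vgam]
    refine (sortTop_spec e1' ha (by simp only [Store.setv_a, f1.a .SQ rfl]; exact hSQ)
      (k := γ) (by simp) hLb.1).seq ?_
    rintro k2 s2 f2 ⟨hk2, D2⟩
    have tot2 : s2.v .tot = s1.v .tot := by rw [f2.v _ rfl]; simp
    refine (brutePass_spec (e1'.frame f2 (by decide)) ha D2 tot2 (by omega)).mono ?_
    rintro k3 s3 - ⟨hk3, h3⟩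
    refine ⟨?_, by omega⟩
    have h4 : 1 ≤ 2 ^ γ := Nat.one_le_two_pow
    have h5 : 2 ^ L ≤ 2 ^ L * 2 ^ γ := Nat.le_mul_of_pos_right _ h4
    have h6 : rounds L γ ≤ 2 ^ L * rounds L γ := Nat.le_mul_of_pos_left _ hpos
    rw [Nat.mul_add, Nat.mul_left_comm] at hk1
    rw [Nat.mul_add (2 ^ L)]
    rw [mul_comm (rounds L γ) (2 ^ L)] at hk1
    simp
    omega

end SingleCrossing

namespace SingleCrossing

/-! ### Kendall tau distance as a number of inversions -/

theorem inv_map_range (F : ℕ → ℕ) (n : ℕ) :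
    inv ((List.range n).map F) =
      ∑ j ∈ Finset.range n, ((Finset.range j).filter (F j < F ·)).card := by
  induction n with
  | zero => rfl
  | succ n ih =>
    rw [List.range_succ, List.map_append, List.map_singleton, inv_concat, ih,
      Finset.sum_range_succ, List.countP_map, List.countP_eq_length_filter]
    rfl

/-- Positions with respect to `r` of the entries of `s`, continued by the identity. -/
def relPos {n : ℕ} (r s : Ranking n) (i : ℕ) : ℕ :=
  if h : i < n then (r.symm (s ⟨i, h⟩) : ℕ) else i

theorem relPos_lt {n : ℕ} (r s : Ranking n) {i N : ℕ} (hi : i < N) (hn : n ≤ N) :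
    relPos r s i < N := by
  unfold relPos
  split_ifs
  · exact (Fin.is_lt _).trans_le hn
  · exact hi

theorem relPos_injective {n : ℕ} (r s : Ranking n) : Function.Injective (relPos r s) := by
  intro i j h
  unfold relPos at h
  split_ifs at h with h1 h2 h2
  · simpa [Fin.val_inj] using h
  · exact absurd (h ▸ Fin.is_lt _) h2
  · exact absurd (h ▸ Fin.is_lt _) h1
  · exact h

theorem map_relPos_perm {n N : ℕ} (r s : Ranking n) (hn : n ≤ N) :
    ((List.range N).map (relPos r s)).Perm (List.range N) := by
  refine List.Subperm.perm_of_length_le ?_ (by simp)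
  refine List.Nodup.subperm (List.nodup_range.map (relPos_injective r s)) ?_
  intro x hx
  obtain ⟨i, hi, rfl⟩ := List.mem_map.1 hx
  exact List.mem_range.2 (relPos_lt r s (List.mem_range.1 hi) hn)

/-- Read along `s`, the positions in `r` are inverted exactly at the pairs ranked differently. The
padding is fixed and exceeds everything before it, so it adds no inversion. -/
theorem inv_map_relPos {n N : ℕ} (r s : Ranking n) (hn : n ≤ N) :
    inv ((List.range N).map (relPos r s)) = kendallTau r s := by
  have h1 : inv ((List.range N).map (relPos r s)) = inv ((List.range n).map (relPos r s)) := by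
    rw [inv_map_range, inv_map_range]
    refine (Finset.sum_subset (Finset.range_mono hn) fun j _ hj => ?_).symm
    rw [Finset.card_eq_zero, Finset.filter_eq_empty_iff]
    intro i hi
    rw [Finset.mem_range, not_lt] at hj
    rw [Finset.mem_range] at hi
    have : relPos r s j = j := dif_neg (by omega)
    rw [this, not_lt]
    exact (relPos_lt r s hi hj).le
  rw [h1, inv_map_range, ← Finset.card_sigma, kendallTau]
  symm
  -- A pair that `r` ranks as `p.1` over `p.2` and `s` the other way has the later index `s.symm
  -- p.1` and the earlier index `s.symm p.2`.
  refine Finset.card_bij' (fun p _ => ⟨(s.symm p.1 : ℕ), (s.symm p.2 : ℕ)⟩)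
    (fun p hp => (s ⟨p.1, ?_⟩, s ⟨p.2, ?_⟩)) ?_ ?_ ?_ ?_
  · exact Finset.mem_range.1 (Finset.mem_sigma.1 hp).1
  · have h2 := Finset.mem_sigma.1 hp
    have h3 := Finset.mem_range.1 h2.1
    have h4 := Finset.mem_range.1 (Finset.mem_filter.1 h2.2).1
    exact h4.trans h3
  · rintro ⟨a, b⟩ hp
    simp only [Finset.mem_filter, Finset.mem_univ, true_and, Prefers] at hp
    simp only [Finset.mem_sigma, Finset.mem_range, Finset.mem_filter, Fin.is_lt, true_and, relPos,
      dif_pos, Fin.eta, Equiv.apply_symm_apply, Fin.val_fin_lt]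
    exact ⟨hp.2, hp.1⟩
  · rintro ⟨j, i⟩ hp
    simp only [Finset.mem_sigma, Finset.mem_range, Finset.mem_filter] at hp
    have hi : i < n := by omega
    simp only [relPos, dif_pos hp.1, dif_pos hi, Fin.val_fin_lt] at hp
    simp only [Finset.mem_filter, Finset.mem_univ, true_and, Prefers, Equiv.symm_apply_apply,
      Fin.mk_lt_mk]
    exact ⟨hp.2.2, hp.2.1⟩
  · rintro ⟨a, b⟩ _
    simp
  · rintro ⟨j, i⟩ _
    simp

theorem kendallTau_le {n : ℕ} (r s : Ranking n) : kendallTau r s ≤ n * n := by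
  rw [← inv_map_relPos r s le_rfl]
  simpa using inv_le ((List.range n).map (relPos r s))

section

open Var Arr

/-- The Kendall tau distance between the orders with indices `X` and `Y`. -/
def distance : Cmd :=
  .loop i n (.put POS (.get io (X * n + i)) i) ;;
  .loop i N (.ite i n (.put SQ i (.get POS (.get io (Y * n + i)))) (.put SQ i i)) ;;
  invCount

end

/-- The store holds the profile and its dimensions. -/
structure Input {n t : ℕ} (P : Profile n t) (U B : ℕ) (s : Store) : Prop where
  vn : s.v .n = n
  vt : s.v .t = t
  io : ∀ (j : Fin t) (i : Fin n), s.a .io (j * n + i) = P j i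
  le : n * t ≤ B
  lt : B < U

theorem Input.frame {n t U B : ℕ} {P : Profile n t} {c : Cmd} {s s' : Store}
    (h : Input P U B s) (f : Frame c s s')
    (hc : (!c.writes .n && !c.writes .t && !c.writesA .io) = true) : Input P U B s' := by
  simp only [Bool.and_eq_true, Bool.not_eq_true'] at hc
  exact ⟨by rw [f.v _ hc.1.1, h.vn], by rw [f.v _ hc.1.2, h.vt], by rw [f.a _ hc.2]; exact h.io,
    h.le, h.lt⟩

theorem Input.idx_lt {n t U B : ℕ} {P : Profile n t} {s : Store} (h : Input P U B s) (j : Fin t)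
    (i : Fin n) : j * n + i < B := by
  refine lt_of_lt_of_le ?_ h.le
  calc j * n + i < j * n + n := by have := i.is_lt; omega
    _ = (j + 1) * n := by ring
    _ ≤ t * n := Nat.mul_le_mul_right _ j.is_lt
    _ = n * t := mul_comm _ _

theorem distance_spec {n t U B L γ : ℕ} {P : Profile n t} {s : Store} (h : Env U L γ s)
    (hP : Input P U B s) (hn : n ≤ 2 ^ L) (x y : Fin t) (hX : s.v .X = x) (hY : s.v .Y = y) :
    wp U B distance s fun c s' => c ≤ 2300 * (2 ^ L * (rounds L γ + 2 ^ γ)) ∧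
      s'.v .tot = kendallTau (P x) (P y) := by
  have hpos : 1 ≤ 2 ^ L := Nat.one_le_two_pow
  have hN2 : 2 ^ L ≤ 2 ^ L * 2 ^ L := Nat.le_mul_self _
  have hidx : ∀ (j : Fin t) (i : ℕ), i < n → j * n + i < B := fun j i hi => hP.idx_lt j ⟨i, hi⟩
  have hBU := hP.lt
  refine (wp_loop (fun k s => ∀ (i : ℕ) (hi : i < n), i < k → s.a .POS (P x ⟨i, hi⟩) = i) 50
    (by decide) (fun i hi h0 => absurd h0 (by simp)) ?_).seq ?_
  · intro k hk s1 f1 hk1 I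
    rw [hP.vn] at hk
    have p1 : Input P U B s1 := hP.frame f1 (by decide)
    have X1 : s1.v .X = x := by rw [f1.v _ rfl, hX]
    have h1 := hidx x k hk
    have hio : s1.a .io (x * n + k) = P x ⟨k, hk⟩ := p1.io x ⟨k, hk⟩
    simp only [wp_put]
    simp only [Expr.safe_add, Expr.safe_mul, Expr.safe_var, Expr.safe_get, Expr.eval_add,
      Expr.eval_mul, Expr.eval_var, Expr.eval_get, reduceCtorEq, true_and, false_imp_iff, and_true,
      X1, p1.vn, hk1, hio, true_imp_iff]
    refine ⟨⟨⟨by omega, by omega⟩, by omega⟩, by simp, fun i hi hik => ?_⟩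
    simp only [Store.setv_a, Store.seta_a, if_true, Function.update_apply, Fin.val_inj,
      (P x).injective.eq_iff, Fin.mk.injEq]
    split_ifs with e
    · exact e.symm
    · exact I i hi (by omega)
  rintro k1 s1 f1 ⟨hk1, h1⟩
  rw [hP.vn] at hk1 h1
  have p1 : Input P U B s1 := hP.frame f1 (by decide)
  have e1 : Env U L γ s1 := h.frame f1 (by decide)
  have hPOS : ∀ b : Fin n, s1.a .POS b = (P x).symm b := by
    intro b
    have := h1 ((P x).symm b) (Fin.is_lt _) (Fin.is_lt _)
    simpa using this
  refine (wp_loop (fun k s => ∀ i < k, s.a .SQ i = relPos (P x) (P y) i) 50 (by decide)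
    (by simp) ?_).seq ?_
  · intro k hk s2 f2 hk2 I
    have p2 : Input P U B s2 := p1.frame f2 (by decide)
    have Y2 : s2.v .Y = y := by rw [f2.v _ rfl, f1.v _ rfl, hY]
    have POS2 : s2.a .POS = s1.a .POS := f2.a _ rfl
    simp only [wp_ite, wp_put]
    simp only [Expr.safe_add, Expr.safe_mul, Expr.safe_var, Expr.safe_get, Expr.eval_add,
      Expr.eval_mul, Expr.eval_var, Expr.eval_get, reduceCtorEq, true_and, false_imp_iff, and_true,
      Y2, p2.vn, hk2, true_imp_iff, Store.setv_a, Store.seta_a, if_true, Function.update_apply, POS2]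
    refine ⟨fun hkn => ?_, fun hkn => ⟨by simp, fun i hi => ?_⟩⟩
    · have h3 := hidx y k hkn
      have hio : s2.a .io (y * n + k) = P y ⟨k, hkn⟩ := p2.io y ⟨k, hkn⟩
      refine ⟨⟨⟨by omega, by omega⟩, by omega⟩, by simp, fun i hi => ?_⟩
      split_ifs with e
      · rw [hio, hPOS, e, relPos, dif_pos hkn]
      · exact I i (by omega)
    · split_ifs with e
      · rw [e, relPos, dif_neg hkn]
      · exact I i (by omega)
  rintro k2 s2 f2 ⟨hk2, h2⟩
  rw [e1.vN] at hk2 h2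
  refine (invCount_spec (e1.frame f2 (by decide)) (map_relPos_perm (P x) (P y) hn) ?_).mono ?_
  · intro i hi
    rw [zero_add, h2 i (by simpa using hi)]
    simp
  · rintro k3 s3 - ⟨hk3, h3⟩
    refine ⟨?_, by rw [h3, inv_map_relPos _ _ hn]⟩
    have h4 : 1 ≤ 2 ^ γ := Nat.one_le_two_pow
    have h5 : 2 ^ L ≤ 2 ^ L * (rounds L γ + 2 ^ γ) := Nat.le_mul_of_pos_right _ (by omega)
    omega

end SingleCrossing

namespace SingleCrossing

/-! ### Parameters -/

section

open Var Arr

/-- The least power `N = 2 ^ L` that is at least `n`. -/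
def setupN : Cmd :=
  .set N 1 ;; .set L 0 ;; .loop i n (.ite N n (.set N (N * 2) ;; .set L (L + 1)) .skip)

/-- A power `g = 2 ^ gam` of the order of `√L`. -/
def setupG : Cmd :=
  .set gam 0 ;; .set g 1 ;;
  .loop i L (.ite L (16 * (g * g)) .skip (.set g (g * 2) ;; .set gam (gam + 1)))

/-- Powers of two. -/
def setupPW : Cmd :=
  .set t1 (L + 1) ;; .set c 1 ;; .loop i t1 (.put PW i c ;; .set c (c * 2))

/-- Sets up parameters and tables. -/
def setup : Cmd :=
  setupN ;; setupG ;; setupPW ;;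
  .set D (.get PW g) ;; .set W (.get PW (g * g)) ;; .set R ((L - gam + g - 1) / g) ;;
  .set nW (N / g) ;; buildTables

end

variable {U B : ℕ} {s : Store}

theorem setupN_spec {n : ℕ} (hn : 2 ≤ n) (hvn : s.v .n = n) (hU : 4 * n < U) :
    wp U B setupN s fun c s' => c ≤ 50 * n ∧ ∃ L, s'.v .L = L ∧ s'.v .N = 2 ^ L ∧ n ≤ 2 ^ L ∧
      2 ^ L ≤ 2 * n := by
  simp only [setupN, wp_seq (c := .set _ _), wp_set, Expr.safe_ofNat, true_and]
  refine (wp_loop (fun i s => s.v .N = 2 ^ s.v .L ∧ 2 ^ s.v .L ≤ 2 * n ∧ s.v .L ≤ i ∧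
    (n ≤ s.v .N ∨ s.v .L = i)) 30 (by decide) (by simp; omega) ?_).mono ?_
  · rintro i hi s1 f1 hi1 ⟨I1, I2, I3, I4⟩
    replace hi : i < n := by simpa [hvn] using hi
    have n1 : s1.v .n = n := by rw [f1.v _ rfl]; simp [hvn]
    simp only [wp_ite, wp_seq, wp_set, wp_skip]
    simp [n1]
    refine ⟨fun hlt => ⟨by omega, by omega, by rw [I1, pow_succ], ?_, by omega, ?_⟩,
      fun hge => ⟨I1, I2, by omega, Or.inl hge⟩⟩
    · rw [pow_succ]; omega
    · omega
  · rintro k s1 - ⟨hk, h1, h2, h3, h4⟩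
    have hvn' : ((s.setv .N (Expr.eval 1 s)).setv .L (Expr.eval 0 (s.setv .N (Expr.eval 1 s)))).v .n
      = n := by simp [hvn]
    rw [hvn'] at hk h4
    refine ⟨by simp; omega, s1.v .L, rfl, h1, ?_, h2⟩
    rcases h4 with h4 | h4
    · rwa [← h1]
    -- If doubling took place in all `n` rounds, then `L = n`, and `n < 2 ^ n` still suffices.
    · rw [h4]; exact Nat.lt_two_pow_self.le

/-- Doubling `g` only while `16 * g ^ 2 ≤ L` leaves `4 * g ^ 2 ≤ L` after each doubling. This keeps
the tables small, while the exit condition bounds the number of rounds. -/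
theorem setupG_spec {L : ℕ} (hvL : s.v .L = L) (hU : 4 * L + 16 < U) :
    wp U B setupG s fun c s' => c ≤ 50 * (L + 1) ∧ ∃ γ, s'.v .gam = γ ∧ s'.v .g = 2 ^ γ ∧
      (γ = 0 ∨ 4 * (2 ^ γ * 2 ^ γ) ≤ L) ∧ L < 16 * (2 ^ γ * 2 ^ γ) := by
  simp only [setupG, wp_seq (c := .set _ _), wp_set, Expr.safe_ofNat, true_and]
  refine (wp_loop (fun i s => s.v .g = 2 ^ s.v .gam ∧
    (s.v .gam = 0 ∨ 4 * (s.v .g * s.v .g) ≤ L) ∧ s.v .gam ≤ i ∧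
    (L < 16 * (s.v .g * s.v .g) ∨ s.v .gam = i)) 40 (by decide) (by simp) ?_).mono ?_
  · rintro i hi s1 f1 hi1 ⟨I1, I2, I3, I4⟩
    replace hi : i < L := by simpa [hvL] using hi
    have L1 : s1.v .L = L := by rw [f1.v _ rfl]; simp [hvL]
    have hgg : 16 * (s1.v .g * s1.v .g) < U := by
      rcases I2 with I2 | I2
      · rw [I1, I2]; omega
      · omega
    have hle : s1.v .g ≤ s1.v .g * s1.v .g := Nat.le_mul_self _
    simp only [wp_ite, wp_seq, wp_set, wp_skip]
    simp [L1]
    refine ⟨⟨by omega, hgg⟩, fun hlt => ⟨I1, I2, by omega, Or.inl hlt⟩,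
      fun hge => ⟨by omega, by omega, by rw [I1, pow_succ], ?_, by omega, by omega⟩⟩
    calc 4 * (s1.v .g * 2 * (s1.v .g * 2)) = 16 * (s1.v .g * s1.v .g) := by ring
      _ ≤ L := hge
  · rintro k s1 - ⟨hk, h1, h2, h3, h4⟩
    have hvL' : ((s.setv .gam (Expr.eval 0 s)).setv .g
        (Expr.eval 1 (s.setv .gam (Expr.eval 0 s)))).v .L = L := by simp [hvL]
    rw [hvL'] at hk h3 h4
    refine ⟨by simp; omega, s1.v .gam, rfl, h1, by rwa [← h1], ?_⟩
    rw [← h1]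
    rcases h4 with h4 | h4
    · exact h4
    · have h5 : L < s1.v .g := by rw [h1, h4]; exact Nat.lt_two_pow_self
      have : s1.v .g ≤ s1.v .g * s1.v .g := Nat.le_mul_self _
      omega

theorem setupPW_spec {L : ℕ} (hvL : s.v .L = L) (hU : 2 * 2 ^ L < U) (hLU : L + 1 < U) :
    wp U B setupPW s fun c s' => c ≤ 50 * (L + 1) ∧ ∀ i ≤ L, s'.a .PW i = 2 ^ i := by
  simp only [setupPW, wp_seq (c := .set _ _), wp_set, Expr.safe_ofNat, Expr.safe_add, Expr.safe_var,
    true_and, Expr.eval_var, Expr.eval_ofNat, hvL]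
  refine ⟨hLU, ?_⟩
  refine (wp_loop (fun i s => s.v .c = 2 ^ i ∧ ∀ j < i, s.a .PW j = 2 ^ j) 20 (by decide) (by simp)
    ?_).mono ?_
  · rintro i hi s1 f1 hi1 ⟨I1, I2⟩
    replace hi : i < L + 1 := by simpa [hvL] using hi
    have hle : 2 ^ i ≤ 2 ^ L := Nat.pow_le_pow_right (by norm_num) (by omega)
    simp only [wp_seq, wp_put, wp_set]
    simp [hi1, I1]
    refine ⟨by omega, by rw [pow_succ], fun j hj => ?_⟩
    rw [Function.update_apply]
    split_ifs with e
    · rw [e]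
    · exact I2 j (by omega)
  · rintro k s1 - ⟨hk, -, h2⟩
    have ht1 : ((s.setv .t1 ((Expr.var .L + 1).eval s)).setv .c 1).v .t1 = L + 1 := by
      simp [hvL]
    rw [ht1] at hk h2
    exact ⟨by simp; omega, fun i hi => h2 i (by omega)⟩

theorem setup_spec {n : ℕ} (hn : 2 ≤ n) (hvn : s.v .n = n) (hU : 64 * (n * n) ≤ U) :
    wp U B setup s fun c s' => c ≤ 2000 * n ∧ ∃ L γ, Env U L γ s' ∧ n ≤ 2 ^ L ∧ 2 ^ L ≤ 2 * n ∧
      L < 16 * (2 ^ γ * 2 ^ γ) := by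
  have hnn : 2 * n ≤ n * n := Nat.mul_le_mul_right n hn
  refine (setupN_spec hn hvn (by omega)).seq ?_
  rintro k1 s1 f1 ⟨hk1, L, L1, N1, hnL, hLn⟩
  have hL1 : 1 ≤ L := by
    rcases Nat.eq_zero_or_pos L with h | h
    · rw [h] at hnL; omega
    · exact h
  have hLlt : L < 2 ^ L := Nat.lt_two_pow_self
  have hU' : 16 * (2 ^ L * 2 ^ L) ≤ U := by
    have := Nat.mul_le_mul hLn hLn
    calc 16 * (2 ^ L * 2 ^ L) ≤ 16 * (2 * n * (2 * n)) := by omega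
      _ = 64 * (n * n) := by ring
      _ ≤ U := hU
  have hNN : 2 ^ L ≤ 2 ^ L * 2 ^ L := Nat.le_mul_self _
  refine (setupG_spec L1 (by omega)).seq ?_
  rintro k2 s2 f2 ⟨hk2, γ, gam2, g2, hγ, hLγ⟩
  have L2 : s2.v .L = L := by rw [f2.v _ rfl, L1]
  refine (setupPW_spec L2 (by omega) (by omega)).seq ?_
  rintro k3 s3 f3 ⟨hk3, PW3⟩
  have L3 : s3.v .L = L := by rw [f3.v _ rfl, L2]
  have N3 : s3.v .N = 2 ^ L := by rw [f3.v _ rfl, f2.v _ rfl, N1]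
  have gam3 : s3.v .gam = γ := by rw [f3.v _ rfl, gam2]
  have g3 : s3.v .g = 2 ^ γ := by rw [f3.v _ rfl, g2]
  have hsq : 2 ^ γ * 2 ^ γ ≤ L := by
    rcases hγ with rfl | hγ
    · simpa using hL1
    · omega
  have hγlt : γ < 2 ^ γ := Nat.lt_two_pow_self
  have hle : 2 ^ γ ≤ 2 ^ γ * 2 ^ γ := Nat.le_mul_self _
  have hWW : (2 ^ 2 ^ γ) ^ 2 ^ γ * (2 ^ 2 ^ γ) ^ 2 ^ γ ≤ 2 * 2 ^ L := by
    rcases hγ with rfl | hγ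
    -- For `γ = 0` the square of `W` is 4, which needs the factor 2 in the bound when `L = 1`.
    · have : 2 ^ 1 ≤ 2 ^ L := Nat.pow_le_pow_right (by norm_num) hL1
      norm_num at this ⊢
      omega
    · rw [← pow_mul, ← pow_add]
      have : 2 ^ (2 ^ γ * 2 ^ γ + 2 ^ γ * 2 ^ γ) ≤ 2 ^ L :=
        Nat.pow_le_pow_right (by norm_num) (by omega)
      omega
  have hsqW : 2 ^ γ * 2 ^ γ < (2 ^ 2 ^ γ) ^ 2 ^ γ := by
    rw [← pow_mul]; exact Nat.lt_two_pow_self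
  have hgW : 2 ^ γ * (2 ^ 2 ^ γ) ^ 2 ^ γ ≤ (2 ^ 2 ^ γ) ^ 2 ^ γ * (2 ^ 2 ^ γ) ^ 2 ^ γ :=
    Nat.mul_le_mul_right _ (by omega)
  have hWle : (2 ^ 2 ^ γ) ^ 2 ^ γ ≤ (2 ^ 2 ^ γ) ^ 2 ^ γ * (2 ^ 2 ^ γ) ^ 2 ^ γ := Nat.le_mul_self _
  have hpow : 2 ^ (2 ^ γ * 2 ^ γ) = (2 ^ 2 ^ γ) ^ 2 ^ γ := pow_mul _ _ _
  simp only [wp_seq (c := .set _ _), wp_set]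
  simp only [Expr.safe_add, Expr.safe_sub, Expr.safe_mul, Expr.safe_div, Expr.safe_var,
    Expr.safe_get, Expr.safe_ofNat, Expr.eval_add, Expr.eval_sub, Expr.eval_mul, Expr.eval_div,
    Expr.eval_var, Expr.eval_get, Expr.eval_ofNat, Store.setv_v, Store.setv_a, reduceCtorEq,
    if_true, if_false, true_and, false_imp_iff, and_true, L3, N3, gam3, g3, PW3 _ (hle.trans hsq),
    PW3 _ hsq, hpow]
  refine ⟨by omega, ⟨⟨by omega, by omega⟩, by omega⟩, ?_⟩
  refine (buildTables_spec (D := 2 ^ 2 ^ γ) (g := 2 ^ γ) (Nat.one_lt_two_pow (by positivity))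
    (by simp [g3]) (by simp) (by simp) (fun i hi => by simp [PW3 i (by omega)]) (by omega)
    (by omega) (by omega)).mono ?_
  rintro k4 s4 f4 ⟨hk4, htab⟩
  refine ⟨?_, L, γ, ⟨hsq, hWW, hU', ?_, ?_, ?_, ?_, ?_, ?_, ?_, ?_, ?_, htab⟩, hnL, hLn, hLγ⟩
  -- With `g = 2 ^ γ`, the leading cost `g ^ 2 * W` is at most `W ^ 2`, because `g ^ 2 < 2 ^ (g ^ 2)
  -- = W`; so building the tables is linear in `2 ^ L`.
  · have h5 : 2 ^ γ * ((2 ^ 2 ^ γ) ^ 2 ^ γ * (60 * 2 ^ γ + 100) + 100) =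
        60 * (2 ^ γ * 2 ^ γ * (2 ^ 2 ^ γ) ^ 2 ^ γ) + 100 * (2 ^ γ * (2 ^ 2 ^ γ) ^ 2 ^ γ) +
          100 * 2 ^ γ := by ring
    have h6 : 2 ^ γ * 2 ^ γ * (2 ^ 2 ^ γ) ^ 2 ^ γ ≤
        (2 ^ 2 ^ γ) ^ 2 ^ γ * (2 ^ 2 ^ γ) ^ 2 ^ γ := Nat.mul_le_mul_right _ hsqW.le
    simp
    omega
  · rw [f4.v _ rfl]; simp [L3]
  · rw [f4.v _ rfl]; simp [N3]
  · rw [f4.v _ rfl]; simp [gam3]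
  · rw [f4.v _ rfl]; simp [g3]
  · rw [f4.v _ rfl]; simp
  · rw [f4.v _ rfl]; simp
  · rw [f4.v _ rfl]; simp
  · rw [f4.v _ rfl]; simp [Nat.pow_div (show γ ≤ L by omega)]
  · rw [f4.a _ rfl]; simpa using PW3

end SingleCrossing

namespace SingleCrossing

/-! ### Single-crossing lists and Kendall tau distance -/

section

variable {n t : ℕ}

/-- `s` agrees with `r` and `u` on every pair on which these agree. -/
def Between (r s u : Ranking n) : Prop :=
  ∀ a b, Prefers r a b → Prefers u a b → Prefers s a b

theorem not_prefers_iff {r : Ranking n} {a b : Fin n} (h : a ≠ b) :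
    ¬ Prefers r a b ↔ Prefers r b a := by
  have : r.symm a ≠ r.symm b := fun e => h (r.symm.injective e)
  rw [Prefers, Prefers, not_lt]
  exact ⟨fun h => lt_of_le_of_ne h this.symm, le_of_lt⟩

theorem Prefers.ne {r : Ranking n} {a b : Fin n} (h : Prefers r a b) : a ≠ b := by
  rintro rfl; exact lt_irrefl _ h

theorem kendallTau_comm (r s : Ranking n) : kendallTau r s = kendallTau s r := by
  refine Finset.card_equiv (Equiv.prodComm _ _) fun p => ?_
  simp [and_comm]

theorem kendallTau_self (r : Ranking n) : kendallTau r r = 0 := by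
  rw [kendallTau, Finset.card_eq_zero, Finset.filter_eq_empty_iff]
  rintro p - ⟨h1, h2⟩
  exact lt_asymm h1 h2

/-- Split each disagreement set by the opinion of the third order. Disagreements of `r` and `u`
occur once on the left; a pair on which `s` opposes both occurs twice, once in each orientation. -/
theorem kendallTau_add (r s u : Ranking n) :
    kendallTau r s + kendallTau s u = kendallTau r u +
      2 * (Finset.univ.filter fun p : Fin n × Fin n =>
        Prefers r p.1 p.2 ∧ Prefers s p.2 p.1 ∧ Prefers u p.1 p.2).card := by
  have split : ∀ (A : Fin n × Fin n → Prop) [DecidablePred A] (v : Ranking n),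
      (∀ p, A p → p.1 ≠ p.2) → (Finset.univ.filter A).card =
        (Finset.univ.filter fun p => A p ∧ Prefers v p.1 p.2).card +
        (Finset.univ.filter fun p => A p ∧ Prefers v p.2 p.1).card := by
    intro A _ v hA
    rw [← Finset.card_filter_add_card_filter_not (fun p : Fin n × Fin n => Prefers v p.1 p.2),
      Finset.filter_filter, Finset.filter_filter]
    congr 2
    refine Finset.filter_congr fun p _ => and_congr_right fun hp => not_prefers_iff (hA p hp)
  have h3 : (Finset.univ.filter fun p : Fin n × Fin n =>
      (Prefers s p.1 p.2 ∧ Prefers u p.2 p.1) ∧ Prefers r p.2 p.1).card =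
      (Finset.univ.filter fun p : Fin n × Fin n =>
        (Prefers r p.1 p.2 ∧ Prefers s p.2 p.1) ∧ Prefers u p.1 p.2).card := by
    refine Finset.card_equiv (Equiv.prodComm _ _) fun p => ?_
    simp; tauto
  have h4 : (Finset.univ.filter fun p : Fin n × Fin n =>
      (Prefers s p.1 p.2 ∧ Prefers u p.2 p.1) ∧ Prefers r p.1 p.2).card =
      (Finset.univ.filter fun p : Fin n × Fin n =>
        (Prefers r p.1 p.2 ∧ Prefers u p.2 p.1) ∧ Prefers s p.1 p.2).card := by
    congr 1; refine Finset.filter_congr fun p _ => ?_; tauto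
  have h5 : (Finset.univ.filter fun p : Fin n × Fin n =>
      (Prefers r p.1 p.2 ∧ Prefers s p.2 p.1) ∧ Prefers u p.2 p.1).card =
      (Finset.univ.filter fun p : Fin n × Fin n =>
        (Prefers r p.1 p.2 ∧ Prefers u p.2 p.1) ∧ Prefers s p.2 p.1).card := by
    congr 1; refine Finset.filter_congr fun p _ => ?_; tauto
  have e1 := split (fun p => Prefers r p.1 p.2 ∧ Prefers s p.2 p.1) u fun p h => h.1.ne
  have e2 := split (fun p => Prefers s p.1 p.2 ∧ Prefers u p.2 p.1) r fun p h => h.1.ne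
  have e3 := split (fun p => Prefers r p.1 p.2 ∧ Prefers u p.2 p.1) s fun p h => h.1.ne
  rw [kendallTau, kendallTau, kendallTau, e1, e2, e3, h3, h4, h5]
  simp only [and_assoc]
  ring

theorem kendallTau_triangle (r s u : Ranking n) :
    kendallTau r u ≤ kendallTau r s + kendallTau s u := by
  rw [kendallTau_add]; omega

theorem between_iff {r s u : Ranking n} :
    Between r s u ↔ kendallTau r s + kendallTau s u = kendallTau r u := by
  rw [kendallTau_add]
  have h : (Finset.univ.filter fun p : Fin n × Fin n =>
      Prefers r p.1 p.2 ∧ Prefers s p.2 p.1 ∧ Prefers u p.1 p.2).card = 0 ↔ Between r s u := by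
    rw [Finset.card_eq_zero, Finset.filter_eq_empty_iff]
    constructor
    · intro h a b h1 h2
      by_contra h3
      exact h (Finset.mem_univ (a, b)) ⟨h1, (not_prefers_iff h1.ne).1 h3, h2⟩
    · rintro h ⟨a, b⟩ - ⟨h1, h2, h3⟩
      exact lt_asymm h2 (h a b h1 h3)
  rw [← h]
  omega

/-- Without disagreement, the change of positions is a strictly increasing bijection of `Fin n`,
hence the identity. -/
theorem eq_of_kendallTau_eq_zero {r s : Ranking n} (h : kendallTau r s = 0) : r = s := by
  have hmono : StrictMono (fun i => s.symm (r i)) := by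
    intro i j hij
    rw [kendallTau, Finset.card_eq_zero, Finset.filter_eq_empty_iff] at h
    have h1 : Prefers r (r i) (r j) := by simpa [Prefers] using hij
    by_contra h2
    exact h (Finset.mem_univ (r i, r j)) ⟨h1, (not_prefers_iff h1.ne).1 h2⟩
  have hid : (fun i => s.symm (r i)) = id := by
    refine (StrictMono.range_inj hmono strictMono_id).1 ?_
    rw [Set.range_id, Set.range_eq_univ]
    exact (r.trans s.symm).surjective
  ext i
  have := congrFun hid i
  simp only [id, Equiv.symm_apply_eq] at this
  rw [this]

/-- Conversely, the opinion of the first order on a pair decides whether prefix or suffix occurs: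
once abandoned, this opinion cannot return. -/
theorem isSingleCrossingList_iff {Q : Profile n t} :
    IsSingleCrossingList Q ↔ ∀ i j k, i ≤ j → j ≤ k → Between (Q i) (Q j) (Q k) := by
  constructor
  · intro h i j k hij hjk a b h1 h2
    rcases h a b h1.ne with h | h
    · exact h hjk h2
    · exact h hij h1
  · intro h a b hab
    -- This asks for a first index `k`; it fails only for the empty list.
    by_cases h0 : ∃ k, ∀ i, k ≤ i ∧ Prefers (Q k) a b ∨ k ≤ i ∧ ¬ Prefers (Q k) a b
    · obtain ⟨k, hk⟩ := h0
      have hk' : ∀ i, k ≤ i := fun i => (hk i).elim And.left And.left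
      by_cases hp : Prefers (Q k) a b
      · exact Or.inl fun j i hij hj => h k i j (hk' i) hij a b hp hj
      · refine Or.inr fun i j hij hi => ?_
        by_contra hj
        have hj' := (not_prefers_iff hab).1 hj
        have := h k i j (hk' i) hij b a ((not_prefers_iff hab).1 hp) hj'
        exact lt_asymm this hi
    · left
      intro j
      exact absurd ⟨⟨0, j.pos⟩, fun i => by
        by_cases hp : Prefers (Q ⟨0, j.pos⟩) a b
        exacts [Or.inl ⟨Nat.zero_le _, hp⟩, Or.inr ⟨Nat.zero_le _, hp⟩]⟩ h0

/-- A list is single-crossing if its disagreements with some fixed order increase. -/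
theorem isSingleCrossingList_of_monotone {Q : Profile n t} (r : Ranking n)
    (h : ∀ i j, i ≤ j → Between r (Q i) (Q j)) : IsSingleCrossingList Q := by
  intro a b hab
  by_cases hr : Prefers r a b
  · exact Or.inl fun j i hij hj => h i j hij a b hr hj
  · refine Or.inr fun i j hij hi => ?_
    by_contra hj
    have := h i j hij b a ((not_prefers_iff hab).1 hr) ((not_prefers_iff hab).1 hj)
    exact lt_asymm this hi

/-- Equality in the triangle inequality is betweenness with respect to the first order, and this
relation composes: neighbours suffice, by induction along the list. -/
theorem isSingleCrossingList_iff_passesDistanceCheck {Q : Profile n t} :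
    IsSingleCrossingList Q ↔ PassesDistanceCheck Q := by
  constructor
  · intro h i _ hi
    rw [← between_iff]
    exact isSingleCrossingList_iff.1 h _ _ _ (Nat.zero_le _) (Nat.le_succ _)
  · intro h
    by_cases ht : 0 < t
    · refine isSingleCrossingList_of_monotone (Q ⟨0, ht⟩) ?_
      rintro ⟨i, hi⟩ ⟨j, hj⟩ hij
      replace hij : i ≤ j := hij
      induction j, hij using Nat.le_induction with
      | base => exact fun a b _ h => h
      | succ j hij ih =>
        intro a b h1 h2
        refine ih (by omega) a b h1 ?_
        rcases Nat.eq_zero_or_pos j with rfl | hj0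
        · exact h1
        · exact between_iff.2 (h j hj0 hj) a b h1 h2
    · intro a b _
      exact Or.inl fun j => absurd j.pos ht

theorem IsSingleCrossingList.rev {Q : Profile n t} (h : IsSingleCrossingList Q) :
    IsSingleCrossingList fun i => Q i.rev := by
  rw [isSingleCrossingList_iff] at h ⊢
  intro i j k hij hjk a b h1 h2
  exact h _ _ _ (Fin.rev_le_rev.2 hjk) (Fin.rev_le_rev.2 hij) a b h2 h1

/-- An order that is farthest from a member of a single-crossing list is at one of its ends. -/
theorem IsSingleCrossingList.eq_end {Q : Profile n t} (h : IsSingleCrossingList Q) {i j : Fin t}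
    (hmax : ∀ k, kendallTau (Q i) (Q k) ≤ kendallTau (Q i) (Q j)) :
    Q j = Q ⟨0, j.pos⟩ ∨ Q j = Q (Fin.rev ⟨0, j.pos⟩) := by
  rw [isSingleCrossingList_iff] at h
  rcases le_total i j with hij | hij
  · right
    have h1 : j ≤ Fin.rev ⟨0, j.pos⟩ := by
      rw [Fin.le_def, Fin.val_rev]; have := j.is_lt; simp; omega
    have h2 := between_iff.1 (h _ _ _ hij h1)
    have h3 := hmax (Fin.rev ⟨0, j.pos⟩)
    exact eq_of_kendallTau_eq_zero (by omega)
  · left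
    have h1 : (⟨0, j.pos⟩ : Fin t) ≤ j := Nat.zero_le _
    have h2 := between_iff.1 (h _ _ _ h1 hij)
    have h3 := hmax ⟨0, j.pos⟩
    rw [kendallTau_comm _ (Q i), kendallTau_comm (Q ⟨0, j.pos⟩) (Q i)] at h2
    exact (eq_of_kendallTau_eq_zero (by omega)).symm

/-- Every witness starts or ends with a given farthest order. -/
theorem Witnesses.exists_start {P : Profile n t} {τ : Equiv.Perm (Fin t)} (h : Witnesses P τ)
    {x : Fin t} (hx : IsFarthestFromFirst P x) :
    ∃ τ' : Equiv.Perm (Fin t), Witnesses P τ' ∧ P (τ' ⟨0, x.pos⟩) = P x ∧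
      (τ' = τ ∨ τ' = Fin.revPerm.trans τ) := by
  have := IsSingleCrossingList.eq_end h (i := τ.symm ⟨0, x.pos⟩) (j := τ.symm x)
    (fun k => by simpa using hx (τ k))
  simp only [Equiv.apply_symm_apply] at this
  rcases this with h1 | h1
  · exact ⟨τ, h, h1.symm, Or.inl rfl⟩
  · exact ⟨Fin.revPerm.trans τ, IsSingleCrossingList.rev h, h1.symm, Or.inr rfl⟩

theorem Witnesses.between_of_le {P : Profile n t} {τ : Equiv.Perm (Fin t)} (h : Witnesses P τ)
    {x : Fin t} (hx : P (τ ⟨0, x.pos⟩) = P x) {y z : Fin t} (hyz : τ.symm y ≤ τ.symm z) :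
    Between (P x) (P y) (P z) := by
  have := isSingleCrossingList_iff.1 h ⟨0, x.pos⟩ (τ.symm y) (τ.symm z) (Nat.zero_le _) hyz
  simpa [hx] using this

/-- One of the two orders lies between the starting order and the other, so equal distances from the
start leave distance zero between them. -/
theorem Witnesses.eq_of_kendallTau_eq {P : Profile n t} {τ : Equiv.Perm (Fin t)}
    (h : Witnesses P τ) {x : Fin t} (hx : P (τ ⟨0, x.pos⟩) = P x) {y z : Fin t}
    (hyz : kendallTau (P x) (P y) = kendallTau (P x) (P z)) : P y = P z := by
  rcases le_total (τ.symm y) (τ.symm z) with h1 | h1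
  · have := between_iff.1 (h.between_of_le hx h1)
    exact eq_of_kendallTau_eq_zero (by omega)
  · have := between_iff.1 (h.between_of_le hx h1)
    exact (eq_of_kendallTau_eq_zero (by omega)).symm

theorem Witnesses.sortsByDistanceFrom {P : Profile n t} {τ : Equiv.Perm (Fin t)}
    (h : Witnesses P τ) {x : Fin t} (hx : P (τ ⟨0, x.pos⟩) = P x) : SortsByDistanceFrom P x τ := by
  intro i j hij
  have := between_iff.1 (h.between_of_le hx (y := τ i) (z := τ j) (by simpa using hij))
  omega

/-- A witness that starts with the farthest order is sorted by distance from it, and ties are equal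
orders. Any other sort differs only within ties. -/
theorem IsSingleCrossing.witnesses {P : Profile n t} (h : IsSingleCrossing P) {x : Fin t}
    (hx : IsFarthestFromFirst P x) {σ : Equiv.Perm (Fin t)} (hσ : SortsByDistanceFrom P x σ) :
    Witnesses P σ := by
  obtain ⟨τ, hτ⟩ := h
  obtain ⟨τ', hτ', h0, -⟩ := hτ.exists_start hx
  refine isSingleCrossingList_of_monotone (P x) fun i j hij => ?_
  rcases le_total (τ'.symm (σ i)) (τ'.symm (σ j)) with h1 | h1
  · exact hτ'.between_of_le h0 h1
  -- Here `σ` and `τ'` disagree on the order of two indices, which forces a tie and hence equal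
  -- orders.
  · have h2 := between_iff.1 (hτ'.between_of_le h0 h1)
    have h3 := hσ i j hij
    have h4 : P (σ i) = P (σ j) := hτ'.eq_of_kendallTau_eq h0 (by omega)
    rw [h4]
    exact fun a b _ h => h

theorem exists_isFarthestFromFirst (P : Profile n t) (ht : 0 < t) :
    ∃ x, IsFarthestFromFirst P x := by
  have : Nonempty (Fin t) := ⟨⟨0, ht⟩⟩
  obtain ⟨x, -, hx⟩ := Finset.exists_max_image Finset.univ
    (fun y => kendallTau (P ⟨0, ht⟩) (P y)) Finset.univ_nonempty
  exact ⟨x, fun y => hx y (Finset.mem_univ _)⟩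

theorem witnesses_unique {P : Profile n t} {σ τ : Equiv.Perm (Fin t)} (hσ : Witnesses P σ)
    (hτ : Witnesses P τ) :
    (∀ i : Fin t, P (σ i) = P (τ i)) ∨ (∀ i : Fin t, P (σ i) = P (τ i.rev)) := by
  by_cases ht : 0 < t
  · obtain ⟨x, hx⟩ := exists_isFarthestFromFirst P ht
    obtain ⟨σ', hσ', hσ0, hσe⟩ := hσ.exists_start hx
    obtain ⟨τ', hτ', hτ0, hτe⟩ := hτ.exists_start hx
    have key : ∀ i, P (σ' i) = P (τ' i) := by
      intro i
      -- Both rearrangements sort the same distances, so the sorted sequences of distances coincide.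
      have := Tuple.unique_monotone (f := fun y => kendallTau (P x) (P y)) (σ := σ') (τ := τ')
        (fun i j hij => hσ'.sortsByDistanceFrom hσ0 i j hij)
        (fun i j hij => hτ'.sortsByDistanceFrom hτ0 i j hij)
      exact hσ'.eq_of_kendallTau_eq hσ0 (congrFun this i)
    rcases hσe with rfl | rfl <;> rcases hτe with rfl | rfl
    · exact Or.inl key
    · exact Or.inr key
    · exact Or.inr fun i => by simpa using key i.rev
    · exact Or.inl fun i => by simpa using key i.rev
  · exact Or.inl fun i => absurd i.pos ht

end

end SingleCrossing

namespace SingleCrossing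

/-! ### The recognition program -/

section

open Var Arr

/-- Finds an order `xb` at maximum distance from the first one. -/
def farthest : Cmd :=
  .set best 0 ;; .set xb 0 ;; .set X 0 ;;
  .loop yy t (.set Y yy ;; distance ;; .ite best tot (.set best tot ;; .set xb yy) .skip)

/-- Stores the distances from the order `xb`. -/
def distances : Cmd :=
  .set X xb ;; .loop yy t (.set Y yy ;; distance ;; .put D2 yy tot)

/-- Sorts the indices of the orders by the values in `D2`, two-digit numbers to base `n + 1`. -/
def radixSort : Cmd :=
  .set m t ;; .set H (n + 1) ;;
  .loop i t (.put SRC i i ;; .put KEY i (.get D2 i % H)) ;;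
  bucketSort ;;
  .loop i t (.put SRC i (.get DST i) ;; .put KEY i (.get D2 (.get DST i) / H)) ;;
  bucketSort

/-- Stores the sorted indices in `SIG` and checks the distances of neighbours. -/
def verify : Cmd :=
  .loop i t (.put SIG i (.get DST i)) ;;
  .set ok 1 ;; .set t1 (t - 1) ;;
  .loop yy t1 (.set X (.get SIG yy) ;; .set Y (.get SIG (yy + 1)) ;; distance ;;
    .ite (.get D2 (.get SIG (yy + 1))) (.get D2 (.get SIG yy) + tot) (.set ok 0) .skip)

/-- Writes the result. -/
def output : Cmd :=
  .loop i t (.put io i (.get SIG i)) ;; .set n ok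

/-- Recognition in the nondegenerate case. -/
def recognize : Cmd :=
  setup ;; farthest ;; distances ;; radixSort ;; verify ;; output

/-- Accepts with the identity permutation. -/
def accept : Cmd :=
  .loop i t (.put io i i) ;; .set n 1

/-- The whole program. -/
def program : Cmd :=
  .ite n 2 accept (.ite t 1 accept recognize)

end

/-- The store holds a profile, and the parameters and tables suit its size. -/
structure Context {n t : ℕ} (P : Profile n t) (U B L γ : ℕ) (s : Store) : Prop where
  env : Env U L γ s
  input : Input P U B s
  le_two_pow : n ≤ 2 ^ L
  lt : t + 1 < U

section

variable {n t U B L γ : ℕ} {P : Profile n t} {s s' : Store}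

theorem Context.frame (h : Context P U B L γ s) {c : Cmd} (f : Frame c s s')
    (hc : (c.keepsEnv && (!c.writes .n && !c.writes .t && !c.writesA .io)) = true) :
    Context P U B L γ s' := by
  rw [Bool.and_eq_true] at hc
  exact ⟨h.env.frame f hc.1, h.input.frame f hc.2, h.le_two_pow, h.lt⟩

theorem Context.setv (h : Context P U B L γ s) (x : Var) (y : ℕ)
    (hx : x ∉ [Var.n, .t, .L, .N, .gam, .g, .D, .W, .R, .nW]) : Context P U B L γ (s.setv x y) := by
  simp only [List.mem_cons, List.not_mem_nil, or_false, not_or] at hx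
  refine ⟨h.env.setv x y (by simp [hx]), ⟨?_, ?_, h.input.io, h.input.le, h.input.lt⟩,
    h.le_two_pow, h.lt⟩
  · rw [Store.setv_v, if_neg (Ne.symm hx.1), h.input.vn]
  · rw [Store.setv_v, if_neg (Ne.symm hx.2.1), h.input.vt]

theorem Context.sq_lt (h : Context P U B L γ s) : 2 * (n * n) < U := by
  have h1 := Nat.mul_le_mul h.le_two_pow h.le_two_pow
  have h2 := h.env.U_ge
  have h3 : 1 ≤ 2 ^ L * 2 ^ L := Nat.mul_pos (by positivity) (by positivity)
  omega

/-- Bound on the cost of a distance computation. -/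
def distanceCost (L γ : ℕ) : ℕ := 2300 * (2 ^ L * (rounds L γ + 2 ^ γ))

theorem Context.distance_spec (h : Context P U B L γ s) (x y : Fin t) (hX : s.v .X = x)
    (hY : s.v .Y = y) : wp U B distance s fun c s' =>
      c ≤ distanceCost L γ ∧ s'.v .tot = kendallTau (P x) (P y) :=
  SingleCrossing.distance_spec h.env h.input h.le_two_pow x y hX hY

/-- The initial values are consistent: the first order is at distance 0 from itself, so `best = 0`
belongs to index 0. -/
theorem farthest_spec (h : Context P U B L γ s) (ht : 0 < t) : wp U B farthest s fun c s' =>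
    c ≤ 30 + t * (distanceCost L γ + 30) ∧
      ∃ x : Fin t, s'.v .xb = x ∧ IsFarthestFromFirst P x := by
  simp only [farthest, wp_seq (c := .set _ _), wp_set, Expr.safe_ofNat, true_and, Expr.eval_ofNat]
  have h0 := ((h.setv .best 0 (by decide)).setv .xb 0 (by decide)).setv .X 0 (by decide)
  have ht0 := h0.input.vt
  refine (wp_loop (fun i s => ∃ x : Fin t, s.v .xb = x ∧
    s.v .best = kendallTau (P ⟨0, ht⟩) (P x) ∧
    ∀ y : Fin t, y < i → kendallTau (P ⟨0, ht⟩) (P y) ≤ s.v .best) (distanceCost L γ + 20)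
    (by decide) ⟨⟨0, ht⟩, by simp [kendallTau_self]⟩ ?_).mono ?_
  · rintro i hi s1 f1 hi1 ⟨x, I1, I2, I3⟩
    rw [ht0] at hi
    have h1 := h0.frame f1 (by decide)
    have X1 : s1.v .X = 0 := by rw [f1.v _ rfl]; simp
    simp only [wp_seq, wp_set, Expr.safe_var, true_and, Expr.eval_var, hi1]
    refine ((h1.setv .Y i (by decide)).distance_spec ⟨0, ht⟩ ⟨i, hi⟩ (by simp [X1])
      (by simp)).mono ?_
    rintro k2 s2 f2 ⟨hk2, h2⟩
    have b2 : s2.v .best = s1.v .best := by rw [f2.v _ rfl]; simp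
    have x2 : s2.v .xb = s1.v .xb := by rw [f2.v _ rfl]; simp
    have y2 : s2.v .yy = i := by rw [f2.v _ rfl]; simp [hi1]
    simp only [wp_ite, wp_seq, wp_set, wp_skip]
    simp [-Fin.val_fin_lt, b2, x2, y2, h2]
    refine ⟨fun hlt => ⟨by omega, ⟨i, hi⟩, rfl, rfl, fun y hy => ?_⟩,
      fun hge => ⟨by omega, x, I1, I2, fun y hy => ?_⟩⟩
    · rcases Nat.lt_or_eq_of_le hy with hy | hy
      · exact (I3 y hy).trans hlt.le
      · have : y = ⟨i, hi⟩ := Fin.ext hy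
        rw [this]
    · rcases Nat.lt_or_eq_of_le hy with hy | hy
      · exact I3 y hy
      · have : y = ⟨i, hi⟩ := Fin.ext hy
        rw [this]; exact hge
  · rintro k s1 - ⟨hk, x, h1, h2, h3⟩
    rw [ht0] at hk h3
    refine ⟨?_, x, h1, fun y => h2 ▸ h3 y y.is_lt⟩
    have : t * (distanceCost L γ + 20 + 3) ≤ t * (distanceCost L γ + 30) :=
      Nat.mul_le_mul_left _ (by omega)
    simp
    omega

theorem distances_spec (h : Context P U B L γ s) {x : Fin t} (hx : s.v .xb = x) :
    wp U B distances s fun c s' => c ≤ 30 + t * (distanceCost L γ + 30) ∧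
      ∀ y : Fin t, s'.a .D2 y = kendallTau (P x) (P y) := by
  simp only [distances, wp_seq (c := .set _ _), wp_set, Expr.safe_var, true_and, Expr.eval_var, hx]
  have h0 := h.setv .X x (by decide)
  have ht0 := h0.input.vt
  refine (wp_loop (fun i s => ∀ y : Fin t, y < i → s.a .D2 y = kendallTau (P x) (P y))
    (distanceCost L γ + 20) (by decide) (by simp) ?_).mono ?_
  · rintro i hi s1 f1 hi1 I
    rw [ht0] at hi
    have h1 := h0.frame f1 (by decide)
    have X1 : s1.v .X = x := by rw [f1.v _ rfl]; simp
    simp only [wp_seq, wp_set, Expr.safe_var, true_and, Expr.eval_var, hi1]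
    refine ((h1.setv .Y i (by decide)).distance_spec x ⟨i, hi⟩ (by simp [X1]) (by simp)).mono ?_
    rintro k2 s2 f2 ⟨hk2, h2⟩
    have y2 : s2.v .yy = i := by rw [f2.v _ rfl]; simp [hi1]
    have d2 : s2.a .D2 = s1.a .D2 := by rw [f2.a _ rfl]; simp
    simp only [wp_put]
    simp [-Fin.val_fin_lt, y2, h2, d2]
    refine ⟨by omega, fun y hy => ?_⟩
    rw [Function.update_apply]
    split_ifs with e
    · have : y = ⟨i, hi⟩ := Fin.ext e
      rw [this]
    · exact I y (by omega)
  · rintro k s1 - ⟨hk, h1⟩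
    rw [ht0] at hk h1
    refine ⟨?_, fun y => h1 y y.is_lt⟩
    have : t * (distanceCost L γ + 20 + 3) ≤ t * (distanceCost L γ + 30) :=
      Nat.mul_le_mul_left _ (by omega)
    simp
    omega

/-- The permutation that an arrangement of `0, …, t - 1` represents. -/
theorem exists_perm_of_list {l : List ℕ} (h : l.Perm (List.range t)) :
    ∃ σ : Equiv.Perm (Fin t), ∀ i : Fin t, l[i]? = some (σ i : ℕ) := by
  have hl : l.length = t := by simpa using h.length_eq
  have hlt : ∀ i (hi : i < l.length), l[i] < t := fun i hi =>
    List.mem_range.1 (h.mem_iff.1 (List.getElem_mem hi))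
  let f : Fin t → Fin t := fun i => ⟨l[i]'(by omega), hlt _ _⟩
  have hf : Function.Injective f := by
    intro i j hij
    have h1 : l.Nodup := h.nodup_iff.2 List.nodup_range
    exact Fin.ext ((h1.getElem_inj_iff).1 (Fin.mk.inj_iff.1 hij))
  exact ⟨Equiv.ofBijective f (Finite.injective_iff_bijective.1 hf), fun i => by simp [f, hl]⟩

/-- Distances are at most `n * n < (n + 1) ^ 2`, so two base `n + 1` digits suffice and sorting
costs only `O(n + t)`. -/
theorem radixSort_spec (hn : s.v .n = n) (ht : s.v .t = t) {d : ℕ → ℕ} (hd : ∀ y < t, d y ≤ n * n)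
    (hD : ∀ y < t, s.a .D2 y = d y) (hnU : n + 1 < U) (htU : t + 1 < U) :
    wp U B radixSort s fun c s' => c ≤ 500 * (n + t + 2) ∧ ∃ σ : Equiv.Perm (Fin t),
      (∀ i : Fin t, s'.a .DST i = σ i) ∧ ∀ i j, i ≤ j → d (σ i) ≤ d (σ j) := by
  have hlt : ∀ y < t, d y / (n + 1) < n + 1 := fun y hy => by
    rw [Nat.div_lt_iff_lt_mul (by omega)]
    have := hd y hy
    nlinarith
  simp only [radixSort, wp_seq (c := .set _ _), wp_set, Expr.safe_var, Expr.safe_add,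
    Expr.safe_ofNat, true_and, Expr.eval_var, Expr.eval_add, Expr.eval_ofNat, Store.setv_v,
    reduceCtorEq, if_false, hn, ht]
  refine ⟨hnU, ?_⟩
  refine (wp_loop (fun i s => ∀ j < i, s.a .SRC j = j ∧ s.a .KEY j = d j % (n + 1)) 30 (by decide)
    (by simp) ?_).seq ?_
  · intro i hi s1 f1 hi1 I
    replace hi : i < t := by simpa [ht] using hi
    have H1 : s1.v .H = n + 1 := by rw [f1.v _ rfl]; simp
    have D1 : s1.a .D2 = s.a .D2 := by rw [f1.a _ rfl]; simp
    simp only [wp_seq, wp_put]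
    simp [-Order.lt_add_one_iff, hi1, H1, D1, hD i hi, Function.update_apply]
    intro j hj
    split_ifs with e
    · simp [e]
    · exact I j (by omega)
  rintro k1 s1 f1 ⟨hk1, h1⟩
  have t0 : ((s.setv .m t).setv .H (n + 1)).v .t = t := by simp [ht]
  rw [t0] at hk1 h1
  have t1 : s1.v .t = t := by rw [f1.v _ rfl, t0]
  have m1 : s1.v .m = t := by rw [f1.v _ rfl]; simp
  have H1 : s1.v .H = n + 1 := by rw [f1.v _ rfl]; simp
  have D1 : s1.a .D2 = s.a .D2 := by rw [f1.a _ rfl]; simp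
  refine (bucketSort_spec (f := fun x => d x % (n + 1)) (l := List.range t) (by simpa using m1) H1
    (by simpa using htU) (fun i hi => by simpa using (h1 i (by simpa using hi)).1)
    (fun i hi => by simpa using (h1 i (by simpa using hi)).2)
    (fun x _ => Nat.mod_lt _ (by omega))).seq ?_
  rintro k2 s2 f2 ⟨hk2, h2⟩
  set l := bucket (fun x => d x % (n + 1)) (n + 1) (List.range t) with hl
  have hperm : l.Perm (List.range t) := bucket_perm fun x _ => Nat.mod_lt _ (by omega)
  have hlen : l.length = t := by simpa using hperm.length_eq
  have hmem : ∀ x ∈ l, x < t := fun x hx => List.mem_range.1 (hperm.mem_iff.1 hx)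
  have t2 : s2.v .t = t := by rw [f2.v _ rfl, t1]
  have m2 : s2.v .m = t := by rw [f2.v _ rfl, m1]
  have H2 : s2.v .H = n + 1 := by rw [f2.v _ rfl, H1]
  have D2 : s2.a .D2 = s.a .D2 := by rw [f2.a _ rfl, D1]
  refine (wp_loop (fun i s => ∀ j (hj : j < l.length), j < i →
    s.a .SRC j = l[j] ∧ s.a .KEY j = d l[j] / (n + 1)) 40 (by decide) (by simp) ?_).seq ?_
  · intro i hi s3 f3 hi3 I
    rw [t2] at hi
    have hi' : i < l.length := by omega
    have H3 : s3.v .H = n + 1 := by rw [f3.v _ rfl, H2]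
    have D3 : s3.a .D2 = s.a .D2 := by rw [f3.a _ rfl, D2]
    have dst3 : s3.a .DST i = l[i] := by rw [f3.a _ rfl]; simpa using h2 i hi'
    simp only [wp_seq, wp_put]
    simp [-Order.lt_add_one_iff, hi3, H3, D3, dst3, hD _ (hmem _ (List.getElem_mem hi')),
      Function.update_apply]
    intro j hjl hj
    split_ifs with e
    · subst e; simp
    · exact I j hjl (by omega)
  rintro k3 s3 f3 ⟨hk3, h3⟩
  rw [t2] at hk3 h3
  have m3 : s3.v .m = t := by rw [f3.v _ rfl, m2]
  have H3 : s3.v .H = n + 1 := by rw [f3.v _ rfl, H2]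
  refine (bucketSort_spec (f := fun x => d x / (n + 1)) (l := l) (by rw [m3, hlen]) H3
    (by rwa [hlen]) (fun i hi => by simpa using (h3 i hi (by omega)).1)
    (fun i hi => (h3 i hi (by omega)).2) (fun x hx => hlt x (hmem x hx))).mono ?_
  rintro k4 s4 - ⟨hk4, h4⟩
  have hperm' : (bucket (fun x => d x / (n + 1)) (n + 1) l).Perm l :=
    bucket_perm fun x hx => hlt x (hmem x hx)
  have hsort : (bucket (fun x => d x / (n + 1)) (n + 1) l).Pairwise fun x y => d x ≤ d y := by
    -- The second pass orders by the high digit; for equal high digits, stability preserves the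
    -- low-digit order of the first pass.
    refine pairwise_bucket ?_ fun x y hxy => ?_
    · refine pairwise_bucket (List.pairwise_of_forall fun x y hxy hxy' => ?_)
        fun x y hxy hxy' => ?_
      · rw [← Nat.div_add_mod (d x) (n + 1), ← Nat.div_add_mod (d y) (n + 1), hxy, hxy']
      · rw [← Nat.div_add_mod (d x) (n + 1), ← Nat.div_add_mod (d y) (n + 1), hxy']
        omega
    · by_contra hlt
      exact absurd (Nat.div_le_div_right (c := n + 1) (not_le.1 hlt).le) (by omega)
  obtain ⟨σ, hσ⟩ := exists_perm_of_list (hperm'.trans hperm)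
  refine ⟨?_, σ, fun i => ?_, fun i j hij => ?_⟩
  · simp only [hlen, List.length_range] at hk2 hk4
    simp
    omega
  · obtain ⟨hi, e⟩ := List.getElem?_eq_some_iff.1 (hσ i)
    rw [← e, ← h4 i hi, zero_add]
  · obtain ⟨hi, ei⟩ := List.getElem?_eq_some_iff.1 (hσ i)
    obtain ⟨hj, ej⟩ := List.getElem?_eq_some_iff.1 (hσ j)
    rcases hij.lt_or_eq with hij | rfl
    · rw [← ei, ← ej]
      exact List.pairwise_iff_getElem.1 hsort i j hi hj hij
    · exact le_rfl

end

end SingleCrossing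

/-! ### Verification, output and total cost. -/

namespace SingleCrossing

section

variable {n t U B L γ : ℕ} {P : Profile n t} {s s' : Store}

/-- The distances from `P x` are additive along the list sorted by `σ`. -/
def AdditiveFrom (P : Profile n t) (x : Fin t) (σ : Equiv.Perm (Fin t)) (i : ℕ) : Prop :=
  ∀ h : i + 1 < t, kendallTau (P x) (P (σ ⟨i, by omega⟩)) +
    kendallTau (P (σ ⟨i, by omega⟩)) (P (σ ⟨i + 1, h⟩)) ≤ kendallTau (P x) (P (σ ⟨i + 1, h⟩))

/-- The first order is no farther from `P x` than `P x` itself. It may have another index if orders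
repeat. -/
theorem SortsByDistanceFrom.eq_start {x : Fin t} {σ : Equiv.Perm (Fin t)}
    (h : SortsByDistanceFrom P x σ) : P x = P (σ ⟨0, x.pos⟩) := by
  have := h ⟨0, x.pos⟩ (σ.symm x) (Nat.zero_le _)
  rw [Equiv.apply_symm_apply, kendallTau_self] at this
  exact eq_of_kendallTau_eq_zero (Nat.le_zero.1 this)

/-- The extra condition at index 0 is trivial, as the first order has distance 0 from `P x`; and the
inequality is an equality by the triangle inequality. -/
theorem SortsByDistanceFrom.passesDistanceCheck_iff {x : Fin t} {σ : Equiv.Perm (Fin t)}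
    (h : SortsByDistanceFrom P x σ) :
    (PassesDistanceCheck fun i => P (σ i)) ↔ ∀ i, AdditiveFrom P x σ i := by
  unfold PassesDistanceCheck AdditiveFrom
  rw [h.eq_start]
  constructor
  · intro h1 i hi
    rcases Nat.eq_zero_or_pos i with rfl | hi0
    · rw [kendallTau_self, zero_add]
    · exact (h1 i hi0 hi).le
  · exact fun h1 i _ hi => (h1 i hi).antisymm (kendallTau_triangle _ _ _)

/-- The distances from `P x` are stored, so each neighbouring pair costs one new distance. `ok` is
only ever lowered: 0 certifies a failure, 1 that none has occurred so far. -/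
theorem verify_spec (h : Context P U B L γ s) (ht : 0 < t) {x : Fin t} {σ : Equiv.Perm (Fin t)}
    (hD : ∀ y : Fin t, s.a .D2 y = kendallTau (P x) (P y)) (hσ : ∀ i : Fin t, s.a .DST i = σ i) :
    wp U B verify s fun c s' => c ≤ 50 + t * (distanceCost L γ + 150) ∧
      (∀ i : Fin t, s'.a .SIG i = σ i) ∧
      (s'.v .ok = 1 ∧ (∀ i, AdditiveFrom P x σ i) ∨
        s'.v .ok = 0 ∧ ¬ ∀ i, AdditiveFrom P x σ i) := by
  refine (wp_loop (fun i s => ∀ j : Fin t, j < i → s.a .SIG j = σ j) 30 (by decide) (by simp)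
    ?_).seq ?_
  · intro i hi s1 f1 hi1 I
    rw [h.input.vt] at hi
    have dst1 : s1.a .DST i = σ ⟨i, hi⟩ := by rw [f1.a _ rfl]; exact hσ ⟨i, hi⟩
    simp only [wp_put]
    simp [-Fin.val_fin_lt, -Order.lt_add_one_iff, hi1, dst1, Function.update_apply]
    intro j hj
    split_ifs with e
    · have : j = ⟨i, hi⟩ := Fin.ext e
      rw [this]
    · exact I j (by omega)
  rintro k1 s1 f1 ⟨hk1, h1⟩
  rw [h.input.vt] at hk1 h1
  replace h1 : ∀ i (hi : i < t), s1.a .SIG i = σ ⟨i, hi⟩ := fun i hi => h1 ⟨i, hi⟩ hi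
  have c1 := h.frame f1 (by decide)
  have D1 : s1.a .D2 = s.a .D2 := f1.a _ rfl
  simp only [wp_seq (c := .set _ _), wp_set, Expr.safe_var, Expr.safe_sub, Expr.safe_ofNat,
    true_and, Expr.eval_var, Expr.eval_sub, Expr.eval_ofNat, Store.setv_v, reduceCtorEq, if_false,
    c1.input.vt]
  refine ⟨ht, ?_⟩
  have c2 := (c1.setv .ok 1 (by decide)).setv .t1 (t - 1) (by decide)
  refine (wp_loop (fun i s => s.v .ok = 1 ∧ (∀ j < i, AdditiveFrom P x σ j) ∨
        s.v .ok = 0 ∧ ¬ ∀ i, AdditiveFrom P x σ i) (distanceCost L γ + 100) (by decide)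
    (by simp) ?_).mono ?_
  · intro i hi s2 f2 hi2 I
    replace hi : i < t - 1 := by simpa using hi
    have c3 := c2.frame f2 (by decide)
    have SIG2 : s2.a .SIG = s1.a .SIG := by rw [f2.a _ rfl]; simp
    have D2 : s2.a .D2 = s.a .D2 := by rw [f2.a _ rfl]; simp [D1]
    have g0 := h1 i (by omega)
    have g1 := h1 (i + 1) (by omega)
    have hiU : i + 1 < U := by have := h.lt; omega
    simp only [wp_seq (c := .set _ _), wp_set, wp_seq (c := distance)]
    simp only [Expr.safe_var, Expr.safe_get, Expr.safe_add, Expr.safe_ofNat, Expr.eval_var,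
      Expr.eval_get, Expr.eval_add, Expr.eval_ofNat, Store.setv_v, Store.setv_a, reduceCtorEq,
      if_false, if_true, hi2, SIG2, g0, g1, true_and, false_imp_iff, and_true]
    refine ⟨hiU, ?_⟩
    refine (((c3.setv .X _ (by decide)).setv .Y _ (by decide)).distance_spec (σ ⟨i, by omega⟩)
      (σ ⟨i + 1, by omega⟩) (by simp) (by simp)).mono ?_
    rintro k4 s4 f4 ⟨hk4, h4⟩
    have SIG4 : s4.a .SIG = s1.a .SIG := by rw [f4.a _ rfl]; simp [SIG2]
    have D4 : s4.a .D2 = s.a .D2 := by rw [f4.a _ rfl]; simp [D2]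
    have y4 : s4.v .yy = i := by rw [f4.v _ rfl]; simp [hi2]
    have ok4 : s4.v .ok = s2.v .ok := by rw [f4.v _ rfl]; simp
    have b1 := kendallTau_le (P x) (P (σ ⟨i, by omega⟩))
    have b2 := kendallTau_le (P (σ ⟨i, by omega⟩)) (P (σ ⟨i + 1, by omega⟩))
    have b3 := h.sq_lt
    simp only [wp_ite, wp_set, wp_skip]
    simp [-Order.lt_add_one_iff, y4, SIG4, D4, g0, g1, hD, h4, ok4]
    refine ⟨hiU, by omega, fun hlt => ⟨by omega, i, fun hall => ?_⟩,
      fun hge => ⟨by omega, ?_⟩⟩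
    · exact absurd (hall (by omega)) (not_le.2 hlt)
    · rcases I with ⟨I1, I2⟩ | ⟨I1, I2⟩
      · refine Or.inl ⟨I1, fun j hj => ?_⟩
        rcases Nat.lt_succ_iff_lt_or_eq.1 hj with hj | rfl
        · exact I2 j hj
        · exact fun _ => hge
      · exact Or.inr ⟨I1, by simpa using I2⟩
  · rintro k2 s2 f2 ⟨hk2, h2⟩
    have e : ((s1.setv .ok 1).setv .t1 (t - 1)).v .t1 = t - 1 := by simp
    rw [e] at hk2 h2
    refine ⟨?_, fun i => ?_, ?_⟩
    · have h3 : t * (distanceCost L γ + 150) = t * (distanceCost L γ + 100 + 3) + t * 47 := by ring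
      have h4 : (t - 1) * (distanceCost L γ + 100 + 3) ≤ t * (distanceCost L γ + 100 + 3) :=
        Nat.mul_le_mul_right _ (by omega)
      simp
      omega
    · rw [f2.a _ rfl]
      exact h1 i i.is_lt
    · rcases h2 with ⟨h2, h3⟩ | h2
      · exact Or.inl ⟨h2, fun i hi => h3 i (by omega) hi⟩
      · exact Or.inr h2

/-- The final store holds a correct answer. -/
def Answers (P : Profile n t) (s : Store) : Prop :=
  (IsSingleCrossing P → ∃ σ : Equiv.Perm (Fin t), (s.v .n = 1 ∧ ∀ i : Fin t, s.a .io i = σ i) ∧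
    Witnesses P σ ∧ (1 ≤ t → ∃ x, IsFarthestFromFirst P x ∧ SortsByDistanceFrom P x σ)) ∧
  (¬ IsSingleCrossing P → s.v .n = 0)

theorem output_spec (ht : s.v .t = t) (hB : t ≤ B) {σ : Equiv.Perm (Fin t)}
    (hσ : ∀ i : Fin t, s.a .SIG i = σ i) : wp U B output s fun c s' => c ≤ 20 * (t + 1) ∧
      s'.v .n = s.v .ok ∧ ∀ i : Fin t, s'.a .io i = σ i := by
  refine (wp_loop (fun i s => ∀ j : Fin t, j < i → s.a .io j = σ j) 15 (by decide) (by simp)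
    ?_).seq ?_
  · intro i hi s1 f1 hi1 I
    rw [ht] at hi
    have sig1 : s1.a .SIG i = σ ⟨i, hi⟩ := by rw [f1.a _ rfl]; exact hσ ⟨i, hi⟩
    simp only [wp_put]
    simp [-Fin.val_fin_lt, -Order.lt_add_one_iff, hi1, sig1, Function.update_apply]
    refine ⟨by omega, fun j hj => ?_⟩
    split_ifs with e
    · have : j = ⟨i, hi⟩ := Fin.ext e
      rw [this]
    · exact I j (by omega)
  rintro k1 s1 f1 ⟨hk1, h1⟩
  rw [ht] at hk1 h1
  rw [wp_set]
  refine ⟨trivial, by simp; omega, by simp [f1.v .ok rfl], fun i => h1 i i.is_lt⟩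

/-- In the degenerate cases all orders of the list are equal, so the identity is a witness. -/
theorem accept_spec (hvt : s.v .t = t) (hB : t ≤ B) (h : n ≤ 1 ∨ t = 0) :
    wp U B accept s fun c s' => c ≤ 20 * (t + 1) ∧ Answers P s' := by
  have hP : ∀ x y, P x = P y := by
    rcases h with h | rfl
    · have := Fin.subsingleton_iff_le_one.2 h
      exact fun x y => Subsingleton.elim _ _
    · exact fun x => x.elim0
  have hW : Witnesses P 1 := isSingleCrossingList_iff_passesDistanceCheck.2 fun i _ hi => by
    simp only [hP _ ⟨i, by omega⟩, kendallTau_self]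
  refine (wp_loop (fun i s => ∀ j : Fin t, j < i → s.a .io j = (j : ℕ)) 15 (by decide) (by simp)
    ?_).seq ?_
  · intro i hi s1 f1 hi1 I
    rw [hvt] at hi
    simp only [wp_put]
    simp [-Fin.val_fin_lt, -Order.lt_add_one_iff, hi1, Function.update_apply]
    refine ⟨by omega, fun j hj => ?_⟩
    split_ifs with e
    · exact e.symm
    · exact I j (by omega)
  rintro k1 s1 f1 ⟨hk1, h1⟩
  rw [hvt] at hk1 h1
  rw [wp_set]
  refine ⟨trivial, by simp; omega, fun _ => ⟨1, ⟨by simp, fun i => h1 i i.is_lt⟩, hW, fun ht => ?_⟩,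
    fun h => absurd ⟨1, hW⟩ h⟩
  exact ⟨⟨0, ht⟩, fun y => by rw [hP y ⟨0, ht⟩], fun i j _ => (congrArg _ (hP _ _)).le⟩

theorem recognize_spec (hn : 2 ≤ n) (ht : 1 ≤ t) (h : Input P U B s) (hU : 64 * (n * n) ≤ U)
    (hB : t ≤ B) (htU : t + 1 < U) : wp U B recognize s fun c s' =>
      (∃ L γ, 2 ^ L ≤ 2 * n ∧ L < 16 * (2 ^ γ * 2 ^ γ) ∧ γ ≤ L ∧ 2 ^ γ * 2 ^ γ ≤ L ∧
        c ≤ 9000 * (n * t) + 3 * (t * distanceCost L γ)) ∧ Answers P s' := by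
  refine (setup_spec hn h.vn hU).seq ?_
  rintro k1 s1 f1 ⟨hk1, L, γ, E1, hnL, hLn, hLγ⟩
  have c1 : Context P U B L γ s1 := ⟨E1, h.frame f1 (by decide), hnL, htU⟩
  refine (farthest_spec c1 ht).seq ?_
  rintro k2 s2 f2 ⟨hk2, x, x2, hx⟩
  have c2 := c1.frame f2 (by decide)
  refine (distances_spec c2 x2).seq ?_
  rintro k3 s3 f3 ⟨hk3, D3⟩
  have c3 := c2.frame f3 (by decide)
  have hdef : ∀ y (hy : y < t), s3.a .D2 y = kendallTau (P x) (P ⟨y, hy⟩) := fun y hy => D3 ⟨y, hy⟩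
  refine (radixSort_spec c3.input.vn c3.input.vt (d := s3.a .D2)
    (fun y hy => by rw [hdef y hy]; exact kendallTau_le _ _) (fun _ _ => rfl)
    (by have := c3.sq_lt; nlinarith) htU).seq ?_
  rintro k4 s4 f4 ⟨hk4, σ, hσ, hsort⟩
  have c4 := c3.frame f4 (by decide)
  have hS : SortsByDistanceFrom P x σ := fun i j hij => by
    rw [← D3, ← D3]; exact hsort i j hij
  refine (verify_spec c4 ht (fun y => by rw [f4.a _ rfl, D3]) hσ).seq ?_
  rintro k5 s5 f5 ⟨hk5, hsig, hok⟩
  have c5 := c4.frame f5 (by decide)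
  refine (output_spec c5.input.vt hB hsig).mono ?_
  rintro k6 s6 - ⟨hk6, n6, io6⟩
  have key : (∀ i, AdditiveFrom P x σ i) ↔ Witnesses P σ := by
    rw [← hS.passesDistanceCheck_iff, ← isSingleCrossingList_iff_passesDistanceCheck]; rfl
  rw [key] at hok
  refine ⟨⟨L, γ, hLn, hLγ, E1.bounds.1, E1.sq_le, ?_⟩, fun hsc => ?_, fun hsc => ?_⟩
  · have e1 : n ≤ n * t := Nat.le_mul_of_pos_right _ ht
    have e2 : 2 * t ≤ n * t := Nat.mul_le_mul_right _ hn
    rw [mul_add] at hk2 hk3 hk5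
    omega
  · have hw := hsc.witnesses hx hS
    rcases hok with hok | hok
    · exact ⟨σ, ⟨by rw [n6, hok.1], io6⟩, hw, fun _ => ⟨x, hx, hS⟩⟩
    · exact absurd hw hok.2
  · rcases hok with hok | hok
    · exact absurd ⟨σ, hok.2⟩ hsc
    · rw [n6, hok.1]

/-- The chosen `γ` balances both parts of the cost: there are at most `16 * 2 ^ γ` rounds, and `2 ^
γ` is at most the square root of `L`, which is `O(log n)`. -/
theorem recognize_cost {n t L γ c : ℕ} (hn : 2 ≤ n) (hLn : 2 ^ L ≤ 2 * n)
    (hLγ : L < 16 * (2 ^ γ * 2 ^ γ)) (hγ : γ ≤ L) (hsq : 2 ^ γ * 2 ^ γ ≤ L)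
    (hc : c ≤ 10000 * (n * t) + 3 * (t * distanceCost L γ)) :
    (c : ℝ) ≤ 600000 * (n * t * Real.sqrt (Real.log n)) := by
  have hg : 1 ≤ 2 ^ γ := Nat.one_le_two_pow
  have hr : rounds L γ ≤ 16 * 2 ^ γ := by
    by_contra hr
    have h1 := (rounds_bounds hγ).2
    have h2 : 2 ^ γ * (16 * 2 ^ γ + 1) ≤ 2 ^ γ * rounds L γ := Nat.mul_le_mul_left _ (by omega)
    have h3 : 2 ^ γ * (16 * 2 ^ γ + 1) = 16 * (2 ^ γ * 2 ^ γ) + 2 ^ γ := by ring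
    omega
  have h1 : c ≤ 300000 * (n * t * 2 ^ γ) := by
    have h2 : distanceCost L γ ≤ 2300 * (2 * n * (17 * 2 ^ γ)) :=
      Nat.mul_le_mul_left _ (Nat.mul_le_mul hLn (by omega))
    have h3 := Nat.mul_le_mul_left t h2
    have h4 : t * (2300 * (2 * n * (17 * 2 ^ γ))) = 78200 * (n * t * 2 ^ γ) := by ring
    have h5 : n * t ≤ n * t * 2 ^ γ := Nat.le_mul_of_pos_right _ hg
    omega
  have hlog : (L : ℝ) ≤ 4 * Real.log n := by
    have hn0 : (2 : ℝ) ≤ n := by exact_mod_cast hn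
    -- From `2 ^ L ≤ 2 * n ≤ n ^ 2` and `log 2 ≥ 1 / 2` one gets `L ≤ 4 * log n`.
    have h2 : (2 : ℝ) ^ L ≤ n * n := by
      have : (2 : ℝ) ^ L ≤ 2 * n := by exact_mod_cast hLn
      nlinarith
    have h3 := Real.log_le_log (by positivity) h2
    rw [Real.log_pow, Real.log_mul (by positivity) (by positivity)] at h3
    have h4 := Real.log_two_gt_d9
    have h5 : (L : ℝ) * (1 / 2) ≤ L * Real.log 2 :=
      mul_le_mul_of_nonneg_left (by linarith) (Nat.cast_nonneg _)
    linarith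
  have hroot : (2 : ℝ) ^ γ ≤ 2 * Real.sqrt (Real.log n) := by
    have h2 : (2 : ℝ) ^ γ * 2 ^ γ ≤ L := by exact_mod_cast hsq
    have h3 : (0 : ℝ) ≤ Real.log n := Real.log_natCast_nonneg n
    have h4 := Real.sq_sqrt h3
    refine le_of_sq_le_sq ?_ (by positivity)
    nlinarith
  have h2 : (c : ℝ) ≤ 300000 * (n * t * 2 ^ γ) := by exact_mod_cast h1
  have h3 : (n * t * 2 ^ γ : ℝ) ≤ n * t * (2 * Real.sqrt (Real.log n)) :=
    mul_le_mul_of_nonneg_left hroot (by positivity)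
  linarith

theorem program_spec (h : Input P U B s) (hU : 64 * (n * n) ≤ U) (hB : t ≤ B) (htU : t + 1 < U) :
    wp U B program s fun c s' =>
      (2 ≤ n → 1 ≤ t → ((c + 2 : ℕ) : ℝ) ≤ 600000 * (n * t * Real.sqrt (Real.log n))) ∧
      (n ≤ 1 ∨ t = 0 → c ≤ 50 * (t + 1)) ∧ Answers P s' := by
  simp only [program, wp_ite, Expr.safe_var, Expr.safe_ofNat, Expr.eval_var, Expr.eval_ofNat,
    true_and, h.vn, h.vt, Expr.cost_var, Expr.cost_ofNat]
  refine ⟨fun hn => ?_, fun hn => ⟨fun ht => ?_, fun ht => ?_⟩⟩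
  · refine (accept_spec (P := P) h.vt hB (Or.inl (by omega))).mono ?_
    rintro k s1 - ⟨hk, h1⟩
    exact ⟨fun hn' => by omega, fun _ => by omega, h1⟩
  · refine (accept_spec (P := P) h.vt hB (Or.inr (by omega))).mono ?_
    rintro k s1 - ⟨hk, h1⟩
    exact ⟨fun _ ht' => by omega, fun _ => by omega, h1⟩
  · refine (recognize_spec (by omega) (by omega) h hU hB htU).mono ?_
    rintro k s1 - ⟨⟨L, γ, hLn, hLγ, hγ, hsq, hk⟩, h1⟩
    refine ⟨fun hn ht => ?_, fun h => by omega, h1⟩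
    have h2 : 2 * 1 ≤ n * t := Nat.mul_le_mul hn ht
    exact recognize_cost hn hLn hLγ hγ hsq (by omega)

end

end SingleCrossing

/-! ### From stores to machine states. -/

namespace SingleCrossing

section

variable {n t : ℕ} (P : Profile n t)

/-- The initial store on input `P`. -/
def inputStore : Store where
  v x := (inputState P).reg x.ctorIdx
  a k i := if k = .io then (inputState P).mem i else 0

theorem inputStore_input {U B : ℕ} (hB : n * t ≤ B) (hU : B < U) : Input P U B (inputStore P) where
  vn := rfl
  vt := rfl
  io j i := by
    have hlt : (j * n + i : ℕ) < n * t := by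
      calc (j * n + i : ℕ) < j * n + n := by have := i.is_lt; omega
        _ = (j + 1) * n := by ring
        _ ≤ t * n := Nat.mul_le_mul_right _ j.is_lt
        _ = n * t := mul_comm _ _
    have hn : 0 < n := i.pos
    have h1 : (j * n + i : ℕ) / n = j := by
      rw [mul_comm, Nat.mul_add_div hn, Nat.div_eq_of_lt i.is_lt, add_zero]
    have h2 : (j * n + i : ℕ) % n = i := by
      rw [mul_comm, Nat.mul_add_mod, Nat.mod_eq_of_lt i.is_lt]
    simp only [inputStore, inputState, if_true, dif_pos hlt, h1, h2]
  le := hB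
  lt := hU

theorem inputStore_bounded {U : ℕ} (hn : n < U) (ht : t < U) : (inputStore P).Bounded U where
  v x := by
    simp only [inputStore, inputState]
    split_ifs <;> omega
  a k i := by
    simp only [inputStore, inputState]
    split_ifs
    · exact (Fin.is_lt _).trans hn
    · omega
    · omega

-- Two instructions put `B = n * t + t` into the base register, which leaves room for both the input
-- and the output below the arrays. They account for the `c + 2` in `program_spec`.
open WordRAM in
theorem program_exec {w : ℕ} (hw : ((n + 2) * (t + 2)) ^ 8 ≤ 2 ^ w) : ∃ k s,
    Exec w (.seq (.seq (.op .mul 99 0 1) (.op .add 99 99 1)) program.compile) (inputState P) k s ∧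
    (2 ≤ n → 1 ≤ t → (k : ℝ) ≤ 600000 * (n * t * Real.sqrt (Real.log n))) ∧
    (n ≤ 1 ∨ t = 0 → k ≤ 60 * (t + 1)) ∧
    (IsSingleCrossing P → ∃ σ : Equiv.Perm (Fin t), OutputsYes s σ ∧ Witnesses P σ ∧
      (1 ≤ t → ∃ x, IsFarthestFromFirst P x ∧ SortsByDistanceFrom P x σ)) ∧
    (¬ IsSingleCrossing P → OutputsNo s) := by
  have hm : (n + 2) * (t + 2) = n * t + 2 * n + 2 * t + 4 := by ring
  set m := (n + 2) * (t + 2) with hmdef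
  have hmm : m ≤ m * m := Nat.le_mul_self m
  have hnn : n * n ≤ m * m := Nat.mul_le_mul (by omega) (by omega)
  have hF : Fits w (64 * (m * m)) (n * t + t) := by
    refine ⟨by omega, le_trans ?_ hw⟩
    -- Addresses stay below `4 ^ 6 * m ^ 2`, and `m ≥ 4`; this is where the exponent 8 comes from.
    have h1 : 4 ^ 6 ≤ m ^ 6 := Nat.pow_le_pow_left (by omega) 6
    have h2 : 4 ^ 6 * (m * m) ≤ m ^ 6 * (m * m) := Nat.mul_le_mul_right _ h1
    have h3 : m ^ 8 = m ^ 6 * (m * m) := by ring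
    omega
  have hI := inputStore_input P (U := 64 * (m * m)) (B := n * t + t) (by omega) (by omega)
  obtain ⟨hs, hc1, hc2, hans⟩ := program_spec hI (by omega) (by omega) (by omega)
  set s1 : State := ⟨Function.update (Function.update (inputState P).reg 99 (n * t)) 99 (n * t + t),
    (inputState P).mem⟩ with hs1
  have hrep : Rep (n * t + t) (inputStore P) s1 := by
    refine ⟨fun x => ?_, by simp [hs1], fun _ _ => rfl, fun k hk i => ?_⟩
    · have := x.ctorIdx_lt
      simp only [hs1]
      rw [Function.update_of_ne (by omega), Function.update_of_ne (by omega)]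
      rfl
    · simp only [hs1, inputState, inputStore, if_neg hk]
      -- Array cells start above the `n * t` input words, so they are initially zero.
      rw [dif_neg (by omega)]
  have hlt : n * t + t < 2 ^ w := by have := hF.addr_lt; omega
  have e1 : Exec w (.seq (.op .mul 99 0 1) (.op .add 99 99 1)) (inputState P) (1 + 1) s1 := by
    have := Exec.seq (Exec.op (w := w) .mul 99 0 1 (inputState P)) (Exec.op .add 99 99 1 _)
    convert this using 2
    simp [BinOp.eval, inputState, Nat.mod_eq_of_lt hlt,
      Nat.mod_eq_of_lt (show n * t < 2 ^ w by omega)]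
  obtain ⟨s2, e2, hrep2, -⟩ := Cmd.compile_exec hF (by decide)
    (inputStore_bounded P (by omega) (by omega)) hs hrep
  refine ⟨_, s2, e1.seq e2, fun hn ht => ?_, fun h => ?_, fun h => ?_, fun h => ?_⟩
  · rw [Nat.add_comm]
    exact hc1 hn ht
  · have := hc2 h
    omega
  · obtain ⟨σ, ⟨hσ1, hσ2⟩, hσ⟩ := hans.1 h
    refine ⟨σ, ⟨(hrep2.reg .n).trans hσ1, fun i => ?_⟩, hσ⟩
    rw [hrep2.io _ (by have := i.is_lt; omega), hσ2]
  · exact (hrep2.reg .n).trans (hans.2 h)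

end

end SingleCrossing

theorem mainTheorem11 :
    -- recognition on the word RAM, with the time bound
    (∃ (p : WordRAM.Prog) (c C : ℕ), ∀ (n t w : ℕ) (P : SingleCrossing.Profile n t),
      ((n + 2) * (t + 2)) ^ c ≤ 2 ^ w →
      ∃ (k : ℕ) (s : WordRAM.State),
        WordRAM.Exec w p (SingleCrossing.inputState P) k s ∧
        (2 ≤ n → 1 ≤ t → (k : ℝ) ≤ (C : ℝ) * ((n : ℝ) * (t : ℝ) * Real.sqrt (Real.log (n : ℝ)))) ∧
        (n ≤ 1 ∨ t = 0 → k ≤ C * (t + 1)) ∧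
        (SingleCrossing.IsSingleCrossing P →
          ∃ σ : Equiv.Perm (Fin t),
            SingleCrossing.OutputsYes s σ ∧ SingleCrossing.Witnesses P σ ∧
            (1 ≤ t → ∃ x : Fin t, SingleCrossing.IsFarthestFromFirst P x ∧
              SingleCrossing.SortsByDistanceFrom P x σ)) ∧
        (¬ SingleCrossing.IsSingleCrossing P → SingleCrossing.OutputsNo s)) ∧
    -- the witnessing list is unique up to reversal
    (∀ (n t : ℕ) (P : SingleCrossing.Profile n t) (σ τ : Equiv.Perm (Fin t)),
      SingleCrossing.Witnesses P σ → SingleCrossing.Witnesses P τ →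
        (∀ i : Fin t, P (σ i) = P (τ i)) ∨ (∀ i : Fin t, P (σ i) = P (τ i.rev))) ∧
    -- sorting by the distance from a farthest order, then checking distances, is correct
    (∀ (n t : ℕ) (P : SingleCrossing.Profile n t) (x : Fin t) (σ : Equiv.Perm (Fin t)),
      SingleCrossing.IsFarthestFromFirst P x → SingleCrossing.SortsByDistanceFrom P x σ →
        (SingleCrossing.IsSingleCrossing P ↔ SingleCrossing.Witnesses P σ) ∧
        (SingleCrossing.Witnesses P σ ↔
          SingleCrossing.PassesDistanceCheck fun i => P (σ i))) := by
  refine ⟨⟨.seq (.seq (.op .mul 99 0 1) (.op .add 99 99 1)) SingleCrossing.program.compile, 8,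
    1000000, fun n t w P hw => ?_⟩, fun n t P σ τ hσ hτ => SingleCrossing.witnesses_unique hσ hτ,
    fun n t P x σ hx hσ => ⟨⟨fun h => h.witnesses hx hσ, fun h => ⟨σ, h⟩⟩,
      SingleCrossing.isSingleCrossingList_iff_passesDistanceCheck⟩⟩
  obtain ⟨k, s, he, h1, h2, h3, h4⟩ := SingleCrossing.program_exec P hw
  refine ⟨k, s, he, fun hn ht => (h1 hn ht).trans ?_, fun h => (h2 h).trans ?_, h3, h4⟩
  · push_cast
    gcongr
    norm_num
  · gcongr
    norm_num
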